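/- Let $\mathbb T^3$ be the flat 3-torus, $n\in\mathbb N$, and $D_{ij}=D_{ji}>0$ for $i\neq j$. Let $\mathbf c^0=(c_1^0,\dots,c_n^0)$ be measurable on $\mathbb T^3$ with $c^0_i\ge 0$ and $\sum_i c_i^0=1$ a.e. A renormalized solution of the Maxwell–Stefan system with initial data $\mathbf c^0$ is a family of measurable concentrations $c_i$ and velocities $u_i$ ($i=1,\dots,n$) on $\mathbb T^3\times(0,\infty)$ such that, for every $i$: (i) $0\le c_i\le 1$ and $\sum_j c_j=1$ a.e.; (ii) $\nabla\sqrt{c_i}$ and $\sqrt{c_i}\,u_i$ belong to $L^2_{\rm loc}(\mathbb T^3\times(0,\infty))$, where $\nabla$ is the weak gradient in $x$; (iii) for every $\beta\in C^2([0,\infty))$ and $\phi\in C_c^\infty(\mathbb T^3\times[0,\infty))$ the following integrals exist and $$\int_{\mathbb T^3}\beta(c_i^0)\phi(x,0)\,dx+\int_0^\infty\!\!\int_{\mathbb T^3}\Big(\beta(c_i)\partial_t\phi+\sqrt{c_i}\,\beta'(c_i)\sqrt{c_i}u_i\cdot\nabla\phi+2c_i\beta''(c_i)\nabla\sqrt{c_i}\cdot\sqrt{c_i}u_i\,\phi\Big)dx\,dt=0,$$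 and $-\sum_{j\ne i}\frac{c_j c_iu_i-c_i c_ju_j}{D_{ij}}=\nabla c_i$, $\ \sum_j c_ju_j=0$ a.e.; (iv) $\operatorname{ess\,lim}_{t\to0}\int_{\mathbb T^3}|\beta(c_i(x,t))-\beta(c_i^0(x))|\,dx=0$ for every $\beta\in C([0,\infty))$. Let $(\mathbf c,\mathbf u)$ and $(\bar{\mathbf c},\bar{\mathbf u})$ be two renormalized solutions with the same coefficients $D_{ij}$ and the same initial data $\mathbf c^0$. Then $c_i$ and $\bar c_i$ have representatives in $C([0,\infty);L^2(\mathbb T^3))$, which are used below to evaluate them at time $T$. For every $\delta>0$ and $T>0$ the function $\ln(c_i+\delta)-\ln(\bar c_i+\delta)$ has a weak gradient in $x$ which lies in $L^2(\mathbb T^3\times(0,T))$, the functions $\frac{c_iu_i}{c_i+\delta}$ and $\frac{\bar c_i\bar u_i}{\bar c_i+\delta}$ lie in $L^2(\mathbb T^3\times(0,T))$, all integrands below are integrable, and $$\int_{\mathbb T^3}\sum_{i=1}^n\big(\ln(c_i+\delta)-\ln(\bar c_i+\delta)\big)(c_i-\bar c_i)\,dx\,\Big|_{t=T}=\sum_{i=1}^n\int_0^T\!\!\int_{\mathbb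 T^3}(c_i+\bar c_i+2\delta)\,\nabla\big(\ln(c_i+\delta)-\ln(\bar c_i+\delta)\big)\cdot\Big(\frac{c_iu_i}{c_i+\delta}-\frac{\bar c_i\bar u_i}{\bar c_i+\delta}\Big)dx\,dt.$$ -/

import Mathlib

open MeasureTheory Filter Set Topology
open scoped ContDiff

noncomputable section

namespace MaxwellStefan

/-- The flat torus `𝕋³ = (ℝ/ℤ)³`, with its invariant measure `volume` (total mass one). -/
abbrev Torus3 : Type := UnitAddTorus (Fin 3)

/-- Vectors of `ℝ³` with the Euclidean inner product. -/
abbrev Vec3 : Type := EuclideanSpace ℝ (Fin 3)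

/-- The measure `dx dt` on `𝕋³ × I`. A point of space-time is written as a pair `(t, x)`. -/
def cyl (I : Set ℝ) : Measure (ℝ × Torus3) :=
  ((volume : Measure ℝ).restrict I).prod (volume : Measure Torus3)

/-- The covering map `ℝ³ → 𝕋³`. -/
def torusProj (y : Fin 3 → ℝ) : Torus3 := fun j => (y j : UnitAddCircle)

/-- Smooth compactly supported functions on `ℝ × 𝕋³`; smoothness is smoothness of the lift to
`ℝ × ℝ³`. Their restrictions to `t ≥ 0` are the test functions of class `C_c^∞(𝕋³ × [0,∞))`. -/
structure IsTestFunction (φ : ℝ × Torus3 → ℝ) : Prop where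
  smooth : ContDiff ℝ ∞ (fun q : ℝ × (Fin 3 → ℝ) => φ (q.1, torusProj q.2))
  hasCompactSupport : HasCompactSupport φ

/-- `∂_t φ`. -/
def timeDeriv (φ : ℝ × Torus3 → ℝ) (p : ℝ × Torus3) : ℝ :=
  deriv (fun t : ℝ => φ (t, p.2)) p.1

/-- `∇φ`: the vector of the derivatives of `φ` along the three coordinate directions of `𝕋³`. -/
def spaceGrad (φ : ℝ × Torus3 → ℝ) (p : ℝ × Torus3) : Vec3 :=
  WithLp.toLp 2 fun j : Fin 3 =>
    deriv (fun h : ℝ => φ (p.1, p.2 + Pi.single j (h : UnitAddCircle))) 0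

/-- `g` is the weak (distributional) spatial gradient of `f` on `𝕋³ × (0,∞)`, both functions being
locally integrable there. -/
structure HasWeakGradient (f : ℝ × Torus3 → ℝ) (g : ℝ × Torus3 → Vec3) : Prop where
  integrable_fun : ∀ s T : ℝ, 0 < s → s < T → Integrable f (cyl (Ioo s T))
  integrable_grad : ∀ s T : ℝ, 0 < s → s < T → Integrable g (cyl (Ioo s T))
  integral_eq : ∀ φ : ℝ × Torus3 → ℝ, IsTestFunction φ → tsupport φ ⊆ Ioi (0 : ℝ) ×ˢ univ →
    ∫ p, f p • spaceGrad φ p ∂(cyl (Ioi 0)) = - ∫ p, φ p • g p ∂(cyl (Ioi 0))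

/-- `f ∈ L²_loc(𝕋³ × (0,∞))`. -/
def LocL2 (f : ℝ × Torus3 → Vec3) : Prop :=
  ∀ s T : ℝ, 0 < s → s < T → MemLp f 2 (cyl (Ioo s T))

/-- Admissible initial concentrations: measurable, nonnegative, summing up to one
(hence bounded by one and of finite entropy). -/
structure IsInitialDatum {n : ℕ} (c0 : Fin n → Torus3 → ℝ) : Prop where
  measurable : ∀ i, AEStronglyMeasurable (c0 i) volume
  nonneg : ∀ i, ∀ᵐ x, 0 ≤ c0 i x
  sum_eq_one : ∀ᵐ x, ∑ i, c0 i x = 1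

/-- The renormalized weak formulation for one component with datum `c0`, concentration `c`,
velocity `u`, `g = ∇√c`, renormalization `β` and test function `φ`; the integrals
whose integrands are not bounded are required to exist. The derivatives of `β` are the one-sided
ones at the end point of `[0,∞)`. -/
def RenormalizedIdentity (c0 : Torus3 → ℝ) (c : ℝ × Torus3 → ℝ) (u g : ℝ × Torus3 → Vec3)
    (β : ℝ → ℝ) (φ : ℝ × Torus3 → ℝ) : Prop :=
  Integrable (fun p => Real.sqrt (c p) * derivWithin β (Ici 0) (c p) *
      inner ℝ (Real.sqrt (c p) • u p) (spaceGrad φ p)) (cyl (Ioi 0)) ∧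
  Integrable (fun p => c p * iteratedDerivWithin 2 β (Ici 0) (c p) *
      inner ℝ (g p) (Real.sqrt (c p) • u p) * φ p) (cyl (Ioi 0)) ∧
  (∫ x, β (c0 x) * φ (0, x)) + (∫ p, β (c p) * timeDeriv φ p ∂(cyl (Ioi 0)))
    + (∫ p, Real.sqrt (c p) * derivWithin β (Ici 0) (c p) *
        inner ℝ (Real.sqrt (c p) • u p) (spaceGrad φ p) ∂(cyl (Ioi 0)))
    + 2 * (∫ p, c p * iteratedDerivWithin 2 β (Ici 0) (c p) *
        inner ℝ (g p) (Real.sqrt (c p) • u p) * φ p ∂(cyl (Ioi 0))) = 0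

/-- The conditions on a renormalized solution `(c, u)` of the Maxwell-Stefan system with diffusion
coefficients `D` and initial datum `c0`, where `g i` stands for `∇√(c i)`. -/
structure IsRenormalizedSolutionWith {n : ℕ} (D : Fin n → Fin n → ℝ) (c0 : Fin n → Torus3 → ℝ)
    (c : Fin n → ℝ × Torus3 → ℝ) (u g : Fin n → ℝ × Torus3 → Vec3) : Prop where
  measurable : ∀ i, AEStronglyMeasurable (c i) (cyl (Ioi 0))
  bounds : ∀ i, ∀ᵐ p ∂(cyl (Ioi 0)), 0 ≤ c i p ∧ c i p ≤ 1
  sum_eq_one : ∀ᵐ p ∂(cyl (Ioi 0)), ∑ i, c i p = 1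
  grad_sqrt : ∀ i, HasWeakGradient (fun p => Real.sqrt (c i p)) (g i)
  grad_sqrt_locL2 : ∀ i, LocL2 (g i)
  sqrt_mul_vel_locL2 : ∀ i, LocL2 (fun p => Real.sqrt (c i p) • u i p)
  renormalized : ∀ i, ∀ β : ℝ → ℝ, ContDiffOn ℝ 2 β (Ici 0) →
    ∀ φ : ℝ × Torus3 → ℝ, IsTestFunction φ →
      RenormalizedIdentity (c0 i) (c i) (u i) (g i) β φ
  /- the force-flux relation `-∑_{j ≠ i} (c_j J_i - c_i J_j) / D_ij = ∇c_i` with `J_i = c_i u_i` -/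
  linear_system : ∀ i, HasWeakGradient (c i) (fun p =>
    - ∑ j ∈ Finset.univ.erase i,
      (D i j)⁻¹ • (c j p • (c i p • u i p) - c i p • (c j p • u j p)))
  flux_sum : ∀ᵐ p ∂(cyl (Ioi 0)), ∑ i, c i p • u i p = 0
  /- `c` is a class of functions up to null sets, so the limit `t → 0` is an essential one -/
  initial : ∀ i, ∀ β : ℝ → ℝ, ContinuousOn β (Ici 0) →
    Tendsto (fun t : ℝ => ∫ x, |β (c i (t, x)) - β (c0 i x)|)
      (𝓝[>] (0 : ℝ) ⊓ ae (volume : Measure ℝ)) (𝓝 0)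

/-- `(c, u)` is a renormalized solution of the Maxwell-Stefan system with initial datum `c0`. -/
def IsRenormalizedSolution {n : ℕ} (D : Fin n → Fin n → ℝ) (c0 : Fin n → Torus3 → ℝ)
    (c : Fin n → ℝ × Torus3 → ℝ) (u : Fin n → ℝ × Torus3 → Vec3) : Prop :=
  ∃ g : Fin n → ℝ × Torus3 → Vec3, IsRenormalizedSolutionWith D c0 c u g

/-- `C` is the representative of `c` in `C⁰([0,∞); L²(𝕋³))`, which gives a meaning to the
value of `c` at every time. -/
structure IsTimeContinuousRep (c : ℝ × Torus3 → ℝ)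
    (C : ℝ → Lp ℝ 2 (volume : Measure Torus3)) : Prop where
  continuousOn : ContinuousOn C (Ici 0)
  ae_eq : ∀ᵐ t ∂((volume : Measure ℝ).restrict (Ioi 0)),
    (C t : Torus3 → ℝ) =ᵐ[volume] fun x => c (t, x)

/-- The regularized symmetrized relative entropy
`∫_{𝕋³} ∑ i, (ln (a_i + δ) - ln (b_i + δ)) (a_i - b_i) dx`. -/
def symRelEntropy {n : ℕ} (δ : ℝ) (a b : Fin n → Torus3 → ℝ) : ℝ :=
  ∫ x, ∑ i, (Real.log (a i x + δ) - Real.log (b i x + δ)) * (a i x - b i x)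

end MaxwellStefan

end

open MaxwellStefan

/-! Taking β = id in the renormalized equation shows that each concentration solves a linear
conservation law ∂ₜc + div J = 0 with J = cu. The claim is then the chain rule for ∫ (L(a) - L(b))(a
- b) along two such solutions a, b with L = ln(· + δ). The derivative of the integrand with respect
to a is L'(a)(a - b) + L(a) - L(b). For this particular L the gradient of that derivative collapses
to (a + b + 2δ)/(a + δ) · ∇(L(a) - L(b)); the derivative with respect to b behaves in the same way,
with the opposite sign and b + δ in the denominator. Pairing the two gradients with the two fluxes
yields the stated integrand (`entropyFlux_smoothLog`).

What needs proof is that this computation is legitimate for weak solutions and down to t = 0.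

Integrability near t = 0: the definition gives √c u in L² only away from the initial time.
Renormalizing with the regularized entropy (x + ε) log (x + ε) gives an entropy balance whose left
side is bounded uniformly in ε. The Maxwell-Stefan relations, together with ∑ c = 1 and ∑ c u = 0,
make the dissipation control ∑ c |u|² (`sum_inner_force_le`). Hence √c u, and with it cu and ∇c,
lies in L² up to t = 0 (`memLp_sqrt_mul_vel`, `isFluxSolution`).

Chain rule: solutions are mollified in x only. For a fixed point y the mollified solution is
absolutely continuous in time, so the fundamental theorem of calculus applies. Fubini and
integration by parts in space give an exact identity for mollified solutions
(`integral_symEntropy_evolve`). Values stay in [0,1], so all coefficients are bounded, while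
gradients and fluxes converge in L²; this allows passage to the limit (`integral_symEntropy`). The
initial term vanishes because the data coincide.

Continuity in time comes from the same mollified identity: with L = id, applied to two
mollifications of one solution, it shows that the mollifications are Cauchy in L² uniformly on
bounded time intervals (`exists_timeContinuousRep`). -/

namespace MaxwellStefan

/-! ### Calculus on the torus -/

instance : IsProbabilityMeasure (volume : Measure UnitAddCircle) :=
  ⟨by simp⟩

instance : IsProbabilityMeasure (volume : Measure Torus3) := by
  rw [show (volume : Measure Torus3) = Measure.pi fun _ => volume from rfl]
  infer_instance

instance : Measure.IsNegInvariant (volume : Measure Torus3) :=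
  Measure.IsAddHaarMeasure.isNegInvariant_of_regular _

theorem torusProj_isOpenQuotientMap : IsOpenQuotientMap torusProj :=
  IsOpenQuotientMap.piMap (f := fun _ : Fin 3 => ((↑) : ℝ → UnitAddCircle))
    fun _ => QuotientAddGroup.isOpenQuotientMap_mk

theorem cylProj_isOpenQuotientMap :
    IsOpenQuotientMap (fun q : ℝ × (Fin 3 → ℝ) => (q.1, torusProj q.2)) :=
  IsOpenQuotientMap.prodMap IsOpenQuotientMap.id torusProj_isOpenQuotientMap

theorem torusProj_add (y z : Fin 3 → ℝ) : torusProj (y + z) = torusProj y + torusProj z := by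
  ext j; simp [torusProj]

theorem torusProj_sub (y z : Fin 3 → ℝ) : torusProj (y - z) = torusProj y - torusProj z := by
  ext j; simp [torusProj]

theorem torusProj_single (j : Fin 3) (h : ℝ) :
    torusProj (Pi.single j h) = Pi.single j (h : UnitAddCircle) := by
  ext k
  by_cases hk : k = j
  · subst hk; simp [torusProj]
  · simp [torusProj, Pi.single_eq_of_ne hk]

/-- `P` is a `C¹` function on the torus with gradient `P'`. -/
structure HasTorusGrad (P : Torus3 → ℝ) (P' : Torus3 → Vec3) : Prop where
  cont : Continuous P
  cont_grad : Continuous P'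
  deriv : ∀ x j, HasDerivAt (fun h : ℝ => P (x + Pi.single j (h : UnitAddCircle))) (P' x j) 0

theorem single_add_coe (j : Fin 3) (h k : ℝ) :
    (Pi.single j ((h + k : ℝ) : UnitAddCircle) : Torus3)
      = Pi.single j (h : UnitAddCircle) + Pi.single j (k : UnitAddCircle) := by
  rw [AddCircle.coe_add, Pi.single_add]

namespace HasTorusGrad

variable {P Q : Torus3 → ℝ} {P' Q' : Torus3 → Vec3}

/-- The structure records the derivative at `h = 0` only; translating the base point gives it at
every `h`. -/
theorem hasDerivAt (hP : HasTorusGrad P P') (x : Torus3) (j : Fin 3) (h : ℝ) :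
    HasDerivAt (fun h : ℝ => P (x + Pi.single j (h : UnitAddCircle)))
      (P' (x + Pi.single j (h : UnitAddCircle)) j) h := by
  have h1 := hP.deriv (x + Pi.single j (h : UnitAddCircle)) j
  have h2 : HasDerivAt (fun k : ℝ => k - h) 1 h := (hasDerivAt_id h).sub_const h
  have h1' : HasDerivAt (fun k : ℝ => P (x + Pi.single j (h : UnitAddCircle)
      + Pi.single j (k : UnitAddCircle))) (P' (x + Pi.single j (h : UnitAddCircle)) j) (h - h) := by
    simpa using h1
  have h3 := HasDerivAt.comp h (h := fun k : ℝ => k - h) h1' h2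
  rw [mul_one] at h3
  refine h3.congr_of_eventuallyEq (Eventually.of_forall fun k => ?_)
  simp only [Function.comp]
  rw [add_assoc, ← single_add_coe, add_sub_cancel]

theorem grad_eq (hP : HasTorusGrad P P') (x : Torus3) :
    WithLp.toLp 2 (fun j : Fin 3 =>
      _root_.deriv (fun h : ℝ => P (x + Pi.single j (h : UnitAddCircle))) 0) = P' x := by
  ext j
  exact (hP.deriv x j).deriv

theorem const (a : ℝ) : HasTorusGrad (fun _ => a) (fun _ => 0) :=
  ⟨continuous_const, continuous_const, fun _ _ => by simpa using hasDerivAt_const (0 : ℝ) a⟩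

theorem add (hP : HasTorusGrad P P') (hQ : HasTorusGrad Q Q') :
    HasTorusGrad (fun x => P x + Q x) (fun x => P' x + Q' x) :=
  ⟨hP.cont.add hQ.cont, hP.cont_grad.add hQ.cont_grad, fun x j => (hP.deriv x j).add (hQ.deriv x j)⟩

theorem sub (hP : HasTorusGrad P P') (hQ : HasTorusGrad Q Q') :
    HasTorusGrad (fun x => P x - Q x) (fun x => P' x - Q' x) :=
  ⟨hP.cont.sub hQ.cont, hP.cont_grad.sub hQ.cont_grad, fun x j => (hP.deriv x j).sub (hQ.deriv x j)⟩

theorem mul (hP : HasTorusGrad P P') (hQ : HasTorusGrad Q Q') :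
    HasTorusGrad (fun x => P x * Q x) (fun x => Q x • P' x + P x • Q' x) :=
  ⟨hP.cont.mul hQ.cont, (hQ.cont.smul hP.cont_grad).add (hP.cont.smul hQ.cont_grad), fun x j => by
    refine ((hP.deriv x j).mul (hQ.deriv x j)).congr_deriv ?_
    rw [AddCircle.coe_zero, Pi.single_zero, add_zero]
    simp [mul_comm]⟩

theorem const_mul (a : ℝ) (hP : HasTorusGrad P P') :
    HasTorusGrad (fun x => a * P x) (fun x => a • P' x) :=
  ⟨continuous_const.mul hP.cont, hP.cont_grad.const_smul a,
    fun x j => by simpa using (hP.deriv x j).const_mul a⟩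

theorem comp (hP : HasTorusGrad P P') {Φ : ℝ → ℝ} (hΦ : ContDiff ℝ 1 Φ) :
    HasTorusGrad (fun x => Φ (P x)) (fun x => _root_.deriv Φ (P x) • P' x) :=
  ⟨hΦ.continuous.comp hP.cont,
    ((hΦ.continuous_deriv le_rfl).comp hP.cont).smul hP.cont_grad, fun x j => by
    have h1 : HasDerivAt Φ (_root_.deriv Φ (P x)) (P (x + Pi.single j ((0 : ℝ) : UnitAddCircle))) := by
      simpa using (hΦ.differentiable one_ne_zero (P x)).hasDerivAt
    simpa [Function.comp_def] using h1.comp (0 : ℝ) (hP.deriv x j)⟩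

theorem comp_sub_left (hP : HasTorusGrad P P') (y : Torus3) :
    HasTorusGrad (fun x => P (y - x)) (fun x => - P' (y - x)) :=
  ⟨hP.cont.comp (continuous_const.sub continuous_id),
    (hP.cont_grad.comp (continuous_const.sub continuous_id)).neg, fun x j => by
    have h2 : HasDerivAt (fun k : ℝ => -k) (-1) 0 := (hasDerivAt_id 0).neg
    have h1 : HasDerivAt (fun h : ℝ => P (y - x + Pi.single j (h : UnitAddCircle)))
        (P' (y - x) j) (-0) := by simpa using hP.deriv (y - x) j
    have h3 := h1.comp (0 : ℝ) h2
    simp only [mul_neg, mul_one] at h3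
    refine (h3.congr_of_eventuallyEq (Eventually.of_forall fun k => ?_))
    simp only [Function.comp, AddCircle.coe_neg, Pi.single_neg]
    congr 1
    abel⟩

theorem exists_bound_grad (hP : HasTorusGrad P P') : ∃ M, 0 ≤ M ∧ ∀ x, ‖P' x‖ ≤ M := by
  obtain ⟨M, hM⟩ := isCompact_univ.exists_bound_of_continuousOn hP.cont_grad.continuousOn
  exact ⟨M, (norm_nonneg _).trans (hM 0 (mem_univ _)), fun x => hM x (mem_univ _)⟩

end HasTorusGrad

theorem _root_.Continuous.integrable_torus {E : Type*} [NormedAddCommGroup E]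
    {f : Torus3 → E} (hf : Continuous f) : Integrable f (volume : Measure Torus3) :=
  hf.integrable_of_hasCompactSupport (HasCompactSupport.of_compactSpace f)

theorem abs_coord_le (v : Vec3) (j : Fin 3) : |v j| ≤ ‖v‖ := by
  simpa using PiLp.norm_apply_le v j

theorem continuous_coord (j : Fin 3) : Continuous fun v : Vec3 => v j :=
  (EuclideanSpace.proj (𝕜 := ℝ) j).continuous

namespace HasTorusGrad

variable {P Q : Torus3 → ℝ} {P' Q' : Torus3 → Vec3}

/-- By invariance of the measure the integral of a translate of `P` does not depend on the
translation; differentiating under the integral sign gives the claim. -/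
theorem integral_grad (hP : HasTorusGrad P P') (j : Fin 3) : ∫ x, P' x j = 0 := by
  have e (h : ℝ) : Continuous fun x : Torus3 => x + Pi.single j (h : UnitAddCircle) :=
    continuous_add_const _
  obtain ⟨M, hM0, hM⟩ := hP.exists_bound_grad
  let s : ℝ → Torus3 := fun h => Pi.single j (h : UnitAddCircle)
  have h := (hasDerivAt_integral_of_dominated_loc_of_deriv_le (μ := (volume : Measure Torus3))
    (F := fun h x => P (x + s h)) (F' := fun h x => P' (x + s h) j) (x₀ := (0 : ℝ))
    (s := univ) (bound := fun _ => M) univ_mem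
    (Eventually.of_forall fun h => (hP.cont.comp (e h)).aestronglyMeasurable)
    ((hP.cont.comp (e 0)).integrable_torus)
    (((continuous_coord j).comp (hP.cont_grad.comp (e 0))).aestronglyMeasurable)
    (Eventually.of_forall fun x h _ => (abs_coord_le _ _).trans (hM _))
    (integrable_const M)
    (Eventually.of_forall fun x h _ => hP.hasDerivAt x j h)).2
  have h2 : (fun h : ℝ => ∫ x, P (x + s h)) = fun _ => ∫ x, P x := by
    funext h
    exact integral_add_right_eq_self P (s h)
  rw [h2, integral_add_right_eq_self (fun x => P' x j) (s 0)] at h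
  exact h.unique (hasDerivAt_const (0 : ℝ) _)

/-- Integration by parts on the torus. -/
theorem integral_mul_grad (hP : HasTorusGrad P P') (hQ : HasTorusGrad Q Q') (j : Fin 3) :
    ∫ x, P x * Q' x j = - ∫ x, P' x j * Q x := by
  have h := (hP.mul hQ).integral_grad j
  have i1 : Integrable (fun x => P x * Q' x j) :=
    (hP.cont.mul ((continuous_coord j).comp hQ.cont_grad)).integrable_torus
  have i2 : Integrable (fun x => P' x j * Q x) :=
    (((continuous_coord j).comp hP.cont_grad).mul hQ.cont).integrable_torus
  have h2 : ∫ x, P' x j * Q x + P x * Q' x j = 0 := by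
    rw [← h]; congr 1; funext x; simp [mul_comm]
  rw [integral_add i2 i1] at h2
  linarith

end HasTorusGrad

theorem integral_coord {α : Type*} [MeasurableSpace α] {μ : Measure α} {f : α → Vec3}
    (hf : Integrable f μ) (j : Fin 3) : (∫ x, f x ∂μ) j = ∫ x, f x j ∂μ :=
  ((EuclideanSpace.proj (𝕜 := ℝ) j).integral_comp_comm hf).symm

theorem HasTorusGrad.integral_smul_grad {P Q : Torus3 → ℝ} {P' Q' : Torus3 → Vec3}
    (hP : HasTorusGrad P P') (hQ : HasTorusGrad Q Q') :
    ∫ x, P x • Q' x = - ∫ x, Q x • P' x := by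
  ext j
  rw [integral_coord (f := fun x => P x • Q' x) (hP.cont.smul hQ.cont_grad).integrable_torus,
    PiLp.neg_apply,
    integral_coord (f := fun x => Q x • P' x) (hQ.cont.smul hP.cont_grad).integrable_torus]
  simpa [mul_comm] using hP.integral_mul_grad hQ j

/-! ### Test functions -/

namespace IsTestFunction

variable {φ : ℝ × Torus3 → ℝ}

theorem continuous (hφ : IsTestFunction φ) : Continuous φ :=
  cylProj_isOpenQuotientMap.isQuotientMap.continuous_iff.2 hφ.smooth.continuous

theorem hasDerivAt_lift (hφ : IsTestFunction φ) (t : ℝ) (z : Fin 3 → ℝ) (j : Fin 3) :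
    HasDerivAt (fun h : ℝ => φ (t, torusProj z + Pi.single j (h : UnitAddCircle)))
      (fderiv ℝ (fun q : ℝ × (Fin 3 → ℝ) => φ (q.1, torusProj q.2)) (t, z) (0, Pi.single j 1)) 0 := by
  have h1 := (hφ.smooth.differentiable (by simp) (t, z)).hasFDerivAt
  have h2 : HasDerivAt (fun h : ℝ => ((t, z) : ℝ × (Fin 3 → ℝ)) + h • (0, Pi.single j 1))
      (0, Pi.single j 1) 0 := by
    simpa using ((hasDerivAt_id (0 : ℝ)).smul_const ((0, Pi.single j 1) : ℝ × (Fin 3 → ℝ))).const_add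
      ((t, z) : ℝ × (Fin 3 → ℝ))
  have h1' : HasFDerivAt (fun q : ℝ × (Fin 3 → ℝ) => φ (q.1, torusProj q.2))
    (fderiv ℝ (fun q : ℝ × (Fin 3 → ℝ) => φ (q.1, torusProj q.2)) (t, z))
      (((t, z) : ℝ × (Fin 3 → ℝ)) + (0 : ℝ) • (0, Pi.single j 1)) := by simpa using h1
  have h3 := h1'.comp_hasDerivAt 0 h2
  refine h3.congr_of_eventuallyEq (Eventually.of_forall fun h => ?_)
  simp only [Function.comp, Prod.smul_mk, smul_zero, Prod.mk_add_mk, add_zero]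
  rw [torusProj_add, ← torusProj_single, ← Pi.single_smul, smul_eq_mul, mul_one]

theorem spaceGrad_lift (hφ : IsTestFunction φ) (t : ℝ) (z : Fin 3 → ℝ) (j : Fin 3) :
    spaceGrad φ (t, torusProj z) j =
      fderiv ℝ (fun q : ℝ × (Fin 3 → ℝ) => φ (q.1, torusProj q.2)) (t, z) (0, Pi.single j 1) :=
  (hφ.hasDerivAt_lift t z j).deriv

theorem continuous_spaceGrad (hφ : IsTestFunction φ) : Continuous (spaceGrad φ) := by
  rw [cylProj_isOpenQuotientMap.isQuotientMap.continuous_iff]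
  refine (PiLp.continuous_toLp 2 _).comp (continuous_pi fun j => ?_)
  have : (fun q : ℝ × (Fin 3 → ℝ) => spaceGrad φ (q.1, torusProj q.2) j) = fun q =>
      fderiv ℝ (fun q : ℝ × (Fin 3 → ℝ) => φ (q.1, torusProj q.2)) q (0, Pi.single j 1) := by
    funext q; exact hφ.spaceGrad_lift q.1 q.2 j
  exact this ▸ (hφ.smooth.continuous_fderiv (by simp)).clm_apply continuous_const

theorem hasTorusGrad (hφ : IsTestFunction φ) (t : ℝ) :
    HasTorusGrad (fun x => φ (t, x)) (fun x => spaceGrad φ (t, x)) :=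
  ⟨hφ.continuous.comp (by fun_prop), hφ.continuous_spaceGrad.comp (by fun_prop), fun x j => by
    obtain ⟨z, rfl⟩ := torusProj_isOpenQuotientMap.surjective x
    rw [hφ.spaceGrad_lift]
    exact hφ.hasDerivAt_lift t z j⟩

theorem spaceGrad_eq_zero {φ : ℝ × Torus3 → ℝ} {t : ℝ} (h : ∀ x, φ (t, x) = 0) (x : Torus3) :
    spaceGrad φ (t, x) = 0 := by
  ext j
  simp [spaceGrad, h]

end IsTestFunction

/-- Smooth functions on the torus. -/
def TorusSmooth (K : Torus3 → ℝ) : Prop := ContDiff ℝ ∞ fun z : Fin 3 → ℝ => K (torusProj z)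

/-- The gradient of a function on the torus. -/
noncomputable def torusGrad (K : Torus3 → ℝ) (x : Torus3) : Vec3 :=
  WithLp.toLp 2 fun j : Fin 3 => deriv (fun h : ℝ => K (x + Pi.single j (h : UnitAddCircle))) 0

/-- Testing a weak identity with `ψ(t) K(y - x)` turns it into a statement, weak in time only, about
convolutions with `K` evaluated at `y`. -/
theorem TorusSmooth.isTestFunction {K : Torus3 → ℝ} (hK : TorusSmooth K) {ψ : ℝ → ℝ}
    (hψ : ContDiff ℝ ∞ ψ) (hψc : HasCompactSupport ψ) (y : Torus3) :
    IsTestFunction (fun p => ψ p.1 * K (y - p.2)) := by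
  refine ⟨?_, ?_⟩
  · obtain ⟨z, rfl⟩ := torusProj_isOpenQuotientMap.surjective y
    have : (fun q : ℝ × (Fin 3 → ℝ) => ψ q.1 * K (torusProj z - torusProj q.2)) =
        fun q => ψ q.1 * (fun z => K (torusProj z)) (z - q.2) := by
      funext q; simp only [torusProj_sub]
    rw [this]
    exact (hψ.comp contDiff_fst).mul
      (ContDiff.comp (g := fun z : Fin 3 → ℝ => K (torusProj z)) hK
        (contDiff_const.sub contDiff_snd))
  · refine HasCompactSupport.intro (hψc.isCompact.prod isCompact_univ) fun p hp => ?_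
    have : p.1 ∉ tsupport ψ := fun h => hp ⟨h, mem_univ _⟩
    simp [image_eq_zero_of_notMem_tsupport this]

theorem TorusSmooth.hasTorusGrad {K : Torus3 → ℝ} (hK : TorusSmooth K) :
    HasTorusGrad K (torusGrad K) := by
  obtain ⟨ψ, hψ⟩ : ∃ ψ : ContDiffBump (0 : ℝ), True := ⟨⟨1, 2, by norm_num, by norm_num⟩, trivial⟩
  -- At time `0` the bump equals one, so the test function with `y = 0` is `x ↦ K (0 - x)`; a second
  -- reflection recovers `K`.
  have h := ((hK.isTestFunction ψ.contDiff ψ.hasCompactSupport 0).hasTorusGrad 0).comp_sub_left 0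
  have h1 : (fun x : Torus3 => (ψ : ℝ → ℝ) 0 * K (0 - (0 - x))) = K := by
    funext x
    rw [ψ.eventuallyEq_one.eq_of_nhds]
    simp
  simp only [h1] at h
  have h2 : torusGrad K = _ := funext fun x => h.grad_eq x
  rw [h2]
  exact h

theorem spaceGrad_mul_kernel {K : Torus3 → ℝ} (hK : TorusSmooth K) (ψ : ℝ → ℝ) (y : Torus3)
    (p : ℝ × Torus3) :
    spaceGrad (fun p => ψ p.1 * K (y - p.2)) p = - ψ p.1 • torusGrad K (y - p.2) := by
  have := ((hK.hasTorusGrad.comp_sub_left y).const_mul (ψ p.1)).grad_eq p.2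
  simpa [spaceGrad] using this

theorem TorusSmooth.const (a : ℝ) : TorusSmooth fun _ => a := contDiff_const

theorem torusGrad_const (a : ℝ) : torusGrad (fun _ => a) = 0 := by
  funext x
  exact (HasTorusGrad.const a).grad_eq x

theorem timeDeriv_mul_kernel {K : Torus3 → ℝ} {ψ : ℝ → ℝ} (hψ : ContDiff ℝ ∞ ψ)
    (y : Torus3) (p : ℝ × Torus3) :
    timeDeriv (fun p => ψ p.1 * K (y - p.2)) p = deriv ψ p.1 * K (y - p.2) :=
  ((hψ.differentiable (by simp) p.1).hasDerivAt.mul_const (K (y - p.2))).deriv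

theorem tsupport_mul_kernel {K : Torus3 → ℝ} {ψ : ℝ → ℝ} (y : Torus3) :
    tsupport (fun p : ℝ × Torus3 => ψ p.1 * K (y - p.2)) ⊆ tsupport ψ ×ˢ univ := by
  refine closure_minimal (fun p hp => ⟨subset_tsupport _ fun h => hp ?_, mem_univ _⟩)
    ((isClosed_tsupport ψ).prod isClosed_univ)
  simp [h]

/-! ### Convolution on the torus -/

theorem Continuous.exists_bound_torus {E : Type*} [NormedAddCommGroup E] {K : Torus3 → E} (hK : Continuous K) :
    ∃ M, 0 ≤ M ∧ ∀ x, ‖K x‖ ≤ M := by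
  obtain ⟨M, hM⟩ := isCompact_univ.exists_bound_of_continuousOn hK.continuousOn
  exact ⟨M, (norm_nonneg _).trans (hM 0 (mem_univ _)), fun x => hM x (mem_univ _)⟩

section Conv

variable {E : Type*} [NormedAddCommGroup E] [NormedSpace ℝ E]

/-- Convolution on the torus. -/
noncomputable def torusConv (K : Torus3 → ℝ) (f : Torus3 → E) (y : Torus3) : E :=
  ∫ x, K (y - x) • f x

/-- Convolution in the space variable. -/
noncomputable def spaceConv (K : Torus3 → ℝ) (f : ℝ × Torus3 → E) (p : ℝ × Torus3) : E :=
  torusConv K (fun x => f (p.1, x)) p.2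

/-- The gradient of a convolution. -/
noncomputable def torusConvGrad (K : Torus3 → ℝ) (f : Torus3 → ℝ) (y : Torus3) : Vec3 :=
  ∫ x, f x • torusGrad K (y - x)

/-- The divergence of the convolution of a vector field. -/
noncomputable def torusConvDiv (K : Torus3 → ℝ) (f : Torus3 → Vec3) (y : Torus3) : ℝ :=
  ∫ x, inner ℝ (torusGrad K (y - x)) (f x)

theorem integrable_kernel_smul {K : Torus3 → ℝ} (hK : Continuous K) {f : Torus3 → E}
    (hf : Integrable f) (y : Torus3) : Integrable (fun x => K (y - x) • f x) := by
  obtain ⟨M, -, hM⟩ := Continuous.exists_bound_torus hK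
  exact hf.bdd_smul M (hK.comp (continuous_const.sub continuous_id)).aestronglyMeasurable
    (Eventually.of_forall fun x => hM _)

theorem torusConv_sub {K : Torus3 → ℝ} (hK : Continuous K) {f g : Torus3 → E}
    (hf : Integrable f) (hg : Integrable g) (y : Torus3) :
    torusConv K (fun x => f x - g x) y = torusConv K f y - torusConv K g y := by
  simp only [torusConv, smul_sub]
  exact integral_sub (integrable_kernel_smul hK hf y) (integrable_kernel_smul hK hg y)

theorem continuous_torusConv {K : Torus3 → ℝ} (hK : Continuous K) {f : Torus3 → E}
    (hf : Integrable f) : Continuous (torusConv K f) := by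
  obtain ⟨M, -, hM⟩ := Continuous.exists_bound_torus hK
  refine continuous_of_dominated (bound := fun x => M * ‖f x‖)
    (fun y => (integrable_kernel_smul hK hf y).aestronglyMeasurable)
    (fun y => Eventually.of_forall fun x => ?_) (hf.norm.const_mul M)
    (Eventually.of_forall fun x => ?_)
  · rw [norm_smul]; gcongr; exact hM _
  · exact (hK.comp (continuous_id.sub continuous_const)).smul continuous_const

theorem integrable_smul_grad {K : Torus3 → ℝ} (hK : TorusSmooth K) {f : Torus3 → ℝ}
    (hf : Integrable f) (y : Torus3) : Integrable (fun x => f x • torusGrad K (y - x)) := by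
  obtain ⟨M, -, hM⟩ := Continuous.exists_bound_torus hK.hasTorusGrad.cont_grad
  exact hf.smul_bdd M (hK.hasTorusGrad.cont_grad.comp
    (continuous_const.sub continuous_id)).aestronglyMeasurable (Eventually.of_forall fun x => hM _)

theorem hasTorusGrad_torusConv {K : Torus3 → ℝ} (hK : TorusSmooth K) {f : Torus3 → ℝ}
    (hf : Integrable f) : HasTorusGrad (torusConv K f) (torusConvGrad K f) := by
  obtain ⟨M, -, hM⟩ := Continuous.exists_bound_torus hK.hasTorusGrad.cont_grad
  refine ⟨continuous_torusConv hK.hasTorusGrad.cont hf, ?_, fun y j => ?_⟩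
  · refine continuous_of_dominated (bound := fun x => ‖f x‖ * M)
      (fun y => (integrable_smul_grad hK hf y).aestronglyMeasurable)
      (fun y => Eventually.of_forall fun x => ?_) (hf.norm.mul_const M)
      (Eventually.of_forall fun x => ?_)
    · rw [norm_smul]; gcongr; exact hM _
    · exact (hK.hasTorusGrad.cont_grad.comp (continuous_id.sub continuous_const)).const_smul (f x)
  · let s : ℝ → Torus3 := fun h => Pi.single j (h : UnitAddCircle)
    have e1 (h : ℝ) (x : Torus3) : y - x + s h = y + s h - x := by abel
    have hi := integrable_smul_grad hK hf (y + s 0)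
    have h := (hasDerivAt_integral_of_dominated_loc_of_deriv_le
      (μ := (volume : Measure Torus3))
      (F := fun h x => K (y + s h - x) • f x)
      (F' := fun h x => (f x • torusGrad K (y + s h - x)) j) (x₀ := (0 : ℝ))
      (s := univ) (bound := fun x => ‖f x‖ * M) univ_mem
      (Eventually.of_forall fun h =>
        (integrable_kernel_smul hK.hasTorusGrad.cont hf (y + s h)).aestronglyMeasurable)
      (integrable_kernel_smul hK.hasTorusGrad.cont hf (y + s 0))
      ((continuous_coord j).comp_aestronglyMeasurable hi.aestronglyMeasurable)
      (Eventually.of_forall fun x h _ => (abs_coord_le _ _).trans (by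
        rw [norm_smul]; gcongr; exact hM _))
      (hf.norm.mul_const M)
      (Eventually.of_forall fun x h _ => by
        have := (hK.hasTorusGrad.hasDerivAt (y - x) j h).mul_const (f x)
        simp only [← e1, smul_eq_mul, PiLp.smul_apply]
        rw [mul_comm (f x)]
        exact this)).2
    rw [← integral_coord hi j] at h
    have e : y + s 0 = y := by simp [s]
    rw [e] at h
    exact h

theorem torusConvDiv_eq_sum {K : Torus3 → ℝ} (hK : TorusSmooth K) {f : Torus3 → Vec3}
    (hf : Integrable f) (y : Torus3) :
    torusConvDiv K f y = ∑ j : Fin 3, torusConvGrad K (fun x => f x j) y j := by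
  have hfj (j : Fin 3) : Integrable (fun x => f x j) :=
    (EuclideanSpace.proj (𝕜 := ℝ) j).integrable_comp hf
  simp only [torusConvGrad]
  simp_rw [fun j => integral_coord (integrable_smul_grad hK (hfj j) y) j]
  have hi (j : Fin 3) : Integrable (fun x => (f x j • torusGrad K (y - x)) j) :=
    (EuclideanSpace.proj (𝕜 := ℝ) j).integrable_comp (integrable_smul_grad hK (hfj j) y)
  rw [← integral_finsetSum _ fun j _ => hi j]
  rfl

theorem torusConv_coord {K : Torus3 → ℝ} (hK : Continuous K) {f : Torus3 → Vec3}
    (hf : Integrable f) (y : Torus3) (j : Fin 3) :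
    torusConv K f y j = torusConv K (fun x => f x j) y := by
  rw [torusConv, integral_coord (integrable_kernel_smul hK hf y)]
  rfl

/-- Integration by parts against the divergence of a convolution. -/
theorem integral_mul_torusConvDiv {K : Torus3 → ℝ} (hK : TorusSmooth K) {f : Torus3 → Vec3}
    (hf : Integrable f) {P : Torus3 → ℝ} {P' : Torus3 → Vec3} (hP : HasTorusGrad P P') :
    ∫ y, P y * torusConvDiv K f y = - ∫ y, inner ℝ (P' y) (torusConv K f y) := by
  have hfj (j : Fin 3) : Integrable (fun x => f x j) :=
    (EuclideanSpace.proj (𝕜 := ℝ) j).integrable_comp hf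
  have hg (j : Fin 3) := hasTorusGrad_torusConv hK (hfj j)
  simp_rw [torusConvDiv_eq_sum hK hf, Finset.mul_sum]
  have h1 (j : Fin 3) : Integrable (fun y => P y * torusConvGrad K (fun x => f x j) y j) :=
    (hP.cont.mul ((continuous_coord j).comp (hg j).cont_grad)).integrable_torus
  have h2 (j : Fin 3) : Integrable (fun y => P' y j * torusConv K (fun x => f x j) y) :=
    (((continuous_coord j).comp hP.cont_grad).mul (hg j).cont).integrable_torus
  rw [integral_finsetSum _ fun j _ => h1 j]
  have e (y : Torus3) : (inner ℝ (P' y) (torusConv K f y) : ℝ)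
      = ∑ j : Fin 3, P' y j * torusConv K (fun x => f x j) y := by
    simp [PiLp.inner_apply, torusConv_coord hK.hasTorusGrad.cont hf, mul_comm]
  simp_rw [e]
  rw [integral_finsetSum _ fun j _ => h2 j, ← Finset.sum_neg_distrib]
  exact Finset.sum_congr rfl fun j _ => hP.integral_mul_grad (hg j) j

/-- Convolution with a probability density is an average. This keeps the mollified concentrations in
a fixed compact set, on which all nonlinear coefficients are bounded. -/
theorem torusConv_mem_Icc {K : Torus3 → ℝ} (hK : Continuous K) (hK0 : ∀ x, 0 ≤ K x)
    (hK1 : ∫ x, K x = 1) {f : Torus3 → ℝ} (hf : Integrable f) (hf0 : ∀ᵐ x, f x ∈ Icc (0 : ℝ) 1)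
    (y : Torus3) : torusConv K f y ∈ Icc (0 : ℝ) 1 := by
  have hi := integrable_kernel_smul hK hf y
  constructor
  · refine integral_nonneg_of_ae ?_
    filter_upwards [hf0] with x hx using mul_nonneg (hK0 _) hx.1
  · have h1 : ∫ x, K (y - x) = 1 :=
      (integral_sub_left_eq_self K volume y).trans hK1
    refine le_trans ?_ h1.le
    refine integral_mono_ae hi
      (hK.comp (continuous_const.sub continuous_id)).integrable_torus ?_
    filter_upwards [hf0] with x hx using mul_le_of_le_one_right (hK0 _) hx.2

theorem norm_torusConvDiv_le {K : Torus3 → ℝ} {M : ℝ}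
    (hM : ∀ x, ‖torusGrad K x‖ ≤ M) {f : Torus3 → Vec3} (hf : Integrable f) (y : Torus3) :
    ‖torusConvDiv K f y‖ ≤ M * ∫ x, ‖f x‖ := by
  rw [← integral_const_mul]
  refine norm_integral_le_of_norm_le (hf.norm.const_mul M) (Eventually.of_forall fun x => ?_)
  exact (norm_inner_le_norm _ _).trans (by gcongr; exact hM _)

theorem continuous_torusConvDiv {K : Torus3 → ℝ} (hK : TorusSmooth K) {f : Torus3 → Vec3}
    (hf : Integrable f) : Continuous (torusConvDiv K f) := by
  have hfj (j : Fin 3) : Integrable (fun x => f x j) :=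
    (EuclideanSpace.proj (𝕜 := ℝ) j).integrable_comp hf
  have : torusConvDiv K f = fun y => ∑ j : Fin 3, torusConvGrad K (fun x => f x j) y j :=
    funext fun y => torusConvDiv_eq_sum hK hf y
  rw [this]
  exact continuous_finsetSum _ fun j _ =>
    (continuous_coord j).comp (hasTorusGrad_torusConv hK (hfj j)).cont_grad

/-! ### Slices of functions on the cylinder -/

theorem ae_slice_of_ae_cyl {I : Set ℝ} {p : ℝ × Torus3 → Prop} (h : ∀ᵐ q ∂(cyl I), p q) :
    ∀ᵐ t ∂(volume.restrict I), ∀ᵐ x, p (t, x) := Measure.ae_ae_of_ae_prod h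

theorem ae_cyl_of_ae_fst {I : Set ℝ} {p : ℝ → Prop} (h : ∀ᵐ t ∂(volume.restrict I), p t) :
    ∀ᵐ q ∂(cyl I), p q.1 := Measure.quasiMeasurePreserving_fst.ae h

theorem torusConv_congr {K : Torus3 → ℝ} {f g : Torus3 → E} (h : f =ᵐ[volume] g) (y : Torus3) :
    torusConv K f y = torusConv K g y :=
  integral_congr_ae (h.mono fun x hx => by simp [hx])

theorem spaceConv_congr {I : Set ℝ} {K : Torus3 → ℝ} {f g : ℝ × Torus3 → E}
    (h : f =ᵐ[cyl I] g) : spaceConv K f =ᵐ[cyl I] spaceConv K g := by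
  filter_upwards [ae_cyl_of_ae_fst (ae_slice_of_ae_cyl h)] with p hp
  exact torusConv_congr hp _

theorem stronglyMeasurable_spaceConv {K : Torus3 → ℝ} (hK : Continuous K) {f : ℝ × Torus3 → E}
    (hf : StronglyMeasurable f) : StronglyMeasurable (spaceConv K f) := by
  refine StronglyMeasurable.integral_prod_right'
    (f := fun q : (ℝ × Torus3) × Torus3 => K (q.1.2 - q.2) • f (q.1.1, q.2)) ?_
  exact (hK.measurable.comp (by fun_prop)).stronglyMeasurable.smul
    (hf.comp_measurable (by fun_prop))

theorem aestronglyMeasurable_spaceConv {I : Set ℝ} {K : Torus3 → ℝ} (hK : Continuous K)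
    {f : ℝ × Torus3 → E} (hf : AEStronglyMeasurable f (cyl I)) :
    AEStronglyMeasurable (spaceConv K f) (cyl I) :=
  ⟨_, stronglyMeasurable_spaceConv hK hf.stronglyMeasurable_mk, spaceConv_congr hf.ae_eq_mk⟩

theorem integral_cyl {I : Set ℝ} {f : ℝ × Torus3 → E} (hf : Integrable f (cyl I)) :
    ∫ p, f p ∂(cyl I) = ∫ t in I, ∫ x, f (t, x) := integral_prod _ hf

theorem lintegral_cyl {I : Set ℝ} {f : ℝ × Torus3 → ENNReal} (hf : AEMeasurable f (cyl I)) :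
    ∫⁻ p, f p ∂(cyl I) = ∫⁻ t in I, ∫⁻ x, f (t, x) := lintegral_prod _ hf

end Conv

/-! ### Approximate identities -/

section L2

variable {α : Type*} [MeasurableSpace α] {μ : Measure α}
  {E : Type*} [NormedAddCommGroup E]

theorem eLpNorm_two_eq (f : α → E) :
    eLpNorm f 2 μ = (∫⁻ x, ‖f x‖ₑ ^ (2 : ℝ) ∂μ) ^ (1 / 2 : ℝ) := by
  rw [eLpNorm_eq_lintegral_rpow_enorm_toReal two_ne_zero ENNReal.ofNat_ne_top]
  simp

/-- Dominated convergence for the squares `‖f n‖²` with majorant `b²`. -/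
theorem tendsto_eLpNorm_two_zero_of_dominated {f : ℕ → α → E} {b : α → ℝ}
    (hf : ∀ n, AEStronglyMeasurable (f n) μ) (hb : MemLp b 2 μ)
    (hfb : ∀ n, ∀ᵐ x ∂μ, ‖f n x‖ ≤ b x)
    (h : ∀ᵐ x ∂μ, Tendsto (fun n => f n x) atTop (𝓝 0)) :
    Tendsto (fun n => eLpNorm (f n) 2 μ) atTop (𝓝 0) := by
  simp_rw [eLpNorm_two_eq]
  have hb2 : ∫⁻ x, ‖b x‖ₑ ^ (2 : ℝ) ∂μ ≠ ⊤ := by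
    have := hb.eLpNorm_ne_top
    rw [eLpNorm_two_eq] at this
    intro h
    rw [h] at this
    simp at this
  have h1 : Tendsto (fun n => ∫⁻ x, ‖f n x‖ₑ ^ (2 : ℝ) ∂μ) atTop (𝓝 (∫⁻ _, 0 ∂μ)) := by
    refine tendsto_lintegral_of_dominated_convergence' (fun x => ‖b x‖ₑ ^ (2 : ℝ))
      (fun n => (hf n).enorm.pow_const _) (fun n => ?_) hb2 ?_
    · filter_upwards [hfb n] with x hx
      refine ENNReal.rpow_le_rpow (enorm_le_iff_norm_le.2 (hx.trans (le_abs_self _))) (by norm_num)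
    · filter_upwards [h] with x hx
      have := (ENNReal.continuous_rpow_const (y := (2 : ℝ))).tendsto _ |>.comp hx.enorm
      simpa [Function.comp_def] using this
  have h2 := (ENNReal.continuous_rpow_const (y := (1 / 2 : ℝ))).tendsto _ |>.comp h1
  simpa [Function.comp_def] using h2

end L2

/-! ### Mollification does not increase the `L²` norm. -/

section Contraction

variable {E : Type*} [NormedAddCommGroup E] [NormedSpace ℝ E]

/-- Jensen's inequality for the probability density `w`: Cauchy-Schwarz for `w g = w^(1/2) ·
(w^(1/2) g)`, where the first factor has unit norm. -/
theorem lintegral_mul_sq_le {w g : Torus3 → ENNReal} (hw : Measurable w) (hg : AEMeasurable g)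
    (hw1 : ∫⁻ x, w x = 1) :
    (∫⁻ x, w x * g x) ^ (2 : ℝ) ≤ ∫⁻ x, w x * g x ^ (2 : ℝ) := by
  have h := ENNReal.lintegral_mul_le_Lp_mul_Lq (volume : Measure Torus3)
    (p := 2) (q := 2) ⟨by norm_num, by norm_num, by norm_num⟩
    (f := fun x => w x ^ (1 / 2 : ℝ)) (g := fun x => w x ^ (1 / 2 : ℝ) * g x)
    (hw.pow_const _).aemeasurable ((hw.pow_const _).aemeasurable.mul hg)
  have e1 (x) : (w x ^ (1 / 2 : ℝ)) ^ (2 : ℝ) = w x := by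
    rw [← ENNReal.rpow_mul]; norm_num
  have e2 (x) : w x ^ (1 / 2 : ℝ) * (w x ^ (1 / 2 : ℝ) * g x) = w x * g x := by
    rw [← mul_assoc, ← ENNReal.rpow_add_of_nonneg _ _ (by norm_num) (by norm_num)]; norm_num
  simp only [Pi.mul_apply, e1, e2, hw1, ENNReal.mul_rpow_of_nonneg _ _ (zero_le_two (α := ℝ)),
    ENNReal.one_rpow, one_mul] at h
  have h2 := ENNReal.rpow_le_rpow h (zero_le_two (α := ℝ))
  rwa [← ENNReal.rpow_mul, one_div, inv_mul_cancel₀ two_ne_zero, ENNReal.rpow_one] at h2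

/-- Jensen's inequality at each `y`, then Tonelli: every `x` is weighted by the total mass of `K (·
- x)`, which is one. -/
theorem lintegral_torusConv_sq_le {K : Torus3 → ℝ} (hK : Continuous K) (hK0 : ∀ x, 0 ≤ K x)
    (hK1 : ∫ x, K x = 1) {f : Torus3 → E} (hf : AEStronglyMeasurable f) :
    ∫⁻ y, ‖torusConv K f y‖ₑ ^ (2 : ℝ) ≤ ∫⁻ x, ‖f x‖ₑ ^ (2 : ℝ) := by
  have hw : Measurable fun x => ENNReal.ofReal (K x) := hK.measurable.ennreal_ofReal
  have hw1 : ∫⁻ x, ENNReal.ofReal (K x) = 1 := by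
    rw [← ofReal_integral_eq_lintegral_ofReal hK.integrable_torus (Eventually.of_forall hK0), hK1]
    simp
  have hf2 : AEMeasurable fun x => ‖f x‖ₑ ^ (2 : ℝ) := hf.enorm.pow_const _
  calc ∫⁻ y, ‖torusConv K f y‖ₑ ^ (2 : ℝ)
      ≤ ∫⁻ y, ∫⁻ x, ENNReal.ofReal (K (y - x)) * ‖f x‖ₑ ^ (2 : ℝ) := by
        refine lintegral_mono fun y => ?_
        refine le_trans (ENNReal.rpow_le_rpow (enorm_integral_le_lintegral_enorm _)
          zero_le_two) ?_
        simp_rw [enorm_smul, fun x => Real.enorm_of_nonneg (hK0 x)]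
        refine lintegral_mul_sq_le (hw.comp (measurable_const.sub measurable_id)) hf.enorm ?_
        exact (lintegral_sub_left_eq_self (fun x => ENNReal.ofReal (K x)) y).trans hw1
    _ = ∫⁻ x, ∫⁻ y, ENNReal.ofReal (K (y - x)) * ‖f x‖ₑ ^ (2 : ℝ) := by
        refine lintegral_lintegral_swap ?_
        refine (hw.comp (measurable_fst.sub measurable_snd)).aemeasurable.mul ?_
        exact hf2.comp_quasiMeasurePreserving Measure.quasiMeasurePreserving_snd
    _ = ∫⁻ x, ‖f x‖ₑ ^ (2 : ℝ) := by
        refine lintegral_congr fun x => ?_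
        have hm : Measurable fun y => ENNReal.ofReal (K (y - x)) := hw.comp (measurable_sub_const x)
        rw [lintegral_mul_const _ hm,
          lintegral_sub_right_eq_self (fun x => ENNReal.ofReal (K x)) x, hw1, one_mul]

theorem eLpNorm_spaceConv_le {I : Set ℝ} {K : Torus3 → ℝ} (hK : Continuous K)
    (hK0 : ∀ x, 0 ≤ K x) (hK1 : ∫ x, K x = 1) {f : ℝ × Torus3 → E}
    (hf : AEStronglyMeasurable f (cyl I)) :
    eLpNorm (spaceConv K f) 2 (cyl I) ≤ eLpNorm f 2 (cyl I) := by
  rw [eLpNorm_two_eq, eLpNorm_two_eq,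
    lintegral_cyl ((aestronglyMeasurable_spaceConv hK hf).enorm.pow_const _),
    lintegral_cyl (hf.enorm.pow_const _)]
  refine ENNReal.rpow_le_rpow (lintegral_mono_ae ?_) (by norm_num)
  filter_upwards [hf.prodMk_left] with t ht
  exact lintegral_torusConv_sq_le hK hK0 hK1 ht

end Contraction

/-! ### A concrete mollifier on the torus. -/

/-- A smooth nonnegative function on the torus with a unique maximum at the origin. -/
noncomputable def peakFun (x : Torus3) : ℝ :=
  ∑ j : Fin 3, (1 + ((AddCircle.toCircle (x j) : Circle) : ℂ).re)

theorem continuous_peakFun : Continuous peakFun := by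
  refine continuous_finsetSum _ fun j _ => continuous_const.add ?_
  exact Complex.continuous_re.comp (continuous_subtype_val.comp
    (AddCircle.continuous_toCircle.comp (continuous_apply j)))

theorem re_circle_le_one (z : Circle) : ((z : Circle) : ℂ).re ≤ 1 :=
  (Complex.re_le_norm (z : ℂ)).trans (Circle.norm_coe z).le

theorem re_circle_ge_neg_one (z : Circle) : -1 ≤ ((z : Circle) : ℂ).re := by
  have := Complex.abs_re_le_norm (z : ℂ)
  rw [Circle.norm_coe] at this
  exact (abs_le.1 this).1

theorem peakFun_nonneg (x : Torus3) : 0 ≤ peakFun x :=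
  Finset.sum_nonneg fun j _ => by linarith [re_circle_ge_neg_one (AddCircle.toCircle (x j))]

theorem peakFun_zero : peakFun 0 = 6 := by
  simp [peakFun, AddCircle.toCircle_zero]; norm_num

/-- Among the points of the unit circle only `1` has real part one, so every nonzero coordinate of
`x` loses strictly. -/
theorem peakFun_lt {x : Torus3} (hx : x ≠ 0) : peakFun x < peakFun 0 := by
  obtain ⟨j, hj⟩ : ∃ j, x j ≠ 0 := by
    by_contra! h
    exact hx (funext h)
  refine Finset.sum_lt_sum (fun i _ => ?_) ⟨j, Finset.mem_univ _, ?_⟩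
  · simpa [AddCircle.toCircle_zero] using re_circle_le_one _
  · suffices h : ((AddCircle.toCircle (x j) : Circle) : ℂ).re < 1 by
      simpa [AddCircle.toCircle_zero] using h
    refine lt_of_le_of_ne (re_circle_le_one _) fun h => hj ?_
    refine AddCircle.injective_toCircle one_ne_zero ?_
    rw [AddCircle.toCircle_zero]
    ext
    have h1 : ‖((AddCircle.toCircle (x j) : Circle) : ℂ)‖ = 1 := Circle.norm_coe _
    have h2 := Complex.sq_norm_sub_sq_re ((AddCircle.toCircle (x j) : Circle) : ℂ)
    rw [h1, h] at h2
    apply Complex.ext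
    · simpa using h
    · simp only [Circle.coe_one, Complex.one_im]
      nlinarith

theorem torusSmooth_peakFun : TorusSmooth peakFun := by
  have : (fun z : Fin 3 → ℝ => peakFun (torusProj z)) =
      fun z => ∑ j : Fin 3, (1 + Real.cos (2 * Real.pi / 1 * z j)) := by
    funext z
    simp only [peakFun, torusProj, AddCircle.toCircle_apply_mk, Circle.coe_exp,
      Complex.exp_ofReal_mul_I_re]
  rw [TorusSmooth, this]
  fun_prop

/-- A sequence of smooth positive kernels concentrating at the origin. -/
noncomputable def moll (n : ℕ) (x : Torus3) : ℝ := (∫ z, peakFun z ^ n)⁻¹ * peakFun x ^ n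

theorem torusSmooth_moll (n : ℕ) : TorusSmooth (moll n) :=
  contDiff_const.mul (ContDiff.pow (f := fun z : Fin 3 → ℝ => peakFun (torusProj z))
    torusSmooth_peakFun n)

theorem continuous_moll (n : ℕ) : Continuous (moll n) := (torusSmooth_moll n).hasTorusGrad.cont

theorem integral_peakFun_pow_pos (n : ℕ) : 0 < ∫ z, peakFun z ^ n := by
  refine (continuous_peakFun.pow n).integral_pos_of_hasCompactSupport_nonneg_nonzero
    (HasCompactSupport.of_compactSpace _) (fun x => pow_nonneg (peakFun_nonneg x) n) (x := 0) ?_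
  simp [peakFun_zero]

theorem moll_nonneg (n : ℕ) (x : Torus3) : 0 ≤ moll n x :=
  mul_nonneg (inv_nonneg.2 (integral_peakFun_pow_pos n).le) (pow_nonneg (peakFun_nonneg x) n)

theorem integral_moll (n : ℕ) : ∫ x, moll n x = 1 := by
  simp only [moll]
  rw [integral_const_mul, inv_mul_cancel₀ (integral_peakFun_pow_pos n).ne']

section

variable {E : Type*} [NormedAddCommGroup E] [NormedSpace ℝ E] [CompleteSpace E]

/-- Laplace's method: the normalized powers of a continuous nonnegative function with a unique
maximum concentrate at the maximum point. -/
theorem tendsto_torusConv_moll {f : Torus3 → E} (hf : Continuous f) (y : Torus3) :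
    Tendsto (fun n => torusConv (moll n) f y) atTop (𝓝 (f y)) := by
  have h := tendsto_setIntegral_pow_smul_of_unique_maximum_of_isCompact_of_continuousOn
    (μ := (volume : Measure Torus3)) isCompact_univ (c := peakFun) (x₀ := 0)
    (g := fun x => f (y - x)) continuous_peakFun.continuousOn (fun x _ hx => peakFun_lt hx)
    (fun x _ => peakFun_nonneg x) (by rw [peakFun_zero]; norm_num) (by simp)
    (hf.comp (continuous_const.sub continuous_id)).continuousOn
  simp only [Measure.restrict_univ, sub_zero] at h
  refine h.congr fun n => ?_
  rw [torusConv, ← integral_smul, ← integral_sub_left_eq_self _ volume y]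
  simp [moll, smul_smul]

/-- Bounded continuous functions are handled by pointwise convergence and domination. They are dense
in `L²`, and the contraction `eLpNorm_spaceConv_le` is uniform in the kernel, so an ε/3 argument
covers the rest. -/
theorem tendsto_eLpNorm_moll {a b : ℝ} {f : ℝ × Torus3 → E} (hf : MemLp f 2 (cyl (Ioo a b))) :
    Tendsto (fun n => eLpNorm (spaceConv (moll n) f - f) 2 (cyl (Ioo a b))) atTop (𝓝 0) := by
  have hfin : IsFiniteMeasure (cyl (Ioo a b)) := by unfold cyl; infer_instance
  have hreg : (cyl (Ioo a b)).WeaklyRegular := by unfold cyl; infer_instance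
  rw [ENNReal.tendsto_nhds_zero]
  intro ε hε
  have hε3 : ε / 3 ≠ 0 := (ENNReal.div_pos hε.ne' (by simp)).ne'
  obtain ⟨g, hgc, M, hM, hg, hg2⟩ : ∃ g : ℝ × Torus3 → E, Continuous g ∧ ∃ M, (∀ p, ‖g p‖ ≤ M) ∧
      eLpNorm (f - g) 2 (cyl (Ioo a b)) ≤ ε / 3 ∧ MemLp g 2 (cyl (Ioo a b)) := by
    obtain ⟨g, hg, hg2⟩ := hf.exists_boundedContinuous_eLpNorm_sub_le (by simp) hε3
    exact ⟨g, g.continuous, ‖g‖, g.norm_coe_le_norm, hg, hg2⟩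
  have hgm (n : ℕ) : AEStronglyMeasurable (spaceConv (moll n) g - g) (cyl (Ioo a b)) :=
    (aestronglyMeasurable_spaceConv (continuous_moll n) hg2.1).sub hg2.1
  have hgs (t : ℝ) : Continuous fun x => g (t, x) := hgc.comp (by fun_prop)
  have h1 : Tendsto (fun n => eLpNorm (spaceConv (moll n) g - g) 2 (cyl (Ioo a b))) atTop
      (𝓝 0) := by
    refine tendsto_eLpNorm_two_zero_of_dominated hgm (memLp_const (M + M))
      (fun n => Eventually.of_forall fun p => ?_) (Eventually.of_forall fun p => ?_)
    · refine (norm_sub_le _ _).trans (add_le_add ?_ (hM p))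
      have h1 : ∫ x, moll n (p.2 - x) = 1 :=
        (integral_sub_left_eq_self (moll n) volume p.2).trans (integral_moll n)
      calc ‖spaceConv (moll n) g p‖ ≤ ∫ x, moll n (p.2 - x) * M := by
            refine norm_integral_le_of_norm_le ?_ (Eventually.of_forall fun x => ?_)
            · exact (((continuous_moll n).comp
                (continuous_const.sub continuous_id)).integrable_torus).mul_const _
            · rw [norm_smul, Real.norm_of_nonneg (moll_nonneg n _)]
              exact mul_le_mul_of_nonneg_left (hM _) (moll_nonneg n _)
        _ = M := by rw [integral_mul_const, h1, one_mul]
    · have := (tendsto_torusConv_moll (hgs p.1) p.2).sub_const (g p)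
      simpa [spaceConv] using this
  filter_upwards [(ENNReal.tendsto_nhds_zero.1 h1) (ε / 3) (pos_iff_ne_zero.2 hε3)] with n hn
  have hd : MemLp (f - g) 2 (cyl (Ioo a b)) := hf.sub hg2
  -- Additivity of the convolution needs `f` to be integrable on the time slice, which is known for
  -- almost every time.
  have e : spaceConv (moll n) f - f =ᵐ[cyl (Ioo a b)]
      (spaceConv (moll n) (f - g) + (spaceConv (moll n) g - g)) - (f - g) := by
    have hfi : Integrable f (cyl (Ioo a b)) := hf.integrable one_le_two
    have hs : ∀ᵐ t ∂((volume : Measure ℝ).restrict (Ioo a b)),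
        Integrable (fun x => f (t, x)) (volume : Measure Torus3) := hfi.prod_right_ae
    filter_upwards [ae_cyl_of_ae_fst hs] with p hp
    have := torusConv_sub (continuous_moll n) hp (hgs p.1).integrable_torus p.2
    simp only [Pi.sub_apply, Pi.add_apply, spaceConv, this]
    abel
  rw [eLpNorm_congr_ae e]
  have hm := aestronglyMeasurable_spaceConv (continuous_moll n) hd.1
  calc _ ≤ eLpNorm (spaceConv (moll n) (f - g) + (spaceConv (moll n) g - g)) 2 (cyl (Ioo a b))
          + eLpNorm (f - g) 2 (cyl (Ioo a b)) :=
        eLpNorm_sub_le (hm.add (hgm n)) hd.1 one_le_two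
    _ ≤ (eLpNorm (spaceConv (moll n) (f - g)) 2 (cyl (Ioo a b)) +
          eLpNorm (spaceConv (moll n) g - g) 2 (cyl (Ioo a b)))
          + eLpNorm (f - g) 2 (cyl (Ioo a b)) := by
        gcongr; exact eLpNorm_add_le hm (hgm n) one_le_two
    _ ≤ (ε / 3 + ε / 3) + ε / 3 := by
        gcongr
        exact (eLpNorm_spaceConv_le (continuous_moll n) (moll_nonneg n) (integral_moll n)
          hd.1).trans hg
    _ = ε := ENNReal.add_thirds ε

end

theorem memLp_spaceConv_moll {E : Type*} [NormedAddCommGroup E] [NormedSpace ℝ E]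
    {I : Set ℝ} {f : ℝ × Torus3 → E} (hf : MemLp f 2 (cyl I)) (n : ℕ) :
    MemLp (spaceConv (moll n) f) 2 (cyl I) :=
  ⟨aestronglyMeasurable_spaceConv (continuous_moll n) hf.1,
    (eLpNorm_spaceConv_le (continuous_moll n) (moll_nonneg n) (integral_moll n) hf.1).trans_lt hf.2⟩

/-! ### Convergence of products in `L²` -/

section L2

variable {α : Type*} [MeasurableSpace α] {μ : Measure α}
  {E : Type*} [NormedAddCommGroup E] [NormedSpace ℝ E]

theorem memLp_bdd_smul {m : α → ℝ} {h : α → E} {M : ℝ} (hm : AEStronglyMeasurable m μ)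
    (hM : ∀ᵐ x ∂μ, |m x| ≤ M) (hh : MemLp h 2 μ) : MemLp (fun x => m x • h x) 2 μ := by
  refine (hh.const_smul M).mono (hm.smul hh.1) ?_
  filter_upwards [hM] with x hx
  simp only [norm_smul, Pi.smul_apply, Real.norm_eq_abs]
  exact mul_le_mul_of_nonneg_right (hx.trans (le_abs_self M)) (norm_nonneg _)

/-- Write the difference as `m n (h n - h') + (m n - m') h'`: the first term is controlled by the
bound `M`, the second by dominated convergence. In this way nonlinear coefficients of mollified
functions pass to the limit against `L²` fields. -/
theorem tendsto_eLpNorm_bdd_smul {m : ℕ → α → ℝ} {m' : α → ℝ} {h : ℕ → α → E} {h' : α → E} {M : ℝ}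
    (hm : ∀ n, AEStronglyMeasurable (m n) μ) (hM : ∀ n, ∀ᵐ x ∂μ, |m n x| ≤ M)
    (hmt : ∀ᵐ x ∂μ, Tendsto (fun n => m n x) atTop (𝓝 (m' x)))
    (hh : ∀ n, MemLp (h n) 2 μ) (hh' : MemLp h' 2 μ)
    (ht : Tendsto (fun n => eLpNorm (h n - h') 2 μ) atTop (𝓝 0)) :
    Tendsto (fun n => eLpNorm ((fun x => m n x • h n x) - fun x => m' x • h' x) 2 μ)
      atTop (𝓝 0) := by
  have hm' : AEStronglyMeasurable m' μ := aestronglyMeasurable_of_tendsto_ae atTop hm hmt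
  have hall : ∀ᵐ x ∂μ, ∀ n, |m n x| ≤ M := ae_all_iff.2 hM
  have hM' : ∀ᵐ x ∂μ, |m' x| ≤ M := by
    filter_upwards [hall, hmt] with x hx hxt
    exact le_of_tendsto hxt.abs (Eventually.of_forall hx)
  have h2 : Tendsto (fun n => eLpNorm (fun x => (m n x - m' x) • h' x) 2 μ) atTop (𝓝 0) := by
    refine tendsto_eLpNorm_two_zero_of_dominated (b := fun x => (M + M) * ‖h' x‖)
      (fun n => ((hm n).sub hm').smul hh'.1) (hh'.norm.const_mul (M + M)) (fun n => ?_) ?_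
    · filter_upwards [hall, hM'] with x hx hx'
      rw [norm_smul]
      gcongr
      exact (norm_sub_le _ _).trans (add_le_add (hx n) hx')
    · filter_upwards [hmt] with x hx
      simpa using (hx.sub_const (m' x)).smul_const (h' x)
  have h1 : Tendsto (fun n => eLpNorm (fun x => m n x • (h n x - h' x)) 2 μ) atTop (𝓝 0) := by
    have h3 : Tendsto (fun n => ENNReal.ofReal M * eLpNorm (h n - h') 2 μ) atTop (𝓝 0) := by
      simpa using ENNReal.Tendsto.const_mul ht (Or.inr (ENNReal.ofReal_ne_top (r := M)))
    refine tendsto_of_tendsto_of_tendsto_of_le_of_le tendsto_const_nhds h3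
      (fun _ => zero_le) fun n => ?_
    refine eLpNorm_le_mul_eLpNorm_of_ae_le_mul ?_ 2
    filter_upwards [hM n] with x hx
    rw [norm_smul]
    exact mul_le_mul_of_nonneg_right hx (norm_nonneg _)
  have h12 := h1.add h2
  rw [add_zero] at h12
  refine tendsto_of_tendsto_of_tendsto_of_le_of_le tendsto_const_nhds h12
    (fun _ => zero_le) fun n => ?_
  have e : ((fun x => m n x • h n x) - fun x => m' x • h' x) =
      (fun x => m n x • (h n x - h' x)) + fun x => (m n x - m' x) • h' x := by
    funext x
    simp only [Pi.sub_apply, Pi.add_apply, smul_sub, sub_smul]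
    abel
  rw [e]
  exact eLpNorm_add_le ((hm n).smul ((hh n).1.sub hh'.1)) (((hm n).sub hm').smul hh'.1) one_le_two

/-- On a finite measure space convergence in `L²` implies convergence in `L¹`. -/
theorem tendsto_integral_of_eLpNorm_two [IsFiniteMeasure μ] {h : ℕ → α → E} {h' : α → E}
    (hh : ∀ n, MemLp (h n) 2 μ) (hh' : MemLp h' 2 μ)
    (ht : Tendsto (fun n => eLpNorm (h n - h') 2 μ) atTop (𝓝 0)) :
    Tendsto (fun n => ∫ x, h n x ∂μ) atTop (𝓝 (∫ x, h' x ∂μ)) := by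
  refine tendsto_integral_of_L1' h' (hh'.integrable one_le_two).aestronglyMeasurable
    (Eventually.of_forall fun n => (hh n).integrable one_le_two) ?_
  have h3 : Tendsto (fun n => eLpNorm (h n - h') 2 μ * μ univ ^ (1 / (1 : ENNReal).toReal
      - 1 / (2 : ENNReal).toReal)) atTop (𝓝 0) := by
    have hne : μ univ ^ (1 / (1 : ENNReal).toReal - 1 / (2 : ENNReal).toReal) ≠ ⊤ :=
      ENNReal.rpow_ne_top_of_nonneg (by norm_num) (measure_ne_top μ univ)
    simpa using ENNReal.Tendsto.mul_const ht (Or.inr hne)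
  exact tendsto_of_tendsto_of_tendsto_of_le_of_le tendsto_const_nhds h3
    (fun _ => zero_le) fun n =>
      eLpNorm_le_eLpNorm_mul_rpow_measure_univ one_le_two ((hh n).1.sub hh'.1)

end L2

theorem exists_subseq_ae_of_eLpNorm_two {α : Type*} [MeasurableSpace α] {μ : Measure α}
    {E : Type*} [NormedAddCommGroup E] {h : ℕ → α → E} {h' : α → E}
    (hh : ∀ n, AEStronglyMeasurable (h n) μ) (hh' : AEStronglyMeasurable h' μ)
    (ht : Tendsto (fun n => eLpNorm (h n - h') 2 μ) atTop (𝓝 0)) :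
    ∃ ns : ℕ → ℕ, StrictMono ns ∧
      ∀ᵐ x ∂μ, Tendsto (fun n => h (ns n) x) atTop (𝓝 (h' x)) :=
  (tendstoInMeasure_of_tendsto_eLpNorm two_ne_zero hh hh' ht).exists_seq_tendsto_ae

/-! ### Restrictions of the measure on the cylinder -/

instance (a b : ℝ) : IsFiniteMeasure (cyl (Ioo a b)) := by unfold cyl; infer_instance

theorem cyl_eq_restrict (I : Set ℝ) :
    cyl I = ((volume : Measure ℝ).prod (volume : Measure Torus3)).restrict (I ×ˢ univ) := by
  rw [cyl, ← Measure.prod_restrict, Measure.restrict_univ]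

theorem cyl_mono {I J : Set ℝ} (h : J ⊆ I) : cyl J ≤ cyl I := by
  rw [cyl_eq_restrict, cyl_eq_restrict]
  exact Measure.restrict_mono (prod_mono h Subset.rfl) le_rfl

theorem cyl_restrict {I J : Set ℝ} (hJ : MeasurableSet J) (h : J ⊆ I) :
    (cyl I).restrict (J ×ˢ univ) = cyl J := by
  rw [cyl_eq_restrict, cyl_eq_restrict, Measure.restrict_restrict (hJ.prod MeasurableSet.univ),
    inter_eq_left.2 (prod_mono h Subset.rfl)]

theorem Ioi_eq_iUnion : Ioi (0 : ℝ) = ⋃ m : ℕ, Ioo (1 / ((m : ℝ) + 2)) ((m : ℝ) + 2) := by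
  ext t
  simp only [mem_Ioi, mem_iUnion, mem_Ioo]
  constructor
  · intro ht
    obtain ⟨m, hm⟩ := exists_nat_gt (max t (1 / t))
    refine ⟨m, ?_, by linarith [le_max_left t (1 / t)]⟩
    rw [div_lt_iff₀ (by positivity)]
    have := (le_max_right t (1 / t)).trans_lt hm
    rw [div_lt_iff₀ ht] at this
    nlinarith
  · rintro ⟨m, h1, -⟩
    exact lt_trans (by positivity) h1

theorem one_div_lt_exhaust (m : ℕ) : 1 / ((m : ℝ) + 2) < (m : ℝ) + 2 := by
  have h2 : (2 : ℝ) ≤ (m : ℝ) + 2 := by linarith [Nat.cast_nonneg (α := ℝ) m]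
  rw [div_lt_iff₀ (by linarith)]
  nlinarith

theorem cyl_Ioi_eq : cyl (Ioi 0) = ((volume : Measure ℝ).prod (volume : Measure Torus3)).restrict
    (⋃ m : ℕ, Ioo (1 / ((m : ℝ) + 2)) ((m : ℝ) + 2) ×ˢ univ) := by
  rw [cyl_eq_restrict, Ioi_eq_iUnion, iUnion_prod_const]

theorem ae_cyl_Ioi {P : ℝ × Torus3 → Prop}
    (h : ∀ s T : ℝ, 0 < s → s < T → ∀ᵐ p ∂(cyl (Ioo s T)), P p) : ∀ᵐ p ∂(cyl (Ioi 0)), P p := by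
  rw [cyl_Ioi_eq, ae_restrict_iUnion_iff]
  intro m
  rw [← cyl_eq_restrict]
  exact h _ _ (by positivity) (one_div_lt_exhaust m)

theorem aestronglyMeasurable_cyl_Ioi {E : Type*} [TopologicalSpace E]
    [TopologicalSpace.PseudoMetrizableSpace E] {f : ℝ × Torus3 → E}
    (h : ∀ s T : ℝ, 0 < s → s < T → AEStronglyMeasurable f (cyl (Ioo s T))) :
    AEStronglyMeasurable f (cyl (Ioi 0)) := by
  rw [cyl_Ioi_eq, aestronglyMeasurable_iUnion_iff]
  intro m
  rw [← cyl_eq_restrict]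
  exact h _ _ (by positivity) (one_div_lt_exhaust m)

theorem Ioo_subset_Ioi_zero {s T : ℝ} (hs : 0 ≤ s) : Ioo s T ⊆ Ioi (0 : ℝ) :=
  fun _ h => hs.trans_lt h.1

theorem ae_Ioo_of_Ioi {s T : ℝ} (hs : 0 ≤ s) {P : ℝ × Torus3 → Prop}
    (h : ∀ᵐ p ∂(cyl (Ioi 0)), P p) : ∀ᵐ p ∂(cyl (Ioo s T)), P p :=
  (Measure.absolutelyContinuous_of_le (cyl_mono (Ioo_subset_Ioi_zero hs))).ae_le h

theorem ae_time_Ioo_of_Ioi {s T : ℝ} (hs : 0 ≤ s) {P : ℝ → Prop}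
    (h : ∀ᵐ t ∂((volume : Measure ℝ).restrict (Ioi 0)), P t) :
    ∀ᵐ t ∂((volume : Measure ℝ).restrict (Ioo s T)), P t :=
  ae_restrict_of_ae_restrict_of_subset (Ioo_subset_Ioi_zero hs) h

theorem integrable_cyl_of_vanishing {E : Type*} [NormedAddCommGroup E] {I J : Set ℝ}
    (hJ : MeasurableSet J) (hJI : J ⊆ I) {f : ℝ × Torus3 → E} (hf : Integrable f (cyl J))
    (h0 : ∀ p, p.1 ∉ J → f p = 0) : Integrable f (cyl I) := by
  rw [← cyl_restrict hJ hJI] at hf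
  refine (integrableOn_iff_integrable_of_support_subset fun p hp => ?_).1 hf
  exact ⟨by_contra fun h => hp (h0 p h), mem_univ _⟩

theorem integral_cyl_of_vanishing {E : Type*} [NormedAddCommGroup E] [NormedSpace ℝ E] {I J : Set ℝ}
    (hJ : MeasurableSet J) (hJI : J ⊆ I) {f : ℝ × Torus3 → E}
    (h0 : ∀ p, p.1 ∉ J → f p = 0) : ∫ p, f p ∂(cyl I) = ∫ p, f p ∂(cyl J) := by
  rw [← cyl_restrict hJ hJI]
  exact (setIntegral_eq_integral_of_forall_compl_eq_zero fun p (hp : p ∉ J ×ˢ univ) =>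
    h0 p fun h => hp ⟨h, mem_univ _⟩).symm

theorem exists_Ioo_of_isCompact {S : Set ℝ} (hS : IsCompact S) (h : S ⊆ Ioi 0) :
    ∃ s T : ℝ, 0 < s ∧ s < T ∧ S ⊆ Ioo s T := by
  -- Inserting the point `1` makes the set nonempty, so that its extrema exist.
  have h1 : IsCompact (insert 1 S) := hS.insert 1
  obtain ⟨a, ha, hal⟩ := h1.exists_isLeast ⟨1, mem_insert _ _⟩
  obtain ⟨b, hb, hbl⟩ := h1.exists_isGreatest ⟨1, mem_insert _ _⟩
  have ha0 : 0 < a := by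
    rcases ha with rfl | ha
    · exact one_pos
    · exact h ha
  have h1a := hal (mem_insert _ _)
  have h1b := hbl (mem_insert _ _)
  exact ⟨a / 2, b + 1, by linarith, by linarith, fun x hx =>
    ⟨by linarith [hal (mem_insert_of_mem _ hx)], by linarith [hbl (mem_insert_of_mem _ hx)]⟩⟩

theorem exists_Ioo_of_tsupport {φ : ℝ × Torus3 → ℝ} (hφ : HasCompactSupport φ)
    (h : tsupport φ ⊆ Ioi (0 : ℝ) ×ˢ univ) :
    ∃ s T : ℝ, 0 < s ∧ s < T ∧ ∀ t ∉ Ioo s T, ∀ x, φ (t, x) = 0 := by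
  obtain ⟨s, T, hs, hT, hsub⟩ := exists_Ioo_of_isCompact (hφ.isCompact.image continuous_fst)
    (image_subset_iff.2 fun p hp => (h hp).1)
  refine ⟨s, T, hs, hT, fun t ht x => image_eq_zero_of_notMem_tsupport fun hx =>
    ht (hsub (mem_image_of_mem Prod.fst hx))⟩

/-! ### Weak gradients and mollification -/

theorem _root_.HasCompactSupport.exists_bound_norm {α E : Type*} [TopologicalSpace α]
    [NormedAddCommGroup E] {f : α → E} (hf : HasCompactSupport f) (hc : Continuous f) :
    ∃ M, ∀ x, ‖f x‖ ≤ M := hc.bounded_above_of_compact_support hf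

theorem integrable_slice {E : Type*} [NormedAddCommGroup E] {f : ℝ × Torus3 → E}
    (hf : ∀ s T : ℝ, 0 < s → s < T → Integrable f (cyl (Ioo s T))) :
    ∀ᵐ t ∂((volume : Measure ℝ).restrict (Ioi 0)), Integrable (fun x => f (t, x)) := by
  rw [Ioi_eq_iUnion, ae_restrict_iUnion_iff]
  intro m
  exact (hf _ _ (by positivity) (one_div_lt_exhaust m)).prod_right_ae

namespace HasWeakGradient

variable {f : ℝ × Torus3 → ℝ} {g : ℝ × Torus3 → Vec3}

/-- Test the weak gradient with `ψ(t) K(y - x)`. The sign from differentiating `K(y - x)` in `x`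
cancels the one in the definition, and `ψ` is arbitrary, so the two functions of time agree almost
everywhere. -/
theorem ae_torusConvGrad_eq_at (h : HasWeakGradient f g) {K : Torus3 → ℝ} (hK : TorusSmooth K)
    (y : Torus3) : ∀ᵐ t ∂((volume : Measure ℝ).restrict (Ioi 0)),
      torusConvGrad K (fun x => f (t, x)) y = torusConv K (fun x => g (t, x)) y := by
  obtain ⟨M₀, -, hM₀⟩ := Continuous.exists_bound_torus hK.hasTorusGrad.cont
  obtain ⟨M₁, -, hM₁⟩ := Continuous.exists_bound_torus hK.hasTorusGrad.cont_grad
  have c0 : Continuous fun p : ℝ × Torus3 => K (y - p.2) :=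
    hK.hasTorusGrad.cont.comp (continuous_const.sub continuous_snd)
  have c1 : Continuous fun p : ℝ × Torus3 => torusGrad K (y - p.2) :=
    hK.hasTorusGrad.cont_grad.comp (continuous_const.sub continuous_snd)
  have i1 (s T : ℝ) (hs : 0 < s) (hT : s < T) :
      Integrable (fun p => f p • torusGrad K (y - p.2)) (cyl (Ioo s T)) :=
    (h.integrable_fun s T hs hT).smul_bdd M₁ c1.aestronglyMeasurable
      (Eventually.of_forall fun _ => hM₁ _)
  have i0 (s T : ℝ) (hs : 0 < s) (hT : s < T) :
      Integrable (fun p => K (y - p.2) • g p) (cyl (Ioo s T)) :=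
    (h.integrable_grad s T hs hT).bdd_smul M₀ c0.aestronglyMeasurable
      (Eventually.of_forall fun _ => hM₀ _)
  have hloc : LocallyIntegrableOn (fun t => torusConvGrad K (fun x => f (t, x)) y
      - torusConv K (fun x => g (t, x)) y) (Ioi (0 : ℝ)) volume := by
    rw [locallyIntegrableOn_iff isOpen_Ioi.isLocallyClosed]
    intro S hS hSc
    obtain ⟨s, T, hs, hT, hST⟩ := exists_Ioo_of_isCompact hSc hS
    exact IntegrableOn.mono_set (t := Ioo s T)
      ((i1 s T hs hT).integral_prod_left.sub (i0 s T hs hT).integral_prod_left) hST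
  have hz := isOpen_Ioi.ae_eq_zero_of_integral_contDiff_smul_eq_zero hloc fun ψ hψ hψc hψs => by
    obtain ⟨s, T, hs, hT, hST⟩ := exists_Ioo_of_isCompact hψc.isCompact hψs
    have hψ0 (t : ℝ) (ht : t ∉ Ioo s T) : ψ t = 0 :=
      image_eq_zero_of_notMem_tsupport fun hx => ht (hST hx)
    obtain ⟨M, hM⟩ := hψc.exists_bound_norm hψ.continuous
    have cψ : AEStronglyMeasurable (fun p : ℝ × Torus3 => ψ p.1) (cyl (Ioo s T)) :=
      (hψ.continuous.comp continuous_fst).aestronglyMeasurable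
    have e := h.integral_eq _ (hK.isTestFunction hψ hψc y)
      ((tsupport_mul_kernel y).trans (prod_mono hψs Subset.rfl))
    simp_rw [spaceGrad_mul_kernel hK ψ y] at e
    have hsub : Ioo s T ⊆ Ioi 0 := Ioo_subset_Ioi_zero hs.le
    rw [integral_cyl_of_vanishing measurableSet_Ioo hsub (fun p hp => by simp [hψ0 _ hp]),
      integral_cyl_of_vanishing measurableSet_Ioo hsub (fun p hp => by simp [hψ0 _ hp])] at e
    have j1 : Integrable (fun p => ψ p.1 • f p • torusGrad K (y - p.2)) (cyl (Ioo s T)) :=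
      (i1 s T hs hT).bdd_smul M cψ (Eventually.of_forall fun p => hM _)
    have j0 : Integrable (fun p => ψ p.1 • K (y - p.2) • g p) (cyl (Ioo s T)) :=
      (i0 s T hs hT).bdd_smul M cψ (Eventually.of_forall fun p => hM _)
    have e1 : ∀ p : ℝ × Torus3, f p • -ψ p.1 • torusGrad K (y - p.2)
        = -(ψ p.1 • f p • torusGrad K (y - p.2)) := fun p => by
      rw [neg_smul, smul_neg, smul_comm]
    simp_rw [e1, mul_smul] at e
    rw [integral_neg, neg_inj, integral_cyl j1, integral_cyl j0] at e
    simp_rw [integral_smul] at e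
    have k1 := j1.integral_prod_left
    have k0 := j0.integral_prod_left
    simp_rw [integral_smul] at k1 k0
    have : ∫ t in Ioo s T, ψ t • (torusConvGrad K (fun x => f (t, x)) y
        - torusConv K (fun x => g (t, x)) y) = 0 := by
      simp_rw [smul_sub]
      exact (integral_sub k1 k0).trans (sub_eq_zero.2 e)
    rw [← this]
    exact (setIntegral_eq_integral_of_forall_compl_eq_zero fun t ht => by
      rw [hψ0 t ht, zero_smul]).symm
  filter_upwards [ae_restrict_of_ae hz, ae_restrict_mem measurableSet_Ioi] with t ht ht0
  exact sub_eq_zero.1 (ht ht0)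

/-- Mollification in space commutes with the weak gradient. -/
theorem ae_torusConvGrad_eq (h : HasWeakGradient f g) {K : Torus3 → ℝ} (hK : TorusSmooth K) :
    ∀ᵐ t ∂((volume : Measure ℝ).restrict (Ioi 0)), ∀ y,
      torusConvGrad K (fun x => f (t, x)) y = torusConv K (fun x => g (t, x)) y := by
  -- The null set of times depends on `y`. A countable dense set of points, together with continuity
  -- of both sides in `y`, gives one null set for all `y`.
  have h1 := ae_all_iff.2 fun n : ℕ =>
    h.ae_torusConvGrad_eq_at hK (TopologicalSpace.denseSeq Torus3 n)
  filter_upwards [h1, integrable_slice h.integrable_fun, integrable_slice h.integrable_grad]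
    with t ht hf hg y
  have c1 := (hasTorusGrad_torusConv hK hf).cont_grad
  have c2 := continuous_torusConv hK.hasTorusGrad.cont hg
  refine congrFun (Continuous.ext_on (TopologicalSpace.denseRange_denseSeq Torus3) c1 c2 ?_) y
  rintro _ ⟨n, rfl⟩
  exact ht n

/-- The mollification in space of a function with a weak gradient is smooth in space. -/
theorem ae_hasTorusGrad (h : HasWeakGradient f g) {K : Torus3 → ℝ} (hK : TorusSmooth K) :
    ∀ᵐ t ∂((volume : Measure ℝ).restrict (Ioi 0)),
      HasTorusGrad (torusConv K fun x => f (t, x)) (torusConv K fun x => g (t, x)) := by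
  filter_upwards [h.ae_torusConvGrad_eq hK, integrable_slice h.integrable_fun] with t ht hf
  have := hasTorusGrad_torusConv hK hf
  rwa [show torusConvGrad K (fun x => f (t, x)) = _ from funext ht] at this

/-- The mollifications of `g` and `g'` both equal the classical gradient of the mollified `f`, and
they converge to `g` and `g'` in `L²`. -/
theorem unique {g' : ℝ × Torus3 → Vec3} (h : HasWeakGradient f g) (h' : HasWeakGradient f g')
    (hg : LocL2 g) (hg' : LocL2 g') : g =ᵐ[cyl (Ioi 0)] g' := by
  refine ae_cyl_Ioi fun s T hs hT => ?_
  have l1 := tendsto_eLpNorm_moll (hg s T hs hT)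
  have l2 := tendsto_eLpNorm_moll (hg' s T hs hT)
  have l := l1.add l2
  rw [add_zero] at l
  have hle (n : ℕ) : eLpNorm (g - g') 2 (cyl (Ioo s T)) ≤
      eLpNorm (spaceConv (moll n) g - g) 2 (cyl (Ioo s T)) +
      eLpNorm (spaceConv (moll n) g' - g') 2 (cyl (Ioo s T)) := by
    have e : g - g' =ᵐ[cyl (Ioo s T)]
        (spaceConv (moll n) g' - g') - (spaceConv (moll n) g - g) := by
      filter_upwards [ae_cyl_of_ae_fst (ae_time_Ioo_of_Ioi (T := T) hs.le
        ((h.ae_torusConvGrad_eq (torusSmooth_moll n)).and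
          (h'.ae_torusConvGrad_eq (torusSmooth_moll n))))] with p hp
      have : spaceConv (moll n) g' p = spaceConv (moll n) g p :=
        (hp.2 p.2).symm.trans (hp.1 p.2)
      simp only [Pi.sub_apply, this]
      abel
    rw [eLpNorm_congr_ae e, add_comm]
    exact eLpNorm_sub_le
      ((aestronglyMeasurable_spaceConv (continuous_moll n) (hg' s T hs hT).1).sub
        (hg' s T hs hT).1)
      ((aestronglyMeasurable_spaceConv (continuous_moll n) (hg s T hs hT).1).sub
        (hg s T hs hT).1) one_le_two
  have h0 : eLpNorm (g - g') 2 (cyl (Ioo s T)) = 0 :=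
    le_antisymm (ge_of_tendsto' l hle) zero_le
  rw [eLpNorm_eq_zero_iff ((hg s T hs hT).1.sub (hg' s T hs hT).1) two_ne_zero] at h0
  filter_upwards [h0] with p hp
  exact sub_eq_zero.1 hp

theorem aestronglyMeasurable (h : HasWeakGradient f g) : AEStronglyMeasurable f (cyl (Ioi 0)) :=
  aestronglyMeasurable_cyl_Ioi fun s T hs hT => (h.integrable_fun s T hs hT).1

theorem congr_grad {g' : ℝ × Torus3 → Vec3} (h : HasWeakGradient f g)
    (hg : g =ᵐ[cyl (Ioi 0)] g') : HasWeakGradient f g' :=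
  ⟨h.integrable_fun, fun s T hs hT => (h.integrable_grad s T hs hT).congr (ae_Ioo_of_Ioi hs.le hg),
    fun φ hφ hs => (h.integral_eq φ hφ hs).trans (congrArg Neg.neg (integral_congr_ae
      (hg.mono fun p hp => by simp only [hp])))⟩

theorem congr_fun {f' : ℝ × Torus3 → ℝ} (h : HasWeakGradient f g)
    (hf : f =ᵐ[cyl (Ioi 0)] f') : HasWeakGradient f' g :=
  ⟨fun s T hs hT => (h.integrable_fun s T hs hT).congr (ae_Ioo_of_Ioi hs.le hf), h.integrable_grad,
    fun φ hφ hs => Eq.trans (integral_congr_ae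
      (hf.mono fun p hp => by simp only [hp])) (h.integral_eq φ hφ hs)⟩

/-- Splitting the integrals over the whole half line requires integrability there. It holds because
the test function lives on a time interval whose closure avoids `0`, where the functions and
gradients are integrable. -/
theorem sub {f' : ℝ × Torus3 → ℝ} {g' : ℝ × Torus3 → Vec3} (h : HasWeakGradient f g)
    (h' : HasWeakGradient f' g') :
    HasWeakGradient (fun p => f p - f' p) (fun p => g p - g' p) := by
  refine ⟨fun s T hs hT => (h.integrable_fun s T hs hT).sub (h'.integrable_fun s T hs hT),
    fun s T hs hT => (h.integrable_grad s T hs hT).sub (h'.integrable_grad s T hs hT),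
    fun φ hφ hsup => ?_⟩
  obtain ⟨s, T, hs, hT, h0⟩ := exists_Ioo_of_tsupport hφ.hasCompactSupport hsup
  have hsub : Ioo s T ⊆ Ioi 0 := Ioo_subset_Ioi_zero hs.le
  have hg0 (p : ℝ × Torus3) (hp : p.1 ∉ Ioo s T) : spaceGrad φ p = 0 :=
    IsTestFunction.spaceGrad_eq_zero (h0 p.1 hp) p.2
  have hφ0 (p : ℝ × Torus3) (hp : p.1 ∉ Ioo s T) : φ p = 0 := h0 p.1 hp p.2
  obtain ⟨M, hM⟩ := hφ.hasCompactSupport.exists_bound_norm hφ.continuous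
  obtain ⟨M', hM'⟩ : ∃ M, ∀ p, ‖spaceGrad φ p‖ ≤ M := by
    refine HasCompactSupport.exists_bound_norm ?_ hφ.continuous_spaceGrad
    exact HasCompactSupport.intro (isCompact_Icc.prod isCompact_univ) fun p hp =>
      hg0 p fun hp' => hp ⟨Ioo_subset_Icc_self hp', mem_univ _⟩
  have ig {f : ℝ × Torus3 → ℝ} (hf : Integrable f (cyl (Ioo s T))) :
      Integrable (fun p => f p • spaceGrad φ p) (cyl (Ioi 0)) :=
    integrable_cyl_of_vanishing measurableSet_Ioo hsub
      (hf.smul_bdd M' hφ.continuous_spaceGrad.aestronglyMeasurable (Eventually.of_forall hM'))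
      fun p hp => by simp [hg0 p hp]
  have iφ {g : ℝ × Torus3 → Vec3} (hf : Integrable g (cyl (Ioo s T))) :
      Integrable (fun p => φ p • g p) (cyl (Ioi 0)) :=
    integrable_cyl_of_vanishing measurableSet_Ioo hsub
      (hf.bdd_smul M hφ.continuous.aestronglyMeasurable (Eventually.of_forall hM))
      fun p hp => by simp [hφ0 p hp]
  simp_rw [sub_smul, smul_sub]
  rw [integral_sub (ig (h.integrable_fun s T hs hT)) (ig (h'.integrable_fun s T hs hT)),
    integral_sub (iφ (h.integrable_grad s T hs hT)) (iφ (h'.integrable_grad s T hs hT)),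
    h.integral_eq φ hφ hsup, h'.integral_eq φ hφ hsup]
  abel

end HasWeakGradient

/-! ### The chain rule -/

theorem IsTestFunction.exists_bounds {φ : ℝ × Torus3 → ℝ} (hφ : IsTestFunction φ) :
    ∃ M, ∀ p, |φ p| ≤ M ∧ ‖spaceGrad φ p‖ ≤ M := by
  obtain ⟨M, hM⟩ := hφ.hasCompactSupport.exists_bound_norm hφ.continuous
  obtain ⟨M', hM'⟩ := HasCompactSupport.exists_bound_norm
    (HasCompactSupport.intro ((hφ.hasCompactSupport.isCompact.image continuous_fst).prod
      isCompact_univ) fun p hp => IsTestFunction.spaceGrad_eq_zero (φ := φ) (t := p.1)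
        (fun x => image_eq_zero_of_notMem_tsupport fun hx =>
          hp ⟨⟨(p.1, x), hx, rfl⟩, mem_univ _⟩) p.2) hφ.continuous_spaceGrad
  exact ⟨max M M', fun p => ⟨(hM p).trans (le_max_left _ _), (hM' p).trans (le_max_right _ _)⟩⟩

theorem _root_.Continuous.exists_bound_Icc {Φ : ℝ → ℝ} (h : Continuous Φ) :
    ∃ M, ∀ a ∈ Icc (0 : ℝ) 1, |Φ a| ≤ M :=
  isCompact_Icc.exists_bound_of_continuousOn h.continuousOn

theorem memLp_of_mem_Icc {a b : ℝ} {f : ℝ × Torus3 → ℝ}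
    (hf : AEStronglyMeasurable f (cyl (Ioo a b)))
    (h : ∀ᵐ p ∂(cyl (Ioo a b)), f p ∈ Icc (0 : ℝ) 1) : MemLp f 2 (cyl (Ioo a b)) :=
  MemLp.of_bound hf 1 (h.mono fun p hp => by
    rw [Real.norm_eq_abs, abs_of_nonneg hp.1]; exact hp.2)

theorem spaceConv_mem_Icc {I : Set ℝ} {K : Torus3 → ℝ} (hK : Continuous K) (hK0 : ∀ x, 0 ≤ K x)
    (hK1 : ∫ x, K x = 1) {f : ℝ × Torus3 → ℝ} (hf : AEStronglyMeasurable f (cyl I))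
    (h : ∀ᵐ p ∂(cyl I), f p ∈ Icc (0 : ℝ) 1) : ∀ᵐ p ∂(cyl I), spaceConv K f p ∈ Icc (0 : ℝ) 1 := by
  filter_upwards [ae_cyl_of_ae_fst (ae_slice_of_ae_cyl h), ae_cyl_of_ae_fst hf.prodMk_left]
    with p hp hm
  exact torusConv_mem_Icc hK hK0 hK1 (Integrable.of_bound hm 1 (hp.mono fun x hx => by
    rw [Real.norm_eq_abs, abs_of_nonneg hx.1]; exact hx.2)) hp p.2

namespace HasWeakGradient

variable {f : ℝ × Torus3 → ℝ} {g : ℝ × Torus3 → Vec3}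

/-- For mollified functions this is the classical chain rule and integration by parts. In the limit
the gradients converge in `L²`, while `Φ` and its derivative stay bounded because the mollified
functions remain in `[0,1]`. -/
theorem comp (h : HasWeakGradient f g) (hg : LocL2 g)
    (hf : ∀ᵐ p ∂(cyl (Ioi 0)), f p ∈ Icc (0 : ℝ) 1) {Φ : ℝ → ℝ} (hΦ : ContDiff ℝ 1 Φ) :
    HasWeakGradient (fun p => Φ (f p)) (fun p => deriv Φ (f p) • g p) := by
  have cΦ := hΦ.continuous
  have cΦ' := hΦ.continuous_deriv le_rfl
  obtain ⟨M₀, hM₀⟩ := cΦ.exists_bound_Icc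
  obtain ⟨M₁, hM₁⟩ := cΦ'.exists_bound_Icc
  have hfI (s T : ℝ) (hs : 0 < s) : ∀ᵐ p ∂(cyl (Ioo s T)), f p ∈ Icc (0 : ℝ) 1 :=
    ae_Ioo_of_Ioi hs.le hf
  have hG (s T : ℝ) (hs : 0 < s) (hT : s < T) :
      MemLp (fun p => deriv Φ (f p) • g p) 2 (cyl (Ioo s T)) :=
    memLp_bdd_smul (cΦ'.comp_aestronglyMeasurable (h.integrable_fun s T hs hT).1)
      ((hfI s T hs).mono fun p hp => hM₁ _ hp) (hg s T hs hT)
  refine ⟨fun s T hs hT => ?_, fun s T hs hT => (hG s T hs hT).integrable one_le_two,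
    fun φ hφ hsup => ?_⟩
  · exact Integrable.of_bound (cΦ.comp_aestronglyMeasurable (h.integrable_fun s T hs hT).1) M₀
      ((hfI s T hs).mono fun p hp => hM₀ _ hp)
  obtain ⟨s, T, hs, hT, h0⟩ := exists_Ioo_of_tsupport hφ.hasCompactSupport hsup
  have hsub : Ioo s T ⊆ Ioi 0 := Ioo_subset_Ioi_zero hs.le
  rw [integral_cyl_of_vanishing measurableSet_Ioo hsub fun p hp => by
      simp [IsTestFunction.spaceGrad_eq_zero (h0 p.1 hp) p.2],
    integral_cyl_of_vanishing measurableSet_Ioo hsub fun p hp => by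
      simp [show φ p = 0 from h0 p.1 hp p.2]]
  obtain ⟨M, hM⟩ := hφ.exists_bounds
  have mf := memLp_of_mem_Icc (h.integrable_fun s T hs hT).1 (hfI s T hs)
  have mfn := fun n => memLp_spaceConv_moll mf n
  have mgn := fun n => memLp_spaceConv_moll (hg s T hs hT) n
  -- The nonlinear coefficients need almost everywhere convergence, which `L²` convergence provides
  -- along a subsequence.
  obtain ⟨ns, hns, hae⟩ := exists_subseq_ae_of_eLpNorm_two (fun n => (mfn n).1) mf.1
    (tendsto_eLpNorm_moll mf)
  have hgt := (tendsto_eLpNorm_moll (hg s T hs hT)).comp hns.tendsto_atTop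
  have hfnI (n : ℕ) : ∀ᵐ p ∂(cyl (Ioo s T)), spaceConv (moll n) f p ∈ Icc (0 : ℝ) 1 :=
    spaceConv_mem_Icc (continuous_moll n) (moll_nonneg n) (integral_moll n)
      mf.1 (hfI s T hs)
  have cφ := hφ.continuous.aestronglyMeasurable (μ := cyl (Ioo s T))
  have mφ : MemLp (spaceGrad φ) 2 (cyl (Ioo s T)) :=
    MemLp.of_bound hφ.continuous_spaceGrad.aestronglyMeasurable M
      (Eventually.of_forall fun p => (hM p).2)
  have mL (n : ℕ) : MemLp (fun p => Φ (spaceConv (moll n) f p) • spaceGrad φ p) 2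
      (cyl (Ioo s T)) :=
    memLp_bdd_smul (cΦ.comp_aestronglyMeasurable (mfn n).1)
      ((hfnI n).mono fun p hp => hM₀ _ hp) mφ
  have bR (n : ℕ) : ∀ᵐ p ∂(cyl (Ioo s T)),
      |φ p * deriv Φ (spaceConv (moll n) f p)| ≤ M * M₁ := (hfnI n).mono fun p hp => by
    rw [abs_mul]
    exact mul_le_mul (hM p).1 (hM₁ _ hp) (abs_nonneg _) ((abs_nonneg _).trans (hM p).1)
  have aR (n : ℕ) : AEStronglyMeasurable (fun p => φ p * deriv Φ (spaceConv (moll n) f p))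
      (cyl (Ioo s T)) := cφ.mul (cΦ'.comp_aestronglyMeasurable (mfn n).1)
  have mR (n : ℕ) : MemLp (fun p => (φ p * deriv Φ (spaceConv (moll n) f p)) •
      spaceConv (moll n) g p) 2 (cyl (Ioo s T)) := memLp_bdd_smul (aR n) (bR n) (mgn n)
  have key (n : ℕ) : ∫ p, Φ (spaceConv (moll n) f p) • spaceGrad φ p ∂(cyl (Ioo s T)) =
      - ∫ p, (φ p * deriv Φ (spaceConv (moll n) f p)) • spaceConv (moll n) g p
        ∂(cyl (Ioo s T)) := by
    rw [integral_cyl ((mL n).integrable one_le_two), integral_cyl ((mR n).integrable one_le_two),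
      ← integral_neg]
    refine integral_congr_ae ?_
    filter_upwards [ae_time_Ioo_of_Ioi (T := T) hs.le (h.ae_hasTorusGrad (torusSmooth_moll n))]
      with t ht
    have := (ht.comp hΦ).integral_smul_grad (hφ.hasTorusGrad t)
    simp only [smul_smul] at this
    exact this
  have limL := tendsto_integral_of_eLpNorm_two (fun n => mL (ns n))
    (memLp_bdd_smul (cΦ.comp_aestronglyMeasurable mf.1)
      ((hfI s T hs).mono fun p hp => hM₀ _ hp) mφ)
    (tendsto_eLpNorm_bdd_smul (h := fun _ => spaceGrad φ)
      (fun n => cΦ.comp_aestronglyMeasurable (mfn (ns n)).1)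
      (fun n => (hfnI (ns n)).mono fun p hp => hM₀ _ hp)
      (hae.mono fun p hp => (cΦ.tendsto _).comp hp) (fun _ => mφ) mφ (by simp))
  have mR' : MemLp (fun p => (φ p * deriv Φ (f p)) • g p) 2 (cyl (Ioo s T)) := by
    refine memLp_bdd_smul (cφ.mul (cΦ'.comp_aestronglyMeasurable mf.1)) (M := M * M₁)
      ((hfI s T hs).mono fun p hp => ?_) (hg s T hs hT)
    rw [abs_mul]
    exact mul_le_mul (hM p).1 (hM₁ _ hp) (abs_nonneg _) ((abs_nonneg _).trans (hM p).1)
  have limR := tendsto_integral_of_eLpNorm_two (fun n => mR (ns n)) mR'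
    (tendsto_eLpNorm_bdd_smul (fun n => aR (ns n)) (fun n => bR (ns n))
      (hae.mono fun p hp => ((cΦ'.tendsto _).comp hp).const_mul (φ p)) (fun n => mgn (ns n))
      (hg s T hs hT) hgt)
  have := tendsto_nhds_unique limL (limR.neg.congr fun n => (key (ns n)).symm)
  simp_rw [smul_smul]
  exact this

end HasWeakGradient

/-! ### One-dimensional calculus -/

/-- An absolutely continuous function has bounded range on the interval, and a `C¹` function is
Lipschitz on a compact interval containing it. -/
theorem absolutelyContinuousOnInterval_comp {L a : ℝ → ℝ} {x y : ℝ} (hL : ContDiff ℝ 1 L)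
    (ha : AbsolutelyContinuousOnInterval a x y) :
    AbsolutelyContinuousOnInterval (fun t => L (a t)) x y := by
  obtain ⟨C, hC⟩ := ha.exists_bound
  obtain ⟨M, hM⟩ := (isCompact_Icc (a := -C) (b := C)).exists_bound_of_continuousOn
    (hL.continuous_deriv le_rfl).continuousOn
  have hlip (u v : ℝ) (hu : u ∈ Icc (-C) C) (hv : v ∈ Icc (-C) C) :
      dist (L u) (L v) ≤ M * dist u v := by
    rw [Real.dist_eq, Real.dist_eq, ← Real.norm_eq_abs, ← Real.norm_eq_abs]
    exact (convex_Icc (-C) C).norm_image_sub_le_of_norm_deriv_le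
      (fun z _ => (hL.differentiable one_ne_zero) z) hM hv hu
  refine squeeze_zero' (g := fun E => M * ∑ i ∈ Finset.range E.1, dist (a (E.2 i).1) (a (E.2 i).2))
    (Eventually.of_forall fun E => Finset.sum_nonneg fun _ _ => dist_nonneg) ?_
    (by simpa using Tendsto.const_mul M ha)
  refine Filter.Eventually.filter_mono inf_le_right (eventually_principal.2 fun E hE => ?_)
  rw [Finset.mul_sum]
  refine Finset.sum_le_sum fun i hi => hlip _ _ ?_ ?_
  · exact abs_le.1 (hC _ (hE.1 i hi).1)
  · exact abs_le.1 (hC _ (hE.1 i hi).2)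

/-- The fundamental theorem of calculus for `(L a - L b) (a - b)` along two absolutely continuous
functions `a` and `b`. -/
theorem integral_deriv_symm_entropy {L α β : ℝ → ℝ} {T : ℝ} (hL : ContDiff ℝ 1 L)
    (hα : IntervalIntegrable α volume 0 T) (hβ : IntervalIntegrable β volume 0 T)
    {a b : ℝ → ℝ} {a₀ b₀ : ℝ} (ha : ∀ t, a t = a₀ + ∫ s in 0..t, α s)
    (hb : ∀ t, b t = b₀ + ∫ s in 0..t, β s) :
    (L (a T) - L (b T)) * (a T - b T) - (L a₀ - L b₀) * (a₀ - b₀) =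
    ∫ t in 0..T, ((deriv L (a t) * (a t - b t) + (L (a t) - L (b t))) * α t
      - (deriv L (b t) * (a t - b t) + (L (a t) - L (b t))) * β t) := by
  have hconst (r : ℝ) : AbsolutelyContinuousOnInterval (fun _ : ℝ => r) 0 T :=
    (LipschitzWith.const r).lipschitzOnWith.absolutelyContinuousOnInterval
  have aca : AbsolutelyContinuousOnInterval a 0 T := by
    rw [show a = fun t => a₀ + ∫ s in 0..t, α s from funext ha]
    exact (hconst a₀).fun_add
      (hα.absolutelyContinuousOnInterval_intervalIntegral left_mem_uIcc)
  have acb : AbsolutelyContinuousOnInterval b 0 T := by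
    rw [show b = fun t => b₀ + ∫ s in 0..t, β s from funext hb]
    exact (hconst b₀).fun_add
      (hβ.absolutelyContinuousOnInterval_intervalIntegral left_mem_uIcc)
  have acF : AbsolutelyContinuousOnInterval (fun t => (L (a t) - L (b t)) * (a t - b t)) 0 T :=
    ((absolutelyContinuousOnInterval_comp hL aca).fun_sub
      (absolutelyContinuousOnInterval_comp hL acb)).fun_mul (aca.fun_sub acb)
  have h := acF.integral_deriv_eq_sub
  have ha0 : a 0 = a₀ := by simp [ha]
  have hb0 : b 0 = b₀ := by simp [hb]
  simp only [ha0, hb0] at h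
  rw [← h]
  refine intervalIntegral.integral_congr_ae ?_
  -- By Lebesgue differentiation the derivatives are `α` and `β` almost everywhere, which is enough
  -- once the entropy is known to be absolutely continuous.
  filter_upwards [hα.ae_hasDerivAt_integral, hβ.ae_hasDerivAt_integral] with t hta htb ht
  have ht' := uIoc_subset_uIcc ht
  have da : HasDerivAt a (α t) t := by
    rw [show a = fun t => a₀ + ∫ s in 0..t, α s from funext ha]
    exact (hta ht' 0 left_mem_uIcc).const_add a₀
  have db : HasDerivAt b (β t) t := by
    rw [show b = fun t => b₀ + ∫ s in 0..t, β s from funext hb]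
    exact (htb ht' 0 left_mem_uIcc).const_add b₀
  have dL (z : ℝ) : HasDerivAt L (deriv L z) z := (hL.differentiable one_ne_zero z).hasDerivAt
  have hd : HasDerivAt (fun t => (L (a t) - L (b t)) * (a t - b t)) _ t :=
    (((dL _).comp t da).sub ((dL _).comp t db)).mul (da.sub db)
  rw [hd.deriv]
  simp only [Function.comp, Pi.sub_apply]
  ring

theorem integral_eq_interval_of_vanishing {h : ℝ → ℝ} {T : ℝ} (hT : 0 ≤ T)
    (h0 : ∀ t, t ∉ Ioc 0 T → h t = 0) : ∫ t, h t = ∫ t in 0..T, h t := by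
  rw [intervalIntegral.integral_of_le hT]
  exact (setIntegral_eq_integral_of_forall_compl_eq_zero h0).symm

theorem integral_Ioi_eq_interval_of_vanishing {h : ℝ → ℝ} {T : ℝ} (hT : 0 ≤ T)
    (h0 : ∀ t, T < t → h t = 0) : ∫ t in Ioi 0, h t = ∫ t in 0..T, h t := by
  rw [intervalIntegral.integral_of_le hT]
  refine setIntegral_eq_of_subset_of_forall_sdiff_eq_zero measurableSet_Ioi
    (fun t ht => ht.1) fun t ht => h0 t ?_
  by_contra hn
  exact ht.2 ⟨ht.1, not_lt.1 hn⟩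

/-- A weak solution of `e' = d`, `e(0) = e₀` on the half line is the primitive of `d`. -/
theorem ae_eq_primitive {e d : ℝ → ℝ} {e₀ : ℝ}
    (he : ∀ T, 0 < T → IntegrableOn e (Ioc 0 T)) (hd : ∀ T, 0 < T → IntegrableOn d (Ioc 0 T))
    (h : ∀ ψ : ℝ → ℝ, ContDiff ℝ ∞ ψ → HasCompactSupport ψ →
      e₀ * ψ 0 + (∫ t in Ioi 0, e t * deriv ψ t) + (∫ t in Ioi 0, d t * ψ t) = 0) :
    ∀ᵐ t ∂((volume : Measure ℝ).restrict (Ioi 0)), e t = e₀ + ∫ s in 0..t, d s := by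
  have hdi (T : ℝ) (hT : 0 < T) : IntervalIntegrable d volume 0 T :=
    (intervalIntegrable_iff_integrableOn_Ioc_of_le hT.le).2 (hd T hT)
  have hei (T : ℝ) (hT : 0 < T) : IntervalIntegrable e volume 0 T :=
    (intervalIntegrable_iff_integrableOn_Ioc_of_le hT.le).2 (he T hT)
  have hprim (T : ℝ) (hT : 0 < T) :
      AbsolutelyContinuousOnInterval (fun t => ∫ s in 0..t, d s) 0 T :=
    (hdi T hT).absolutelyContinuousOnInterval_intervalIntegral left_mem_uIcc
  have hpi (T : ℝ) (hT : 0 < T) :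
      IntervalIntegrable (fun t => ∫ s in 0..t, d s) volume 0 T :=
    (hprim T hT).continuousOn.intervalIntegrable
  have hvi (T : ℝ) (hT : 0 < T) :
      IntervalIntegrable (fun t => e t - e₀ - ∫ s in 0..t, d s) volume 0 T :=
    ((hei T hT).sub intervalIntegrable_const).sub (hpi T hT)
  have hloc : LocallyIntegrableOn (fun t => e t - e₀ - ∫ s in 0..t, d s) (Ioi (0 : ℝ)) volume := by
    rw [locallyIntegrableOn_iff isOpen_Ioi.isLocallyClosed]
    intro S hS hSc
    obtain ⟨s, T, hs, hT, hST⟩ := exists_Ioo_of_isCompact hSc hS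
    exact ((intervalIntegrable_iff_integrableOn_Ioc_of_le (hs.trans hT).le).1
      (hvi T (hs.trans hT))).mono_set fun t ht => ⟨hs.trans (hST ht).1, (hST ht).2.le⟩
  have hz := isOpen_Ioi.ae_eq_zero_of_integral_contDiff_smul_eq_zero hloc fun χ hχ hχc hχs => by
    obtain ⟨s, T, hs, hT, hST⟩ := exists_Ioo_of_isCompact hχc.isCompact hχs
    have hT0 : 0 < T := hs.trans hT
    have hχ0 (t : ℝ) (ht : t ∉ Ioo s T) : χ t = 0 :=
      image_eq_zero_of_notMem_tsupport fun hx => ht (hST hx)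
    -- The primitive is based at `T`, so it vanishes for `t ≥ T`. Its value at `0` is `-∫ χ`, which
    -- brings in the initial value `e₀`.
    let Ψ : ℝ → ℝ := fun t => ∫ s in T..t, χ s
    have dΨ (t : ℝ) : HasDerivAt Ψ (χ t) t :=
      intervalIntegral.integral_hasDerivAt_right (hχ.continuous.intervalIntegrable _ _)
        (hχ.continuous.stronglyMeasurableAtFilter _ _) hχ.continuous.continuousAt
    have hdΨ : deriv Ψ = χ := funext fun t => (dΨ t).deriv
    have cΨ : ContDiff ℝ ∞ Ψ := by
      rw [contDiff_infty_iff_deriv, hdΨ]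
      exact ⟨fun t => (dΨ t).differentiableAt, hχ⟩
    have hΨT (t : ℝ) (ht : T ≤ t) : Ψ t = 0 := by
      refine intervalIntegral.integral_zero_ae (Eventually.of_forall fun x hx => ?_)
      rw [uIoc_of_le ht] at hx
      exact hχ0 x fun hx' => absurd hx.1 (not_lt.2 hx'.2.le)
    -- For `t ≤ 0` the primitive is a constant, in general nonzero, so a cutoff is needed. It has no
    -- effect on `t ≥ 0`: it equals one up to `T + 1`, and `Ψ` vanishes beyond `T`.
    let η : ContDiffBump (0 : ℝ) := ⟨T + 1, T + 2, by linarith, by linarith⟩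
    have hη (t : ℝ) (ht : |t| < T + 1) : η =ᶠ[𝓝 t] 1 :=
      η.eventuallyEq_one_of_mem_ball (by simpa [Metric.mem_ball] using ht)
    have hψ0 (t : ℝ) (ht : 0 ≤ t) : (fun t => η t * Ψ t) t = Ψ t := by
      rcases lt_or_ge t (T + 1) with h1 | h1
      · have := (hη t (by rwa [abs_of_nonneg ht])).eq_of_nhds
        simp [this]
      · simp [hΨT t (by linarith)]
    have hψ' (t : ℝ) (ht : 0 < t) : deriv (fun t => η t * Ψ t) t = χ t := by
      rw [← hdΨ]
      refine Filter.EventuallyEq.deriv_eq ?_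
      filter_upwards [lt_mem_nhds ht] with x hx using hψ0 x hx.le
    have key := h (fun t => η t * Ψ t) (η.contDiff.mul cΨ) η.hasCompactSupport.mul_right
    have k1 : ∫ t in Ioi 0, e t * deriv (fun t => η t * Ψ t) t = ∫ t in 0..T, e t * χ t := by
      rw [← integral_Ioi_eq_interval_of_vanishing hT0.le fun t ht => by
        rw [hχ0 t fun h' => absurd h'.2 (not_lt.2 ht.le), mul_zero]]
      exact setIntegral_congr_fun measurableSet_Ioi fun t ht => by simp only [hψ' t ht]
    have k2 : ∫ t in Ioi 0, d t * (η t * Ψ t) = ∫ t in 0..T, d t * Ψ t := by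
      rw [← integral_Ioi_eq_interval_of_vanishing hT0.le fun t ht => by
        rw [hΨT t ht.le, mul_zero]]
      exact setIntegral_congr_fun measurableSet_Ioi fun t ht =>
        congrArg (d t * ·) (hψ0 t (le_of_lt ht))
    have k0 : η 0 * Ψ 0 = - ∫ t in 0..T, χ t := by
      refine (hψ0 0 le_rfl).trans ?_
      exact intervalIntegral.integral_symm _ _
    have acΨ : AbsolutelyContinuousOnInterval Ψ 0 T :=
      (hχ.continuous.intervalIntegrable _ _).absolutelyContinuousOnInterval_intervalIntegral
        right_mem_uIcc
    -- Both boundary terms vanish: `Ψ` is zero at `T` and the primitive of `d` is zero at `0`.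
    have k3 := (hprim T hT0).integral_mul_deriv_eq_deriv_mul acΨ
    have k4 : ∫ t in 0..T, deriv (fun t => ∫ s in 0..t, d s) t * Ψ t = ∫ t in 0..T, d t * Ψ t := by
      refine intervalIntegral.integral_congr_ae ?_
      filter_upwards [(hdi T hT0).ae_hasDerivAt_integral] with t ht ht'
      rw [(ht (uIoc_subset_uIcc ht') 0 left_mem_uIcc).deriv]
    rw [k4, hdΨ, hΨT T le_rfl, intervalIntegral.integral_same] at k3
    simp only [k1, k2, k0] at key
    have cχ (f : ℝ → ℝ) (hf : IntervalIntegrable f volume 0 T) :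
        IntervalIntegrable (fun t => f t * χ t) volume 0 T :=
      hf.mul_continuousOn hχ.continuous.continuousOn
    rw [integral_eq_interval_of_vanishing hT0.le fun t ht => by
      rw [hχ0 t fun h' => ht ⟨hs.trans h'.1, h'.2.le⟩, zero_smul]]
    have e1 : ∀ t, χ t • (e t - e₀ - ∫ s in 0..t, d s) =
        e t * χ t - e₀ * χ t - (∫ s in 0..t, d s) * χ t := fun t => by
      rw [smul_eq_mul]; ring
    simp_rw [e1]
    rw [intervalIntegral.integral_sub ((cχ _ (hei T hT0)).sub (cχ _ intervalIntegrable_const))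
      (cχ _ (hpi T hT0)), intervalIntegral.integral_sub (cχ _ (hei T hT0))
      (cχ _ intervalIntegrable_const), intervalIntegral.integral_const_mul]
    linarith
  filter_upwards [ae_restrict_of_ae hz, ae_restrict_mem measurableSet_Ioi] with t ht ht0
  linarith [ht ht0]

theorem integrable_cyl_Ioi_of_vanishing {E : Type*} [NormedAddCommGroup E] {T : ℝ}
    {f : ℝ × Torus3 → E} (hf : Integrable f (cyl (Ioo 0 T)))
    (h0 : ∀ p, T ≤ p.1 → f p = 0) : Integrable f (cyl (Ioi 0)) := by
  rw [cyl_eq_restrict] at hf ⊢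
  refine IntegrableOn.of_forall_sdiff_eq_zero hf (measurableSet_Ioi.prod MeasurableSet.univ)
    fun p hp => h0 p ?_
  by_contra hn
  exact hp.2 ⟨⟨hp.1.1, not_le.1 hn⟩, mem_univ _⟩

theorem _root_.HasCompactSupport.exists_pos_vanishing {ψ : ℝ → ℝ} (hψ : HasCompactSupport ψ) :
    ∃ T, 0 < T ∧ ∀ t, T ≤ t → ψ t = 0 ∧ deriv ψ t = 0 := by
  obtain ⟨B, hB⟩ := hψ.isCompact.isBounded.subset_closedBall 0
  have h (t : ℝ) (ht : |B| + 1 ≤ t) : t ∉ tsupport ψ := fun h' => by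
    have := hB h'
    rw [Metric.mem_closedBall, dist_zero_right, Real.norm_eq_abs] at this
    linarith [le_abs_self t, le_abs_self B]
  exact ⟨|B| + 1, by positivity, fun t ht => ⟨image_eq_zero_of_notMem_tsupport (h t ht),
    image_eq_zero_of_notMem_tsupport fun h' => h t ht (tsupport_deriv_subset h')⟩⟩

/-! ### The linear equation `∂ₜa + div J = 0` -/

/-- `a` takes values in `[0,1]`, has the square integrable gradient `h` and solves
`∂ₜa + div J = 0` with initial datum `a₀` and square integrable flux `J`. -/
structure IsFluxSolution (a₀ : Torus3 → ℝ) (a : ℝ × Torus3 → ℝ) (h J : ℝ × Torus3 → Vec3) :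
    Prop where
  meas_init : AEStronglyMeasurable a₀ volume
  init_mem : ∀ᵐ x, a₀ x ∈ Icc (0 : ℝ) 1
  mem : ∀ᵐ p ∂(cyl (Ioi 0)), a p ∈ Icc (0 : ℝ) 1
  grad : HasWeakGradient a h
  memLp_grad : ∀ T, 0 < T → MemLp h 2 (cyl (Ioo 0 T))
  memLp_flux : ∀ T, 0 < T → MemLp J 2 (cyl (Ioo 0 T))
  weak : ∀ φ, IsTestFunction φ → (∫ x, a₀ x * φ (0, x)) + (∫ p, a p * timeDeriv φ p ∂(cyl (Ioi 0)))
    + (∫ p, inner ℝ (J p) (spaceGrad φ p) ∂(cyl (Ioi 0))) = 0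

/-- The solution of the mollified equation with flux `J` and initial datum `a₀`. -/
noncomputable def evolve (K : Torus3 → ℝ) (a₀ : Torus3 → ℝ) (J : ℝ × Torus3 → Vec3) (t : ℝ)
    (y : Torus3) : ℝ :=
  torusConv K a₀ y + ∫ s in 0..t, - torusConvDiv K (fun x => J (s, x)) y

theorem stronglyMeasurable_spaceDiv {K : Torus3 → ℝ} (hK : TorusSmooth K) {f : ℝ × Torus3 → Vec3}
    (hf : StronglyMeasurable f) :
    StronglyMeasurable fun p : ℝ × Torus3 => torusConvDiv K (fun x => f (p.1, x)) p.2 := by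
  refine StronglyMeasurable.integral_prod_right'
    (f := fun q : (ℝ × Torus3) × Torus3 =>
      (inner ℝ (torusGrad K (q.1.2 - q.2)) (f (q.1.1, q.2)) : ℝ)) ?_
  exact (hK.hasTorusGrad.cont_grad.measurable.comp (by fun_prop)).stronglyMeasurable.inner
    (hf.comp_measurable (by fun_prop))

theorem aestronglyMeasurable_spaceDiv {I : Set ℝ} {K : Torus3 → ℝ} (hK : TorusSmooth K)
    {f : ℝ × Torus3 → Vec3} (hf : AEStronglyMeasurable f (cyl I)) :
    AEStronglyMeasurable (fun p : ℝ × Torus3 => torusConvDiv K (fun x => f (p.1, x)) p.2)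
      (cyl I) := by
  refine ⟨_, stronglyMeasurable_spaceDiv hK hf.stronglyMeasurable_mk, ?_⟩
  filter_upwards [ae_cyl_of_ae_fst (ae_slice_of_ae_cyl hf.ae_eq_mk)] with p hp
  exact integral_congr_ae (hp.mono fun x hx => by simp only [hx])

/-- The kernel absorbs the derivative: at time `t` the divergence is at most `M` times the `L¹` norm
of the slice `f (t, ·)`. -/
theorem integrable_spaceDiv {T : ℝ} {K : Torus3 → ℝ} (hK : TorusSmooth K)
    {f : ℝ × Torus3 → Vec3} (hf : Integrable f (cyl (Ioo 0 T))) :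
    Integrable (fun p : ℝ × Torus3 => torusConvDiv K (fun x => f (p.1, x)) p.2)
      (cyl (Ioo 0 T)) := by
  obtain ⟨M, -, hM⟩ := Continuous.exists_bound_torus hK.hasTorusGrad.cont_grad
  have h1 : Integrable (fun t => ∫ x, ‖f (t, x)‖) ((volume : Measure ℝ).restrict (Ioo 0 T)) :=
    hf.norm.integral_prod_left
  have h2 : Integrable (fun p : ℝ × Torus3 => M * ∫ x, ‖f (p.1, x)‖) (cyl (Ioo 0 T)) :=
    (h1.comp_fst (volume : Measure Torus3)).const_mul M
  refine h2.mono' (aestronglyMeasurable_spaceDiv hK hf.1) ?_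
  filter_upwards [ae_cyl_of_ae_fst hf.prod_right_ae] with p hp
  exact norm_torusConvDiv_le hM hp p.2

/-- Fubini is applied with `y` frozen in the kernel, so the conclusion holds for every `y`, not just
for almost every one. -/
theorem intervalIntegrable_torusConvDiv {T : ℝ} (hT : 0 < T) {K : Torus3 → ℝ} (hK : TorusSmooth K)
    {f : ℝ × Torus3 → Vec3} (hf : Integrable f (cyl (Ioo 0 T))) (y : Torus3) :
    IntervalIntegrable (fun s => torusConvDiv K (fun x => f (s, x)) y) volume 0 T := by
  obtain ⟨M, -, hM⟩ := Continuous.exists_bound_torus hK.hasTorusGrad.cont_grad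
  rw [intervalIntegrable_iff_integrableOn_Ioo_of_le hT.le]
  have : Integrable (fun p : ℝ × Torus3 => (inner ℝ (torusGrad K (y - p.2)) (f p) : ℝ))
      (cyl (Ioo 0 T)) := by
    refine (hf.norm.const_mul M).mono' (((hK.hasTorusGrad.cont_grad.comp
      (continuous_const.sub continuous_snd)).aestronglyMeasurable).inner hf.1)
      (Eventually.of_forall fun p => (norm_inner_le_norm _ _).trans ?_)
    gcongr
    exact hM _
  exact this.integral_prod_left

theorem continuous_evolve {K : Torus3 → ℝ} (hK : TorusSmooth K) {a₀ : Torus3 → ℝ}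
    (ha₀ : Integrable a₀) {J : ℝ × Torus3 → Vec3} {t : ℝ} (ht : 0 < t)
    (hJ : Integrable J (cyl (Ioo 0 t))) : Continuous (evolve K a₀ J t) := by
  obtain ⟨M, -, hM⟩ := Continuous.exists_bound_torus hK.hasTorusGrad.cont_grad
  refine (continuous_torusConv hK.hasTorusGrad.cont ha₀).add ?_
  have h1 : Integrable (fun t => ∫ x, ‖J (t, x)‖) ((volume : Measure ℝ).restrict (Ioo 0 t)) :=
    hJ.norm.integral_prod_left
  have h2 : ∀ᵐ s ∂((volume : Measure ℝ).restrict (Ioo 0 t)), Integrable fun x => J (s, x) :=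
    hJ.prod_right_ae
  have e (y : Torus3) : ∫ s in 0..t, - torusConvDiv K (fun x => J (s, x)) y =
      ∫ s in Ioo 0 t, - torusConvDiv K (fun x => J (s, x)) y := by
    rw [intervalIntegral.integral_of_le ht.le, integral_Ioc_eq_integral_Ioo]
  simp_rw [e]
  refine continuous_of_dominated (bound := fun s => M * ∫ x, ‖J (s, x)‖) (fun y => ?_)
    (fun y => ?_) (h1.const_mul M) ?_
  · exact (((intervalIntegrable_iff_integrableOn_Ioo_of_le ht.le).1
      (intervalIntegrable_torusConvDiv ht hK hJ y)).neg).1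
  · filter_upwards [h2] with s hs
    rw [norm_neg]
    exact norm_torusConvDiv_le hM hs y
  · filter_upwards [h2] with s hs
    exact (continuous_torusConvDiv hK hs).neg

namespace IsFluxSolution

variable {a₀ : Torus3 → ℝ} {a : ℝ × Torus3 → ℝ} {h J : ℝ × Torus3 → Vec3}

theorem integrable_init (H : IsFluxSolution a₀ a h J) : Integrable a₀ :=
  Integrable.of_bound H.meas_init 1 (H.init_mem.mono fun x hx => by
    rw [Real.norm_eq_abs, abs_of_nonneg hx.1]; exact hx.2)

theorem measurable (H : IsFluxSolution a₀ a h J) : AEStronglyMeasurable a (cyl (Ioi 0)) :=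
  H.grad.aestronglyMeasurable

theorem mem_Ioo (H : IsFluxSolution a₀ a h J) (T : ℝ) :
    ∀ᵐ p ∂(cyl (Ioo 0 T)), a p ∈ Icc (0 : ℝ) 1 := ae_Ioo_of_Ioi le_rfl H.mem

theorem memLp (H : IsFluxSolution a₀ a h J) (T : ℝ) : MemLp a 2 (cyl (Ioo 0 T)) :=
  memLp_of_mem_Icc (H.measurable.mono_measure (cyl_mono (Ioo_subset_Ioi_zero le_rfl))) (H.mem_Ioo T)

theorem integrable_flux (H : IsFluxSolution a₀ a h J) {T : ℝ} (hT : 0 < T) :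
    Integrable J (cyl (Ioo 0 T)) := (H.memLp_flux T hT).integrable one_le_two

/-- Tested with `ψ(t) K(y - x)`, the equation says that the convolution at `y` is a weak solution of
a scalar ordinary differential equation with initial value `torusConv K a₀ y`; `ae_eq_primitive`
identifies it. -/
theorem ae_eq_evolve_at (H : IsFluxSolution a₀ a h J) {K : Torus3 → ℝ} (hK : TorusSmooth K)
    (y : Torus3) : ∀ᵐ t ∂((volume : Measure ℝ).restrict (Ioi 0)),
      torusConv K (fun x => a (t, x)) y = evolve K a₀ J t y := by
  obtain ⟨M, -, hM⟩ := Continuous.exists_bound_torus hK.hasTorusGrad.cont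
  have c0 : Continuous fun p : ℝ × Torus3 => K (y - p.2) :=
    hK.hasTorusGrad.cont.comp (continuous_const.sub continuous_snd)
  have c1 : Continuous fun p : ℝ × Torus3 => torusGrad K (y - p.2) :=
    hK.hasTorusGrad.cont_grad.comp (continuous_const.sub continuous_snd)
  obtain ⟨M', -, hM'⟩ := Continuous.exists_bound_torus hK.hasTorusGrad.cont_grad
  have i1 (T : ℝ) : Integrable (fun p => K (y - p.2) * a p) (cyl (Ioo 0 T)) :=
    ((H.memLp T).integrable one_le_two).bdd_mul (c := M) c0.aestronglyMeasurable
      (Eventually.of_forall fun p => hM _)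
  have i2 (T : ℝ) (hT : 0 < T) :
      Integrable (fun p => (inner ℝ (torusGrad K (y - p.2)) (J p) : ℝ)) (cyl (Ioo 0 T)) := by
    refine ((H.integrable_flux hT).norm.const_mul M').mono'
      (c1.aestronglyMeasurable.inner (H.integrable_flux hT).1)
      (Eventually.of_forall fun p => (norm_inner_le_norm _ _).trans ?_)
    gcongr
    exact hM' _
  refine ae_eq_primitive (fun T hT => ?_) (fun T hT => ?_) fun ψ hψ hψc => ?_
  · rw [integrableOn_Ioc_iff_integrableOn_Ioo]
    exact (i1 T).integral_prod_left
  · exact ((intervalIntegrable_iff_integrableOn_Ioc_of_le hT.le).1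
      (intervalIntegrable_torusConvDiv hT hK (H.integrable_flux hT) y)).neg
  · have key := H.weak _ (hK.isTestFunction hψ hψc y)
    simp_rw [spaceGrad_mul_kernel hK ψ y, timeDeriv_mul_kernel hψ y] at key
    obtain ⟨T, hT, hψT⟩ := hψc.exists_pos_vanishing
    obtain ⟨B, hB⟩ := hψc.exists_bound_norm hψ.continuous
    obtain ⟨B', hB'⟩ := hψc.deriv.exists_bound_norm (hψ.continuous_deriv (by simp))
    have j1 : Integrable (fun p : ℝ × Torus3 => deriv ψ p.1 * (K (y - p.2) * a p))
        (cyl (Ioi 0)) :=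
      integrable_cyl_Ioi_of_vanishing ((i1 T).bdd_mul (c := B')
        (((hψ.continuous_deriv (by simp)).comp continuous_fst).aestronglyMeasurable)
        (Eventually.of_forall fun p => hB' _)) fun p hp => by rw [(hψT _ hp).2, zero_mul]
    have j2 : Integrable (fun p : ℝ × Torus3 => ψ p.1 * (inner ℝ (torusGrad K (y - p.2)) (J p) : ℝ))
        (cyl (Ioi 0)) :=
      integrable_cyl_Ioi_of_vanishing ((i2 T hT).bdd_mul (c := B)
        ((hψ.continuous.comp continuous_fst).aestronglyMeasurable)
        (Eventually.of_forall fun p => hB _)) fun p hp => by rw [(hψT _ hp).1, zero_mul]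
    have e0 : ∫ x, a₀ x * (ψ 0 * K (y - x)) = torusConv K a₀ y * ψ 0 := by
      rw [torusConv, ← integral_mul_const]
      refine integral_congr_ae (Eventually.of_forall fun x => ?_)
      simp only [smul_eq_mul]; ring
    have e1 : ∫ p, a p * (deriv ψ p.1 * K (y - p.2)) ∂(cyl (Ioi 0)) =
        ∫ t in Ioi 0, torusConv K (fun x => a (t, x)) y * deriv ψ t := by
      rw [show (fun p : ℝ × Torus3 => a p * (deriv ψ p.1 * K (y - p.2))) =
        fun p => deriv ψ p.1 * (K (y - p.2) * a p) from funext fun p => by ring, integral_cyl j1]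
      refine integral_congr_ae (Eventually.of_forall fun t => ?_)
      simp only [integral_const_mul, torusConv, smul_eq_mul, mul_comm]
    have e2 : ∫ p, (inner ℝ (J p) (-ψ p.1 • torusGrad K (y - p.2)) : ℝ) ∂(cyl (Ioi 0)) =
        ∫ t in Ioi 0, - torusConvDiv K (fun x => J (t, x)) y * ψ t := by
      rw [show (fun p : ℝ × Torus3 => (inner ℝ (J p) (-ψ p.1 • torusGrad K (y - p.2)) : ℝ)) =
        fun p => - (ψ p.1 * (inner ℝ (torusGrad K (y - p.2)) (J p) : ℝ)) from funext fun p => by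
          rw [real_inner_comm, real_inner_smul_left, neg_mul],
        integral_neg, integral_cyl j2, ← integral_neg]
      refine integral_congr_ae (Eventually.of_forall fun t => ?_)
      simp only [integral_const_mul, torusConvDiv]
      ring
    rw [e0, e1, e2] at key
    exact key

theorem ae_eq_evolve (H : IsFluxSolution a₀ a h J) {K : Torus3 → ℝ} (hK : TorusSmooth K) :
    ∀ᵐ t ∂((volume : Measure ℝ).restrict (Ioi 0)), ∀ y,
      torusConv K (fun x => a (t, x)) y = evolve K a₀ J t y := by
  have h1 := ae_all_iff.2 fun n : ℕ =>
    H.ae_eq_evolve_at hK (TopologicalSpace.denseSeq Torus3 n)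
  filter_upwards [h1, integrable_slice H.grad.integrable_fun, ae_restrict_mem measurableSet_Ioi]
    with t ht ha ht0 y
  refine congrFun (Continuous.ext_on (TopologicalSpace.denseRange_denseSeq Torus3)
    (continuous_torusConv hK.hasTorusGrad.cont ha)
    (continuous_evolve hK H.integrable_init ht0 (H.integrable_flux ht0)) ?_) y
  rintro _ ⟨n, rfl⟩
  exact ht n

theorem continuousOn_evolve (H : IsFluxSolution a₀ a h J) {K : Torus3 → ℝ} (hK : TorusSmooth K)
    (y : Torus3) : ContinuousOn (fun t => evolve K a₀ J t y) (Ici 0) := by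
  intro t ht
  have h1 : 0 < t + 1 := by linarith [mem_Ici.1 ht]
  have hi := (intervalIntegrable_torusConvDiv h1 hK (H.integrable_flux h1) y).neg
  have hc : ContinuousOn (fun t => evolve K a₀ J t y) (Icc 0 (t + 1)) :=
    continuousOn_const.add (intervalIntegral.continuousOn_primitive_interval' (by
      exact hi) left_mem_uIcc |>.mono (by rw [uIcc_of_le h1.le]))
  refine (hc t ⟨ht, by linarith⟩).mono_of_mem_nhdsWithin ?_
  rw [← Ici_inter_Iic]
  exact inter_mem self_mem_nhdsWithin (mem_nhdsWithin_of_mem_nhds (Iic_mem_nhds (by linarith)))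

/-- For almost every time the value is an average of a function with values in `[0,1]`. By
continuity in time a violation at `t` would persist on an interval to the right of `t`, a set of
positive measure. -/
theorem evolve_mem_Icc (H : IsFluxSolution a₀ a h J) {K : Torus3 → ℝ} (hK : TorusSmooth K)
    (hK0 : ∀ x, 0 ≤ K x) (hK1 : ∫ x, K x = 1) {t : ℝ} (ht : 0 ≤ t) (y : Torus3) :
    evolve K a₀ J t y ∈ Icc (0 : ℝ) 1 := by
  have hae : ∀ᵐ s ∂((volume : Measure ℝ).restrict (Ioi 0)), evolve K a₀ J s y ∈ Icc (0 : ℝ) 1 := by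
    filter_upwards [H.ae_eq_evolve_at hK y, ae_slice_of_ae_cyl H.mem,
      integrable_slice H.grad.integrable_fun] with s hs hm hi
    rw [← hs]
    exact torusConv_mem_Icc hK.hasTorusGrad.cont hK0 hK1 hi hm y
  by_contra hn
  have hopen : ∀ᶠ s in 𝓝[Ici 0] t, evolve K a₀ J s y ∉ Icc (0 : ℝ) 1 :=
    (H.continuousOn_evolve hK y t ht).eventually (isClosed_Icc.isOpen_compl.mem_nhds hn)
  obtain ⟨ε, hε, hball⟩ := Metric.mem_nhdsWithin_iff.1 hopen
  rw [ae_restrict_iff' measurableSet_Ioi, ae_iff] at hae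
  have hsub : Ioo t (t + ε) ⊆ {s | ¬(s ∈ Ioi 0 → evolve K a₀ J s y ∈ Icc (0 : ℝ) 1)} := by
    intro s hs h'
    refine hball ⟨?_, (ht.trans hs.1.le : (0 : ℝ) ≤ s)⟩ (h' (ht.trans_lt hs.1))
    rw [Metric.mem_ball, Real.dist_eq, abs_of_pos (by linarith [hs.1])]
    linarith [hs.2]
  have := measure_mono_null hsub hae
  rw [Real.volume_Ioo] at this
  simp only [ENNReal.ofReal_eq_zero] at this
  linarith

end IsFluxSolution

/-! ### Inner products of square integrable fields -/

section Inner

variable {α : Type*} [MeasurableSpace α] {μ : Measure α}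

theorem inner_ae_eq_toLp {f g : α → Vec3} (hf : MemLp f 2 μ) (hg : MemLp g 2 μ) :
    (fun x => (inner ℝ ((hf.toLp f : Lp Vec3 2 μ) x) ((hg.toLp g : Lp Vec3 2 μ) x) : ℝ)) =ᵐ[μ]
      fun x => inner ℝ (f x) (g x) := by
  filter_upwards [hf.coeFn_toLp, hg.coeFn_toLp] with x h1 h2
  rw [h1, h2]

theorem integrable_inner_of_memLp {f g : α → Vec3} (hf : MemLp f 2 μ) (hg : MemLp g 2 μ) :
    Integrable (fun x => (inner ℝ (f x) (g x) : ℝ)) μ :=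
  (L2.integrable_inner (𝕜 := ℝ) (hf.toLp f) (hg.toLp g)).congr (inner_ae_eq_toLp hf hg)

theorem integral_inner_eq {f g : α → Vec3} (hf : MemLp f 2 μ) (hg : MemLp g 2 μ) :
    ∫ x, (inner ℝ (f x) (g x) : ℝ) ∂μ = inner ℝ (hf.toLp f) (hg.toLp g) :=
  (integral_congr_ae (inner_ae_eq_toLp hf hg)).symm

theorem abs_integral_inner_le {f g : α → Vec3} (hf : MemLp f 2 μ) (hg : MemLp g 2 μ) :
    |∫ x, (inner ℝ (f x) (g x) : ℝ) ∂μ| ≤ (eLpNorm f 2 μ).toReal * (eLpNorm g 2 μ).toReal := by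
  rw [integral_inner_eq hf hg, ← Lp.norm_toLp f hf, ← Lp.norm_toLp g hg]
  exact abs_real_inner_le_norm _ _

theorem tendsto_integral_inner {f g : ℕ → α → Vec3} {f' g' : α → Vec3}
    (hf : ∀ n, MemLp (f n) 2 μ) (hg : ∀ n, MemLp (g n) 2 μ) (hf' : MemLp f' 2 μ)
    (hg' : MemLp g' 2 μ) (tf : Tendsto (fun n => eLpNorm (f n - f') 2 μ) atTop (𝓝 0))
    (tg : Tendsto (fun n => eLpNorm (g n - g') 2 μ) atTop (𝓝 0)) :
    Tendsto (fun n => ∫ x, (inner ℝ (f n x) (g n x) : ℝ) ∂μ) atTop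
      (𝓝 (∫ x, (inner ℝ (f' x) (g' x) : ℝ) ∂μ)) := by
  rw [integral_inner_eq hf' hg']
  simp_rw [fun n => integral_inner_eq (hf n) (hg n)]
  exact ((Lp.tendsto_Lp_iff_tendsto_eLpNorm'' f hf f' hf').2 tf).inner
    ((Lp.tendsto_Lp_iff_tendsto_eLpNorm'' g hg g' hg').2 tg)

end Inner

/-! ### The relative entropy identity for mollified solutions -/

/-- The gradient of the derivative of `(L a - L b) (a - b)` with respect to `a`, if `v` and `w` are
the gradients of `a` and `b`. -/
noncomputable def entropyField (L : ℝ → ℝ) (a b : ℝ) (v w : Vec3) : Vec3 :=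
  (deriv (deriv L) a * (a - b) + 2 * deriv L a) • v - (deriv L a + deriv L b) • w

/-- The function differentiated here is the partial derivative of `(L a - L b) (a - b)` in `a`. It
is the multiplier of the divergence in the time derivative of the entropy, and integration by parts
needs its gradient. -/
theorem hasTorusGrad_entropy_deriv {L : ℝ → ℝ} (hL : ContDiff ℝ 2 L) {P Q : Torus3 → ℝ}
    {P' Q' : Torus3 → Vec3} (hP : HasTorusGrad P P') (hQ : HasTorusGrad Q Q') :
    HasTorusGrad (fun x => deriv L (P x) * (P x - Q x) + (L (P x) - L (Q x)))
      (fun x => entropyField L (P x) (Q x) (P' x) (Q' x)) := by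
  have hL1 : ContDiff ℝ 1 L := hL.of_le one_le_two
  have hL2 : ContDiff ℝ 1 (deriv L) :=
    (contDiff_succ_iff_deriv.1 (show ContDiff ℝ (1 + 1) L by simpa [one_add_one_eq_two] using hL)).2.2
  have := ((hP.comp hL2).mul (hP.sub hQ)).add ((hP.comp hL1).sub (hQ.comp hL1))
  convert this using 2 with x
  unfold entropyField
  module

/-- The integrand in the time derivative of the symmetrized relative entropy. -/
noncomputable def entropyFlux (L : ℝ → ℝ) (a b : ℝ) (v w J J' : Vec3) : ℝ :=
  inner ℝ (entropyField L a b v w) J + inner ℝ (entropyField L b a w v) J'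

theorem memLp_entropyField {L : ℝ → ℝ} (hL : ContDiff ℝ 2 L) {μ : Measure (ℝ × Torus3)}
    {a b : ℝ × Torus3 → ℝ} {v w : ℝ × Torus3 → Vec3}
    (ha : AEStronglyMeasurable a μ) (hb : AEStronglyMeasurable b μ)
    (ha1 : ∀ᵐ p ∂μ, a p ∈ Icc (0 : ℝ) 1) (hb1 : ∀ᵐ p ∂μ, b p ∈ Icc (0 : ℝ) 1)
    (hv : MemLp v 2 μ) (hw : MemLp w 2 μ) :
    MemLp (fun p => entropyField L (a p) (b p) (v p) (w p)) 2 μ := by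
  have hL2 : ContDiff ℝ 1 (deriv L) :=
    (contDiff_succ_iff_deriv.1 (show ContDiff ℝ (1 + 1) L by simpa [one_add_one_eq_two] using hL)).2.2
  have c1 := hL2.continuous
  have c2 := hL2.continuous_deriv le_rfl
  have cP : Continuous fun q : ℝ × ℝ => deriv (deriv L) q.1 * (q.1 - q.2) + 2 * deriv L q.1 := by
    fun_prop
  have cQ : Continuous fun q : ℝ × ℝ => deriv L q.1 + deriv L q.2 := by fun_prop
  obtain ⟨M, hM⟩ := ((isCompact_Icc (a := (0 : ℝ)) (b := 1)).prod
    (isCompact_Icc (a := (0 : ℝ)) (b := 1))).exists_bound_of_continuousOn cP.continuousOn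
  obtain ⟨M', hM'⟩ := ((isCompact_Icc (a := (0 : ℝ)) (b := 1)).prod
    (isCompact_Icc (a := (0 : ℝ)) (b := 1))).exists_bound_of_continuousOn cQ.continuousOn
  refine (memLp_bdd_smul (M := M) (cP.comp_aestronglyMeasurable (ha.prodMk hb)) ?_ hv).sub
    (memLp_bdd_smul (M := M') (cQ.comp_aestronglyMeasurable (ha.prodMk hb)) ?_ hw)
  · filter_upwards [ha1, hb1] with p h1 h2 using hM (a p, b p) ⟨h1, h2⟩
  · filter_upwards [ha1, hb1] with p h1 h2 using hM' (a p, b p) ⟨h1, h2⟩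

theorem integrable_entropyFlux {L : ℝ → ℝ} (hL : ContDiff ℝ 2 L) {μ : Measure (ℝ × Torus3)}
    {a b : ℝ × Torus3 → ℝ} {v w J J' : ℝ × Torus3 → Vec3}
    (ha : AEStronglyMeasurable a μ) (hb : AEStronglyMeasurable b μ)
    (ha1 : ∀ᵐ p ∂μ, a p ∈ Icc (0 : ℝ) 1) (hb1 : ∀ᵐ p ∂μ, b p ∈ Icc (0 : ℝ) 1)
    (hv : MemLp v 2 μ) (hw : MemLp w 2 μ) (hJ : MemLp J 2 μ) (hJ' : MemLp J' 2 μ) :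
    Integrable (fun p => entropyFlux L (a p) (b p) (v p) (w p) (J p) (J' p)) μ :=
  (integrable_inner_of_memLp (memLp_entropyField hL ha hb ha1 hb1 hv hw) hJ).add
    (integrable_inner_of_memLp (memLp_entropyField hL hb ha hb1 ha1 hw hv) hJ')

/-- A nonnegative smooth kernel of total mass one. -/
structure IsMollifier (K : Torus3 → ℝ) : Prop where
  smooth : TorusSmooth K
  nonneg : ∀ x, 0 ≤ K x
  integral_eq : ∫ x, K x = 1

theorem isMollifier_moll (n : ℕ) : IsMollifier (moll n) :=
  ⟨torusSmooth_moll n, moll_nonneg n, integral_moll n⟩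

theorem IsMollifier.cont {K : Torus3 → ℝ} (hK : IsMollifier K) : Continuous K :=
  hK.smooth.hasTorusGrad.cont

theorem IsMollifier.memLp {E : Type*} [NormedAddCommGroup E] [NormedSpace ℝ E]
    {K : Torus3 → ℝ} (hK : IsMollifier K) {I : Set ℝ} {f : ℝ × Torus3 → E}
    (hf : MemLp f 2 (cyl I)) : MemLp (spaceConv K f) 2 (cyl I) :=
  ⟨aestronglyMeasurable_spaceConv hK.cont hf.1,
    (eLpNorm_spaceConv_le hK.cont hK.nonneg hK.integral_eq hf.1).trans_lt hf.2⟩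

/-- `(L a - L b) (a - b)`. -/
noncomputable def symEntropy (L : ℝ → ℝ) (a b : ℝ) : ℝ := (L a - L b) * (a - b)

/-- At each `y` the fundamental theorem of calculus applies in time; Fubini and an integration by
parts in `y` then move the divergence from the fluxes onto the entropy derivative. Different kernels
and data are allowed so that the identity can also compare two mollifications of one solution. -/
theorem IsFluxSolution.integral_symEntropy_evolve {a₀ b₀ : Torus3 → ℝ} {a b : ℝ × Torus3 → ℝ}
    {v w J J' : ℝ × Torus3 → Vec3} (Ha : IsFluxSolution a₀ a v J) (Hb : IsFluxSolution b₀ b w J')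
    {K K' : Torus3 → ℝ} (hK : IsMollifier K) (hK' : IsMollifier K') {L : ℝ → ℝ}
    (hL : ContDiff ℝ 2 L) {T : ℝ} (hT : 0 < T) :
    (∫ y, symEntropy L (evolve K a₀ J T y) (evolve K' b₀ J' T y)) -
      (∫ y, symEntropy L (torusConv K a₀ y) (torusConv K' b₀ y)) =
    ∫ p, entropyFlux L (spaceConv K a p) (spaceConv K' b p) (spaceConv K v p) (spaceConv K' w p)
      (spaceConv K J p) (spaceConv K' J' p) ∂(cyl (Ioo 0 T)) := by
  have hL1 : ContDiff ℝ 1 L := hL.of_le one_le_two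
  have c0 := hL1.continuous
  have c1 := hL1.continuous_deriv le_rfl
  have cS : Continuous fun q : ℝ × ℝ => symEntropy L q.1 q.2 := by unfold symEntropy; fun_prop
  let S : ℝ → ℝ → ℝ := fun x y => deriv L x * (x - y) + (L x - L y)
  have cS' : Continuous fun q : ℝ × ℝ => S q.1 q.2 := by fun_prop
  obtain ⟨M, hM⟩ := ((isCompact_Icc (a := (0 : ℝ)) (b := 1)).prod
    (isCompact_Icc (a := (0 : ℝ)) (b := 1))).exists_bound_of_continuousOn cS'.continuousOn
  let A : ℝ × Torus3 → ℝ := fun p => evolve K a₀ J p.1 p.2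
  let B : ℝ × Torus3 → ℝ := fun p => evolve K' b₀ J' p.1 p.2
  let D : ℝ × Torus3 → ℝ := fun p => torusConvDiv K (fun x => J (p.1, x)) p.2
  let D' : ℝ × Torus3 → ℝ := fun p => torusConvDiv K' (fun x => J' (p.1, x)) p.2
  have hA := ae_time_Ioo_of_Ioi (T := T) le_rfl (Ha.ae_eq_evolve hK.smooth)
  have hB := ae_time_Ioo_of_Ioi (T := T) le_rfl (Hb.ae_eq_evolve hK'.smooth)
  have eA : spaceConv K a =ᵐ[cyl (Ioo 0 T)] A := by
    filter_upwards [ae_cyl_of_ae_fst hA] with p hp using hp p.2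
  have eB : spaceConv K' b =ᵐ[cyl (Ioo 0 T)] B := by
    filter_upwards [ae_cyl_of_ae_fst hB] with p hp using hp p.2
  have ma := hK.memLp (Ha.memLp T)
  have mb := hK'.memLp (Hb.memLp T)
  have mA : AEStronglyMeasurable A (cyl (Ioo 0 T)) := ma.1.congr eA
  have mB : AEStronglyMeasurable B (cyl (Ioo 0 T)) := mb.1.congr eB
  have iD : Integrable D (cyl (Ioo 0 T)) := integrable_spaceDiv hK.smooth (Ha.integrable_flux hT)
  have iD' : Integrable D' (cyl (Ioo 0 T)) := integrable_spaceDiv hK'.smooth (Hb.integrable_flux hT)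
  have time_mem : ∀ᵐ p ∂(cyl (Ioo 0 T)), 0 ≤ p.1 := by
    refine ae_cyl_of_ae_fst ?_
    filter_upwards [ae_restrict_mem measurableSet_Ioo] with t ht using ht.1.le
  have A1 : ∀ᵐ p ∂(cyl (Ioo 0 T)), A p ∈ Icc (0 : ℝ) 1 := by
    filter_upwards [time_mem] with p hp
    exact Ha.evolve_mem_Icc hK.smooth hK.nonneg hK.integral_eq hp p.2
  have B1 : ∀ᵐ p ∂(cyl (Ioo 0 T)), B p ∈ Icc (0 : ℝ) 1 := by
    filter_upwards [time_mem] with p hp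
    exact Hb.evolve_mem_Icc hK'.smooth hK'.nonneg hK'.integral_eq hp p.2
  have i1 : Integrable (fun p => S (A p) (B p) * D p) (cyl (Ioo 0 T)) :=
    iD.bdd_mul (c := M) (cS'.comp_aestronglyMeasurable (mA.prodMk mB)) (by
      filter_upwards [A1, B1] with p h1 h2 using hM (A p, B p) ⟨h1, h2⟩)
  have i2 : Integrable (fun p => S (B p) (A p) * D' p) (cyl (Ioo 0 T)) :=
    iD'.bdd_mul (c := M) (cS'.comp_aestronglyMeasurable (mB.prodMk mA)) (by
      filter_upwards [A1, B1] with p h1 h2 using hM (B p, A p) ⟨h2, h1⟩)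
  have iΦ : Integrable (fun p => - (S (A p) (B p) * D p) - S (B p) (A p) * D' p)
      (cyl (Ioo 0 T)) := i1.neg.sub i2
  have hpt (y : Torus3) : symEntropy L (evolve K a₀ J T y) (evolve K' b₀ J' T y)
      - symEntropy L (torusConv K a₀ y) (torusConv K' b₀ y) =
      ∫ t in Ioo 0 T, (- (S (A (t, y)) (B (t, y)) * D (t, y))
        - S (B (t, y)) (A (t, y)) * D' (t, y)) := by
    have := integral_deriv_symm_entropy hL1
      (intervalIntegrable_torusConvDiv hT hK.smooth (Ha.integrable_flux hT) y).neg
      (intervalIntegrable_torusConvDiv hT hK'.smooth (Hb.integrable_flux hT) y).neg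
      (a := fun t => evolve K a₀ J t y) (b := fun t => evolve K' b₀ J' t y)
      (fun t => rfl) (fun t => rfl)
    rw [intervalIntegral.integral_of_le hT.le, integral_Ioc_eq_integral_Ioo] at this
    refine this.trans (integral_congr_ae (Eventually.of_forall fun t => ?_))
    simp only [S, A, B, D, D', Pi.neg_apply]
    ring
  have cT : Continuous fun y => symEntropy L (evolve K a₀ J T y) (evolve K' b₀ J' T y) :=
    cS.comp ((continuous_evolve hK.smooth Ha.integrable_init hT (Ha.integrable_flux hT)).prodMk
      (continuous_evolve hK'.smooth Hb.integrable_init hT (Hb.integrable_flux hT)))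
  have cI : Continuous fun y => symEntropy L (torusConv K a₀ y) (torusConv K' b₀ y) :=
    cS.comp ((continuous_torusConv hK.cont Ha.integrable_init).prodMk
      (continuous_torusConv hK'.cont Hb.integrable_init))
  have iF := integrable_entropyFlux hL ma.1 mb.1
    (spaceConv_mem_Icc hK.cont hK.nonneg hK.integral_eq (Ha.memLp T).1 (Ha.mem_Ioo T))
    (spaceConv_mem_Icc hK'.cont hK'.nonneg hK'.integral_eq (Hb.memLp T).1 (Hb.mem_Ioo T))
    (hK.memLp (Ha.memLp_grad T hT)) (hK'.memLp (Hb.memLp_grad T hT))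
    (hK.memLp (Ha.memLp_flux T hT)) (hK'.memLp (Hb.memLp_flux T hT))
  rw [← integral_sub cT.integrable_torus cI.integrable_torus]
  simp_rw [hpt]
  rw [integral_integral_swap (f := fun (y : Torus3) (t : ℝ) =>
      - (S (A (t, y)) (B (t, y)) * D (t, y)) - S (B (t, y)) (A (t, y)) * D' (t, y))
      iΦ.swap, integral_cyl iF]
  refine integral_congr_ae ?_
  -- At almost every time the evolved functions are the mollified slices, whose classical gradients
  -- are the mollified weak gradients; integration by parts is available there.
  filter_upwards [hA, hB, ae_time_Ioo_of_Ioi (T := T) le_rfl (Ha.grad.ae_hasTorusGrad hK.smooth),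
    ae_time_Ioo_of_Ioi (T := T) le_rfl (Hb.grad.ae_hasTorusGrad hK'.smooth),
    (Ha.integrable_flux hT).prod_right_ae, (Hb.integrable_flux hT).prod_right_ae]
    with t hAt hBt gA gB jA jB
  have hA' (y : Torus3) : A (t, y) = torusConv K (fun x => a (t, x)) y := (hAt y).symm
  have hB' (y : Torus3) : B (t, y) = torusConv K' (fun x => b (t, x)) y := (hBt y).symm
  simp_rw [hA', hB']
  have g1 := hasTorusGrad_entropy_deriv hL gA gB
  have g2 := hasTorusGrad_entropy_deriv hL gB gA
  have ibp1 := integral_mul_torusConvDiv hK.smooth jA g1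
  have ibp2 := integral_mul_torusConvDiv hK'.smooth jB g2
  have k1 : Integrable fun y => S (torusConv K (fun x => a (t, x)) y)
      (torusConv K' (fun x => b (t, x)) y) * D (t, y) :=
    (g1.cont.mul (continuous_torusConvDiv hK.smooth jA)).integrable_torus
  have k2 : Integrable fun y => S (torusConv K' (fun x => b (t, x)) y)
      (torusConv K (fun x => a (t, x)) y) * D' (t, y) :=
    (g2.cont.mul (continuous_torusConvDiv hK'.smooth jB)).integrable_torus
  have k3 : Integrable fun y => (inner ℝ (entropyField L (torusConv K (fun x => a (t, x)) y)
      (torusConv K' (fun x => b (t, x)) y) (torusConv K (fun x => v (t, x)) y)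
      (torusConv K' (fun x => w (t, x)) y)) (torusConv K (fun x => J (t, x)) y) : ℝ) :=
    (g1.cont_grad.inner (continuous_torusConv hK.cont jA)).integrable_torus
  have k4 : Integrable fun y => (inner ℝ (entropyField L (torusConv K' (fun x => b (t, x)) y)
      (torusConv K (fun x => a (t, x)) y) (torusConv K' (fun x => w (t, x)) y)
      (torusConv K (fun x => v (t, x)) y)) (torusConv K' (fun x => J' (t, x)) y) : ℝ) :=
    (g2.cont_grad.inner (continuous_torusConv hK'.cont jB)).integrable_torus
  have k1n := k1.neg
  refine (integral_sub k1n k2).trans ?_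
  refine Eq.trans ?_ (integral_add k3 k4).symm
  have ibp1' := (integral_neg _).trans ((neg_eq_iff_eq_neg.2 ibp1))
  refine (congrArg₂ (· - ·) ibp1' ibp2).trans ?_
  exact sub_neg_eq_add _ _

/-! ### The representative that is continuous in time -/

/-- Regard `f` as a time-independent function on `(0,1) × 𝕋³`; the time interval has length one, so
the norms agree. -/
theorem tendsto_eLpNorm_torusConv_moll {E : Type*} [NormedAddCommGroup E] [NormedSpace ℝ E]
    [CompleteSpace E] {f : Torus3 → E} (hf : MemLp f 2 volume) :
    Tendsto (fun n => eLpNorm (torusConv (moll n) f - f) 2 volume) atTop (𝓝 0) := by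
  have hprob : IsProbabilityMeasure ((volume : Measure ℝ).restrict (Ioo 0 1)) :=
    ⟨by simp⟩
  have hmp : MeasurePreserving (Prod.snd : ℝ × Torus3 → Torus3) (cyl (Ioo 0 1)) volume :=
    measurePreserving_snd
  refine (tendsto_eLpNorm_moll (hf.comp_measurePreserving hmp)).congr fun n => ?_
  have hm : AEStronglyMeasurable (torusConv (moll n) f - f) volume :=
    (continuous_torusConv (continuous_moll n) (hf.integrable one_le_two)).aestronglyMeasurable.sub
      hf.1
  exact eLpNorm_comp_measurePreserving hm hmp

section Triangle

variable {α E : Type*} [MeasurableSpace α] {μ : Measure α} [NormedAddCommGroup E]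

theorem toReal_eLpNorm_sub_le {f g h : α → E} (hf : MemLp f 2 μ) (hg : MemLp g 2 μ)
    (hh : MemLp h 2 μ) : (eLpNorm (f - g) 2 μ).toReal ≤
      (eLpNorm (f - h) 2 μ).toReal + (eLpNorm (g - h) 2 μ).toReal := by
  rw [← ENNReal.toReal_add (hf.sub hh).2.ne (hg.sub hh).2.ne]
  refine ENNReal.toReal_mono (ENNReal.add_ne_top.2 ⟨(hf.sub hh).2.ne, (hg.sub hh).2.ne⟩) ?_
  rw [← sub_sub_sub_cancel_right f g h]
  exact eLpNorm_sub_le (hf.sub hh).1 (hg.sub hh).1 one_le_two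

theorem tendsto_toReal_zero {f : ℕ → ENNReal} (h : Tendsto f atTop (𝓝 0)) :
    Tendsto (fun n => (f n).toReal) atTop (𝓝 0) := by
  simpa [Function.comp_def] using (ENNReal.tendsto_toReal ENNReal.zero_ne_top).comp h

end Triangle

theorem symEntropy_id (x y : ℝ) : symEntropy id x y = (x - y) ^ 2 := by
  simp [symEntropy, sq]

/-- For `L = id` the entropy is the squared distance and its flux is bilinear in the differences:
the identity becomes the `L²` energy identity. -/
theorem entropyFlux_id (a b : ℝ) (v w J J' : Vec3) :
    entropyFlux id a b v w J J' = 2 * inner ℝ (v - w) (J - J') := by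
  have h : deriv (id : ℝ → ℝ) = fun _ => 1 := by funext x; simp
  simp only [entropyFlux, entropyField, h, deriv_const', zero_mul, mul_one, zero_add,
    inner_sub_left, inner_sub_right, real_inner_smul_left]
  norm_num
  ring

theorem sq_toReal_eLpNorm_two {f : Torus3 → ℝ} (hf : MemLp f 2 volume) :
    (eLpNorm f 2 volume).toReal ^ 2 = ∫ x, f x ^ 2 := by
  have h := hf.eLpNorm_eq_integral_rpow_norm two_ne_zero ENNReal.ofNat_ne_top
  rw [h, ENNReal.toReal_ofReal (by positivity)]
  simp only [ENNReal.toReal_ofNat, Real.norm_eq_abs, Real.rpow_two, sq_abs]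
  rw [← Real.rpow_natCast, ← Real.rpow_mul (integral_nonneg fun x => sq_nonneg _)]
  norm_num

namespace IsFluxSolution

variable {a₀ : Torus3 → ℝ} {a : ℝ × Torus3 → ℝ} {v J : ℝ × Torus3 → Vec3}

theorem continuous_evolve (H : IsFluxSolution a₀ a v J) {K : Torus3 → ℝ} (hK : TorusSmooth K)
    {t : ℝ} (ht : 0 ≤ t) : Continuous (evolve K a₀ J t) := by
  rcases ht.eq_or_lt with rfl | ht
  · have : evolve K a₀ J 0 = torusConv K a₀ := by
      funext y; simp [evolve]
    rw [this]
    exact continuous_torusConv hK.hasTorusGrad.cont H.integrable_init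
  · exact MaxwellStefan.continuous_evolve hK H.integrable_init ht (H.integrable_flux ht)

theorem memLp_evolve (H : IsFluxSolution a₀ a v J) {K : Torus3 → ℝ} (hK : IsMollifier K)
    {t : ℝ} (ht : 0 ≤ t) : MemLp (evolve K a₀ J t) 2 volume :=
  MemLp.of_bound (H.continuous_evolve hK.smooth ht).aestronglyMeasurable 1
    (Eventually.of_forall fun y => by
      have := H.evolve_mem_Icc hK.smooth hK.nonneg hK.integral_eq ht y
      rw [Real.norm_eq_abs, abs_of_nonneg this.1]; exact this.2)

theorem memLp_init (H : IsFluxSolution a₀ a v J) : MemLp a₀ 2 volume :=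
  MemLp.of_bound H.meas_init 1 (H.init_mem.mono fun x hx => by
    rw [Real.norm_eq_abs, abs_of_nonneg hx.1]; exact hx.2)

/-- The distance of a solution from its mollification. -/
noncomputable def mollError (a₀ : Torus3 → ℝ) (v J : ℝ × Torus3 → Vec3) (T : ℝ) (n : ℕ) : ℝ :=
  (eLpNorm (torusConv (moll n) a₀ - a₀) 2 volume).toReal +
  (eLpNorm (spaceConv (moll n) v - v) 2 (cyl (Ioo 0 T))).toReal +
  (eLpNorm (spaceConv (moll n) J - J) 2 (cyl (Ioo 0 T))).toReal

theorem tendsto_mollError (H : IsFluxSolution a₀ a v J) {T : ℝ} (hT : 0 < T) :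
    Tendsto (mollError a₀ v J T) atTop (𝓝 0) := by
  have := ((tendsto_toReal_zero (tendsto_eLpNorm_torusConv_moll H.memLp_init)).add
    (tendsto_toReal_zero (tendsto_eLpNorm_moll (H.memLp_grad T hT)))).add
    (tendsto_toReal_zero (tendsto_eLpNorm_moll (H.memLp_flux T hT)))
  rw [add_zero, add_zero] at this
  exact this

theorem memLp_torusConv_init (H : IsFluxSolution a₀ a v J) {K : Torus3 → ℝ} (hK : IsMollifier K) :
    MemLp (torusConv K a₀) 2 volume := by
  have : torusConv K a₀ = evolve K a₀ J 0 := by funext y; simp [evolve]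
  rw [this]
  exact H.memLp_evolve hK le_rfl

/-- This is the energy identity for two mollifications of the same solution, with Cauchy-Schwarz for
the flux term. The errors are taken on all of `(0,T)`, so the bound is uniform in `t ≤ T`. -/
theorem eLpNorm_evolve_sub_le (H : IsFluxSolution a₀ a v J) {t T : ℝ} (ht : 0 < t) (htT : t ≤ T)
    (n m : ℕ) :
    (eLpNorm (evolve (moll n) a₀ J t - evolve (moll m) a₀ J t) 2 volume).toReal ≤
      2 * (mollError a₀ v J T n + mollError a₀ v J T m) := by
  have hT : 0 < T := ht.trans_le htT
  have hn := isMollifier_moll n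
  have hm := isMollifier_moll m
  have e := H.integral_symEntropy_evolve H hn hm contDiff_id ht
  simp_rw [symEntropy_id, entropyFlux_id] at e
  have k1 := sq_toReal_eLpNorm_two ((H.memLp_evolve hn ht.le).sub (H.memLp_evolve hm ht.le))
  have k0 := sq_toReal_eLpNorm_two ((H.memLp_torusConv_init hn).sub (H.memLp_torusConv_init hm))
  simp only [Pi.sub_apply] at k1 k0
  rw [← k1, ← k0, integral_const_mul] at e
  have mono {f : ℝ × Torus3 → Vec3} (hf : MemLp f 2 (cyl (Ioo 0 T))) :
      (eLpNorm f 2 (cyl (Ioo 0 t))).toReal ≤ (eLpNorm f 2 (cyl (Ioo 0 T))).toReal :=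
    ENNReal.toReal_mono hf.2.ne (eLpNorm_mono_measure f (cyl_mono (Ioo_subset_Ioo_right htT)))
  have b1 := abs_integral_inner_le
    ((hn.memLp (H.memLp_grad t ht)).sub (hm.memLp (H.memLp_grad t ht)))
    ((hn.memLp (H.memLp_flux t ht)).sub (hm.memLp (H.memLp_flux t ht)))
  simp only [Pi.sub_apply] at b1
  have b2 := (mono ((hn.memLp (H.memLp_grad T hT)).sub (hm.memLp (H.memLp_grad T hT)))).trans
    (toReal_eLpNorm_sub_le (hn.memLp (H.memLp_grad T hT)) (hm.memLp (H.memLp_grad T hT))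
      (H.memLp_grad T hT))
  have b3 := (mono ((hn.memLp (H.memLp_flux T hT)).sub (hm.memLp (H.memLp_flux T hT)))).trans
    (toReal_eLpNorm_sub_le (hn.memLp (H.memLp_flux T hT)) (hm.memLp (H.memLp_flux T hT))
      (H.memLp_flux T hT))
  have b4 := toReal_eLpNorm_sub_le (H.memLp_torusConv_init hn) (H.memLp_torusConv_init hm)
    H.memLp_init
  have b5 := b1.trans (mul_le_mul b2 b3 ENNReal.toReal_nonneg (by positivity))
  have b6 := (le_abs_self _).trans b5
  have hr (n : ℕ) : 0 ≤ mollError a₀ v J T n := by unfold mollError; positivity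
  refine abs_le_of_sq_le_sq' ?_ (by linarith [hr n, hr m]) |>.2
  unfold mollError
  set x := (eLpNorm (evolve (moll n) a₀ J t - evolve (moll m) a₀ J t) 2 volume).toReal
  set y := (eLpNorm (torusConv (moll n) a₀ - torusConv (moll m) a₀) 2 volume).toReal
  set p1 := (eLpNorm (torusConv (moll n) a₀ - a₀) 2 volume).toReal
  set p2 := (eLpNorm (torusConv (moll m) a₀ - a₀) 2 volume).toReal
  set q1 := (eLpNorm (spaceConv (moll n) v - v) 2 (cyl (Ioo 0 T))).toReal
  set q2 := (eLpNorm (spaceConv (moll m) v - v) 2 (cyl (Ioo 0 T))).toReal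
  set r1 := (eLpNorm (spaceConv (moll n) J - J) 2 (cyl (Ioo 0 T))).toReal
  set r2 := (eLpNorm (spaceConv (moll m) J - J) 2 (cyl (Ioo 0 T))).toReal
  have hy0 : 0 ≤ y := ENNReal.toReal_nonneg
  have hy : y ^ 2 ≤ (p1 + p2) ^ 2 := pow_le_pow_left₀ hy0 b4 2
  have hx : x ^ 2 ≤ (p1 + p2) ^ 2 + 2 * ((q1 + q2) * (r1 + r2)) := by linarith
  have hp : 0 ≤ p1 + p2 := by positivity
  have hq : 0 ≤ q1 + q2 := by positivity
  have hr' : 0 ≤ r1 + r2 := by positivity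
  have : 2 * (p1 + q1 + r1 + (p2 + q2 + r2)) = 2 * ((p1 + p2) + (q1 + q2) + (r1 + r2)) := by ring
  rw [this]
  -- With `P = p1 + p2`, `Q = q1 + q2`, `R = r1 + r2` one has `x² ≤ P² + 2QR ≤ (P + Q + R)²`, so the
  -- factor `2` leaves room.
  nlinarith [mul_nonneg hp hq, mul_nonneg hp hr', mul_nonneg hq hr', sq_nonneg (p1 + p2),
    sq_nonneg (q1 + q2), sq_nonneg (r1 + r2)]

/-- A solution has a representative which is continuous in time with values in `L²`; it is the limit
of the mollified solutions at every time. -/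
theorem exists_timeContinuousRep (H : IsFluxSolution a₀ a v J) :
    ∃ C : ℝ → Lp ℝ 2 (volume : Measure Torus3), IsTimeContinuousRep a C ∧
      ∀ t, 0 < t → Tendsto (fun n => eLpNorm (evolve (moll n) a₀ J t - (C t : Torus3 → ℝ)) 2 volume)
        atTop (𝓝 0) := by
  -- Replacing `t` by `max t 0` defines the curve on the whole line without changing it for `t ≥ 0`.
  let E : ℕ → ℝ → Lp ℝ 2 (volume : Measure Torus3) := fun n t =>
    (H.memLp_evolve (isMollifier_moll n) (le_max_right t 0)).toLp _
  have hEc (n : ℕ) : Continuous (E n) := by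
    rw [continuous_iff_seqContinuous]
    intro s t hst
    rw [Function.comp_def]
    refine (Lp.tendsto_Lp_iff_tendsto_eLpNorm''
      (fun k => evolve (moll n) a₀ J (max (s k) 0))
      (fun k => H.memLp_evolve (isMollifier_moll n) (le_max_right (s k) 0)) _
      (H.memLp_evolve (isMollifier_moll n) (le_max_right t 0))).2 ?_
    have hb (t : ℝ) (y : Torus3) := H.evolve_mem_Icc (torusSmooth_moll n) (moll_nonneg n)
      (integral_moll n) (le_max_right t 0) y
    refine tendsto_eLpNorm_two_zero_of_dominated
      (fun k => ((H.continuous_evolve (torusSmooth_moll n) (le_max_right (s k) 0)).sub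
        (H.continuous_evolve (torusSmooth_moll n) (le_max_right t 0))).aestronglyMeasurable)
      (memLp_const (1 : ℝ)) (fun k => Eventually.of_forall fun y => ?_)
      (Eventually.of_forall fun y => ?_)
    · rw [Pi.sub_apply, Real.norm_eq_abs, abs_le]
      constructor <;> linarith [(hb (s k) y).1, (hb (s k) y).2, (hb t y).1, (hb t y).2]
    · have hc : Continuous fun t => evolve (moll n) a₀ J (max t 0) y :=
        (H.continuousOn_evolve (torusSmooth_moll n) y).comp_continuous (by fun_prop)
          fun t => le_max_right t 0
      have := ((hc.tendsto t).comp hst).sub_const (evolve (moll n) a₀ J (max t 0) y)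
      simpa using this
  have hdist {t T : ℝ} (ht : 0 < t) (htT : t ≤ T) (n m : ℕ) :
      dist (E n t) (E m t) ≤ 2 * (mollError a₀ v J T n + mollError a₀ v J T m) := by
    rw [Lp.dist_edist, Lp.edist_toLp_toLp, max_eq_left ht.le]
    exact H.eLpNorm_evolve_sub_le ht htT n m
  -- The energy estimate is for positive times; the endpoint `0` follows by continuity of the
  -- curves.
  have hdist0 {t T : ℝ} (ht : 0 ≤ t) (htT : t ≤ T) (hT : 0 < T) (n m : ℕ) :
      dist (E n t) (E m t) ≤ 2 * (mollError a₀ v J T n + mollError a₀ v J T m) := by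
    rcases ht.eq_or_lt with rfl | ht
    · have hc : Tendsto (fun t => dist (E n t) (E m t)) (𝓝[>] 0) (𝓝 (dist (E n 0) (E m 0))) :=
        (((hEc n).dist (hEc m)).tendsto 0).mono_left nhdsWithin_le_nhds
      refine le_of_tendsto hc ?_
      filter_upwards [Ioc_mem_nhdsGT hT] with s hs using hdist hs.1 hs.2 n m
    · exact hdist ht htT n m
  have hunif {T : ℝ} (hT : 0 < T) : UniformCauchySeqOn E atTop (Icc 0 T) := by
    rw [Metric.uniformCauchySeqOn_iff]
    intro ε hε
    obtain ⟨N, hN⟩ := eventually_atTop.1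
      ((tendsto_order.1 (H.tendsto_mollError hT)).2 (ε / 4) (by linarith))
    refine ⟨N, fun m hm n hn t ht => (hdist0 ht.1 ht.2 hT m n).trans_lt ?_⟩
    linarith [hN m hm, hN n hn]
  -- At negative times the limit is given the arbitrary value `0`.
  have hlim (t : ℝ) : ∃ c, 0 ≤ t → Tendsto (fun n => E n t) atTop (𝓝 c) := by
    by_cases ht : 0 ≤ t
    · have : CauchySeq fun n => E n t :=
        (hunif (show 0 < t + 1 by linarith)).cauchy_map ⟨ht, by linarith⟩
      obtain ⟨c, hc⟩ := cauchySeq_tendsto_of_complete this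
      exact ⟨c, fun _ => hc⟩
    · exact ⟨0, fun h => absurd h ht⟩
  choose C hC using hlim
  have hlim' (t : ℝ) (ht : 0 < t) :
      Tendsto (fun n => eLpNorm (evolve (moll n) a₀ J t - (C t : Torus3 → ℝ)) 2 volume) atTop (𝓝 0) := by
    refine ((Lp.tendsto_Lp_iff_tendsto_eLpNorm' _ _).1 (hC t ht.le)).congr fun n => ?_
    refine eLpNorm_congr_ae ?_
    have := (H.memLp_evolve (isMollifier_moll n) (le_max_right t 0)).coeFn_toLp
    filter_upwards [this] with x hx
    have e : evolve (moll n) a₀ J (max t 0) x = evolve (moll n) a₀ J t x := by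
      rw [max_eq_left ht.le]
    simp only [E, Pi.sub_apply, hx, e]
  refine ⟨C, ⟨?_, ?_⟩, hlim'⟩
  · intro t ht
    have hT : 0 < t + 1 := by linarith [mem_Ici.1 ht]
    have hu : TendstoUniformlyOn E C atTop (Icc 0 (t + 1)) :=
      (hunif hT).tendstoUniformlyOn_of_tendsto fun s hs => hC s hs.1
    have hc := hu.continuousOn (Eventually.of_forall fun n => (hEc n).continuousOn).frequently
    refine (hc t ⟨ht, by linarith⟩).mono_of_mem_nhdsWithin ?_
    rw [← Ici_inter_Iic]
    exact inter_mem self_mem_nhdsWithin (mem_nhdsWithin_of_mem_nhds (Iic_mem_nhds (by linarith)))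
  -- At almost every time the evolved functions are the mollified slices; they converge in `L²` both
  -- to the slice of `a` and to `C t`, so these coincide.
  · filter_upwards [ae_all_iff.2 fun n => H.ae_eq_evolve (torusSmooth_moll n),
      ae_slice_of_ae_cyl H.mem, integrable_slice H.grad.integrable_fun,
      ae_restrict_mem measurableSet_Ioi] with t ht hm hi ht0
    have ma : MemLp (fun x => a (t, x)) 2 volume :=
      MemLp.of_bound hi.1 1 (hm.mono fun x hx => by
        rw [Real.norm_eq_abs, abs_of_nonneg hx.1]; exact hx.2)
    have l1 := tendsto_eLpNorm_torusConv_moll ma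
    have l2 := hlim' t ht0
    have e (n : ℕ) : torusConv (moll n) (fun x => a (t, x)) = evolve (moll n) a₀ J t :=
      funext (ht n)
    simp_rw [e] at l1
    have l := (tendsto_toReal_zero l1).add (tendsto_toReal_zero l2)
    rw [add_zero] at l
    have mE (n : ℕ) := H.memLp_evolve (isMollifier_moll n) (le_of_lt ht0)
    have hle (n : ℕ) : (eLpNorm ((C t : Torus3 → ℝ) - fun x => a (t, x)) 2 volume).toReal ≤
        (eLpNorm (evolve (moll n) a₀ J t - fun x => a (t, x)) 2 volume).toReal +
        (eLpNorm (evolve (moll n) a₀ J t - (C t : Torus3 → ℝ)) 2 volume).toReal := by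
      have := toReal_eLpNorm_sub_le (Lp.memLp (C t)) ma (mE n)
      rw [eLpNorm_sub_comm, eLpNorm_sub_comm _ (evolve (moll n) a₀ J t),
        eLpNorm_sub_comm _ (evolve (moll n) a₀ J t), add_comm] at this
      rwa [eLpNorm_sub_comm (C t : Torus3 → ℝ)]
    have h0 := le_antisymm (ge_of_tendsto' l hle) ENNReal.toReal_nonneg
    have h1 : eLpNorm ((C t : Torus3 → ℝ) - fun x => a (t, x)) 2 volume = 0 :=
      ((ENNReal.toReal_eq_zero_iff _).1 h0).resolve_right ((Lp.memLp (C t)).sub ma).2.ne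
    rw [eLpNorm_eq_zero_iff ((Lp.memLp (C t)).sub ma).1 two_ne_zero] at h1
    filter_upwards [h1] with x hx
    exact sub_eq_zero.1 hx

end IsFluxSolution

/-! ### The relative entropy identity -/

/-- The second subsequence is extracted from the first. -/
theorem exists_subseq_pair {α E F : Type*} [MeasurableSpace α] {μ : Measure α}
    [NormedAddCommGroup E] [NormedAddCommGroup F] {f : ℕ → α → E} {f' : α → E} {g : ℕ → α → F}
    {g' : α → F} (hf : ∀ n, AEStronglyMeasurable (f n) μ) (hf' : AEStronglyMeasurable f' μ)
    (hg : ∀ n, AEStronglyMeasurable (g n) μ) (hg' : AEStronglyMeasurable g' μ)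
    (tf : Tendsto (fun n => eLpNorm (f n - f') 2 μ) atTop (𝓝 0))
    (tg : Tendsto (fun n => eLpNorm (g n - g') 2 μ) atTop (𝓝 0)) :
    ∃ ns : ℕ → ℕ, StrictMono ns ∧ (∀ᵐ x ∂μ, Tendsto (fun n => f (ns n) x) atTop (𝓝 (f' x))) ∧
      ∀ᵐ x ∂μ, Tendsto (fun n => g (ns n) x) atTop (𝓝 (g' x)) := by
  obtain ⟨ns, hns, h1⟩ := exists_subseq_ae_of_eLpNorm_two hf hf' tf
  obtain ⟨ms, hms, h2⟩ := exists_subseq_ae_of_eLpNorm_two (fun n => hg (ns n)) hg'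
    (tg.comp hns.tendsto_atTop)
  exact ⟨ns ∘ ms, hns.comp hms, h1.mono fun x hx => hx.comp hms.tendsto_atTop, h2⟩

theorem exists_bound_square {Φ : ℝ → ℝ → ℝ} (h : Continuous fun q : ℝ × ℝ => Φ q.1 q.2) :
    ∃ M, ∀ x ∈ Icc (0 : ℝ) 1, ∀ y ∈ Icc (0 : ℝ) 1, |Φ x y| ≤ M := by
  obtain ⟨M, hM⟩ := ((isCompact_Icc (a := (0 : ℝ)) (b := 1)).prod
    (isCompact_Icc (a := (0 : ℝ)) (b := 1))).exists_bound_of_continuousOn h.continuousOn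
  exact ⟨M, fun x hx y hy => hM (x, y) ⟨hx, hy⟩⟩

theorem continuous_symEntropy {L : ℝ → ℝ} (hL : Continuous L) :
    Continuous fun q : ℝ × ℝ => symEntropy L q.1 q.2 := by unfold symEntropy; fun_prop

/-- Both coefficients are continuous functions of the pair of concentrations, hence bounded on the
unit square, and `tendsto_eLpNorm_bdd_smul` applies to each of the two products. -/
theorem tendsto_entropyField {L : ℝ → ℝ} (hL : ContDiff ℝ 2 L) {μ : Measure (ℝ × Torus3)}
    {a b : ℕ → ℝ × Torus3 → ℝ} {a' b' : ℝ × Torus3 → ℝ}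
    {v w : ℕ → ℝ × Torus3 → Vec3} {v' w' : ℝ × Torus3 → Vec3}
    (ha : ∀ n, AEStronglyMeasurable (a n) μ) (hb : ∀ n, AEStronglyMeasurable (b n) μ)
    (ha1 : ∀ n, ∀ᵐ p ∂μ, a n p ∈ Icc (0 : ℝ) 1) (hb1 : ∀ n, ∀ᵐ p ∂μ, b n p ∈ Icc (0 : ℝ) 1)
    (ta : ∀ᵐ p ∂μ, Tendsto (fun n => a n p) atTop (𝓝 (a' p)))
    (tb : ∀ᵐ p ∂μ, Tendsto (fun n => b n p) atTop (𝓝 (b' p)))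
    (hv : ∀ n, MemLp (v n) 2 μ) (hw : ∀ n, MemLp (w n) 2 μ) (hv' : MemLp v' 2 μ)
    (hw' : MemLp w' 2 μ) (tv : Tendsto (fun n => eLpNorm (v n - v') 2 μ) atTop (𝓝 0))
    (tw : Tendsto (fun n => eLpNorm (w n - w') 2 μ) atTop (𝓝 0)) :
    Tendsto (fun n => eLpNorm ((fun p => entropyField L (a n p) (b n p) (v n p) (w n p))
      - fun p => entropyField L (a' p) (b' p) (v' p) (w' p)) 2 μ) atTop (𝓝 0) := by
  have hL2 : ContDiff ℝ 1 (deriv L) :=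
    (contDiff_succ_iff_deriv.1 (show ContDiff ℝ (1 + 1) L by simpa [one_add_one_eq_two] using hL)).2.2
  have c1 := hL2.continuous
  have c2 := hL2.continuous_deriv le_rfl
  have cP : Continuous fun q : ℝ × ℝ => deriv (deriv L) q.1 * (q.1 - q.2) + 2 * deriv L q.1 := by
    fun_prop
  have cQ : Continuous fun q : ℝ × ℝ => deriv L q.1 + deriv L q.2 := by fun_prop
  obtain ⟨M, hM⟩ := exists_bound_square
    (Φ := fun x y => deriv (deriv L) x * (x - y) + 2 * deriv L x) cP
  obtain ⟨M', hM'⟩ := exists_bound_square (Φ := fun x y => deriv L x + deriv L y) cQ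
  have mP (n : ℕ) := cP.comp_aestronglyMeasurable ((ha n).prodMk (hb n))
  have mQ (n : ℕ) := cQ.comp_aestronglyMeasurable ((ha n).prodMk (hb n))
  have bP (n : ℕ) : ∀ᵐ p ∂μ,
      |deriv (deriv L) (a n p) * (a n p - b n p) + 2 * deriv L (a n p)| ≤ M := by
    filter_upwards [ha1 n, hb1 n] with p h1 h2 using hM _ h1 _ h2
  have bQ (n : ℕ) : ∀ᵐ p ∂μ, |deriv L (a n p) + deriv L (b n p)| ≤ M' := by
    filter_upwards [ha1 n, hb1 n] with p h1 h2 using hM' _ h1 _ h2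
  have t1 := tendsto_eLpNorm_bdd_smul (h := v) (h' := v') mP bP (by
    filter_upwards [ta, tb] with p h1 h2
    exact (cP.tendsto (a' p, b' p)).comp (h1.prodMk_nhds h2)) hv hv' tv
  have t2 := tendsto_eLpNorm_bdd_smul (h := w) (h' := w') mQ bQ (by
    filter_upwards [ta, tb] with p h1 h2
    exact (cQ.tendsto (a' p, b' p)).comp (h1.prodMk_nhds h2)) hw hw' tw
  have t := t1.add t2
  rw [add_zero] at t
  have ha' : AEStronglyMeasurable a' μ := aestronglyMeasurable_of_tendsto_ae atTop ha ta
  have hb' : AEStronglyMeasurable b' μ := aestronglyMeasurable_of_tendsto_ae atTop hb tb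
  refine tendsto_of_tendsto_of_tendsto_of_le_of_le tendsto_const_nhds t (fun _ => zero_le) fun n => ?_
  have e : ((fun p => entropyField L (a n p) (b n p) (v n p) (w n p))
      - fun p => entropyField L (a' p) (b' p) (v' p) (w' p)) =
      ((fun p => (deriv (deriv L) (a n p) * (a n p - b n p) + 2 * deriv L (a n p)) • v n p) -
        fun p => (deriv (deriv L) (a' p) * (a' p - b' p) + 2 * deriv L (a' p)) • v' p) -
      ((fun p => (deriv L (a n p) + deriv L (b n p)) • w n p) -
        fun p => (deriv L (a' p) + deriv L (b' p)) • w' p) := by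
    funext p
    simp only [Pi.sub_apply, entropyField]
    abel
  rw [e]
  exact eLpNorm_sub_le
    (((mP n).smul (hv n).1).sub ((cP.comp_aestronglyMeasurable (ha'.prodMk hb')).smul hv'.1))
    (((mQ n).smul (hw n).1).sub ((cQ.comp_aestronglyMeasurable (ha'.prodMk hb')).smul hw'.1))
    one_le_two

namespace IsFluxSolution

variable {a₀ : Torus3 → ℝ} {a b : ℝ × Torus3 → ℝ} {v w J J' : ℝ × Torus3 → Vec3}

/-- The representatives take values in `[0,1]`. -/
theorem rep_mem_Icc (H : IsFluxSolution a₀ a v J) {t : ℝ} (ht : 0 < t)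
    {C : Lp ℝ 2 (volume : Measure Torus3)}
    (hC : Tendsto (fun n => eLpNorm (evolve (moll n) a₀ J t - (C : Torus3 → ℝ)) 2 volume)
      atTop (𝓝 0)) : ∀ᵐ x, C x ∈ Icc (0 : ℝ) 1 := by
  obtain ⟨ns, -, h⟩ := exists_subseq_ae_of_eLpNorm_two
    (fun n => (H.memLp_evolve (isMollifier_moll n) ht.le).1) (Lp.memLp C).1 hC
  filter_upwards [h] with x hx
  exact isClosed_Icc.mem_of_tendsto hx (Eventually.of_forall fun n =>
    H.evolve_mem_Icc (torusSmooth_moll _) (moll_nonneg _) (integral_moll _) ht.le x)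

/-- The evolution of `∫ (L a - L b) (a - b)` for two solutions with the same initial datum. -/
theorem integral_symEntropy (Ha : IsFluxSolution a₀ a v J) (Hb : IsFluxSolution a₀ b w J')
    {L : ℝ → ℝ} (hL : ContDiff ℝ 2 L) {T : ℝ} (hT : 0 < T)
    {C C' : Lp ℝ 2 (volume : Measure Torus3)}
    (hC : Tendsto (fun n => eLpNorm (evolve (moll n) a₀ J T - (C : Torus3 → ℝ)) 2 volume)
      atTop (𝓝 0))
    (hC' : Tendsto (fun n => eLpNorm (evolve (moll n) a₀ J' T - (C' : Torus3 → ℝ)) 2 volume)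
      atTop (𝓝 0)) :
    ∫ x, symEntropy L (C x) (C' x) =
      ∫ p, entropyFlux L (a p) (b p) (v p) (w p) (J p) (J' p) ∂(cyl (Ioo 0 T)) := by
  have cS := continuous_symEntropy (hL.continuous)
  obtain ⟨M, hM⟩ := exists_bound_square cS
  obtain ⟨ns, hns, h1, h2⟩ := exists_subseq_pair
    (fun n => (Ha.memLp_evolve (isMollifier_moll n) hT.le).1) (Lp.memLp C).1
    (fun n => (Hb.memLp_evolve (isMollifier_moll n) hT.le).1) (Lp.memLp C').1 hC hC'
  have ma (n : ℕ) := (isMollifier_moll n).memLp (Ha.memLp T)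
  have mb (n : ℕ) := (isMollifier_moll n).memLp (Hb.memLp T)
  -- A single sequence of kernels must give almost everywhere convergence both at the final time `T`
  -- and on the cylinder.
  obtain ⟨ms, hms, h3, h4⟩ := exists_subseq_pair
    (fun n => (ma (ns n)).1) (Ha.memLp T).1 (fun n => (mb (ns n)).1) (Hb.memLp T).1
    ((tendsto_eLpNorm_moll (Ha.memLp T)).comp hns.tendsto_atTop)
    ((tendsto_eLpNorm_moll (Hb.memLp T)).comp hns.tendsto_atTop)
  have hk : Tendsto (fun n => ns (ms n)) atTop atTop := (hns.comp hms).tendsto_atTop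
  have limL : Tendsto (fun n => ∫ y, symEntropy L (evolve (moll (ns (ms n))) a₀ J T y)
      (evolve (moll (ns (ms n))) a₀ J' T y)) atTop (𝓝 (∫ x, symEntropy L (C x) (C' x))) := by
    refine tendsto_integral_of_dominated_convergence (fun _ => M) (fun n => ?_)
      (integrable_const M) (fun n => Eventually.of_forall fun y => ?_) ?_
    · exact (cS.comp ((Ha.continuous_evolve (torusSmooth_moll _) hT.le).prodMk
        (Hb.continuous_evolve (torusSmooth_moll _) hT.le))).aestronglyMeasurable
    · exact hM _ (Ha.evolve_mem_Icc (torusSmooth_moll _) (moll_nonneg _) (integral_moll _) hT.le y)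
        _ (Hb.evolve_mem_Icc (torusSmooth_moll _) (moll_nonneg _) (integral_moll _) hT.le y)
    · filter_upwards [h1, h2] with x hx hx'
      exact ((cS.tendsto (C x, C' x)).comp (hx.prodMk_nhds hx')).comp hms.tendsto_atTop
  have a1 (n : ℕ) := spaceConv_mem_Icc (continuous_moll n) (moll_nonneg n) (integral_moll n)
    (Ha.memLp T).1 (Ha.mem_Ioo T)
  have b1 (n : ℕ) := spaceConv_mem_Icc (continuous_moll n) (moll_nonneg n) (integral_moll n)
    (Hb.memLp T).1 (Hb.mem_Ioo T)
  have mv (n : ℕ) := (isMollifier_moll n).memLp (Ha.memLp_grad T hT)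
  have mw (n : ℕ) := (isMollifier_moll n).memLp (Hb.memLp_grad T hT)
  have mJ (n : ℕ) := (isMollifier_moll n).memLp (Ha.memLp_flux T hT)
  have mJ' (n : ℕ) := (isMollifier_moll n).memLp (Hb.memLp_flux T hT)
  have tv := (tendsto_eLpNorm_moll (Ha.memLp_grad T hT)).comp hk
  have tw := (tendsto_eLpNorm_moll (Hb.memLp_grad T hT)).comp hk
  have tJ := (tendsto_eLpNorm_moll (Ha.memLp_flux T hT)).comp hk
  have tJ' := (tendsto_eLpNorm_moll (Hb.memLp_flux T hT)).comp hk
  have F1 (n : ℕ) := memLp_entropyField hL (ma n).1 (mb n).1 (a1 n) (b1 n) (mv n) (mw n)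
  have F2 (n : ℕ) := memLp_entropyField hL (mb n).1 (ma n).1 (b1 n) (a1 n) (mw n) (mv n)
  have F1' := memLp_entropyField hL (Ha.memLp T).1 (Hb.memLp T).1 (Ha.mem_Ioo T) (Hb.mem_Ioo T)
    (Ha.memLp_grad T hT) (Hb.memLp_grad T hT)
  have F2' := memLp_entropyField hL (Hb.memLp T).1 (Ha.memLp T).1 (Hb.mem_Ioo T) (Ha.mem_Ioo T)
    (Hb.memLp_grad T hT) (Ha.memLp_grad T hT)
  have l1 := tendsto_integral_inner (fun n => F1 (ns (ms n))) (fun n => mJ (ns (ms n))) F1'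
    (Ha.memLp_flux T hT) (tendsto_entropyField hL (fun n => (ma (ns (ms n))).1)
      (fun n => (mb (ns (ms n))).1) (fun n => a1 (ns (ms n))) (fun n => b1 (ns (ms n))) h3 h4
      (fun n => mv (ns (ms n))) (fun n => mw (ns (ms n))) (Ha.memLp_grad T hT)
      (Hb.memLp_grad T hT) tv tw) tJ
  have l2 := tendsto_integral_inner (fun n => F2 (ns (ms n))) (fun n => mJ' (ns (ms n))) F2'
    (Hb.memLp_flux T hT) (tendsto_entropyField hL (fun n => (mb (ns (ms n))).1)
      (fun n => (ma (ns (ms n))).1) (fun n => b1 (ns (ms n))) (fun n => a1 (ns (ms n))) h4 h3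
      (fun n => mw (ns (ms n))) (fun n => mv (ns (ms n))) (Hb.memLp_grad T hT)
      (Ha.memLp_grad T hT) tw tv) tJ'
  refine tendsto_nhds_unique limL ?_
  unfold entropyFlux
  rw [integral_add (integrable_inner_of_memLp F1' (Ha.memLp_flux T hT))
    (integrable_inner_of_memLp F2' (Hb.memLp_flux T hT))]
  refine (l1.add l2).congr fun n => ?_
  have key := Ha.integral_symEntropy_evolve Hb (isMollifier_moll (ns (ms n)))
    (isMollifier_moll (ns (ms n))) hL hT
  -- The same kernel acts on the common datum, so the initial entropy is exactly zero before any
  -- limit is taken.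
  have h0 : ∀ y, symEntropy L (torusConv (moll (ns (ms n))) a₀ y)
      (torusConv (moll (ns (ms n))) a₀ y) = 0 := fun y => by simp [symEntropy]
  simp_rw [h0, integral_zero, sub_zero] at key
  rw [key]
  exact (integral_add (integrable_inner_of_memLp (F1 (ns (ms n))) (mJ (ns (ms n))))
    (integrable_inner_of_memLp (F2 (ns (ms n))) (mJ' (ns (ms n))))).symm

end IsFluxSolution

/-! ### Coercivity of the Maxwell-Stefan matrix -/

section Coercivity

variable {n : ℕ}

/-- Exchange `i` and `j` in one of two copies of the sum: since the weights are symmetric, the inner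
products add up to `‖u i - u j‖ ^ 2`. -/
theorem sum_symm_quadratic (m : Fin n → Fin n → ℝ) (hm : ∀ i j, m i j = m j i) (c : Fin n → ℝ)
    (u : Fin n → Vec3) :
    2 * ∑ i, ∑ j, m i j * (c i * c j) * inner ℝ (u i - u j) (u i) =
      ∑ i, ∑ j, m i j * (c i * c j) * ‖u i - u j‖ ^ 2 := by
  have h1 : ∑ i, ∑ j, m i j * (c i * c j) * (inner ℝ (u i - u j) (u i) : ℝ) =
      ∑ i, ∑ j, m i j * (c i * c j) * (inner ℝ (u j - u i) (u j) : ℝ) := by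
    rw [Finset.sum_comm]
    refine Finset.sum_congr rfl fun i _ => Finset.sum_congr rfl fun j _ => ?_
    rw [hm j i, mul_comm (c j)]
  rw [two_mul]
  nth_rewrite 2 [h1]
  rw [← Finset.sum_add_distrib]
  refine Finset.sum_congr rfl fun i _ => ?_
  rw [← Finset.sum_add_distrib]
  refine Finset.sum_congr rfl fun j _ => ?_
  rw [← mul_add, ← real_inner_self_eq_norm_sq]
  congr 1
  rw [← neg_sub (u i) (u j), inner_neg_left, inner_sub_right]
  ring

/-- On expanding, the sum over `j` gives `∑ c j = 1` in the square term and `∑ c j • u j = 0` in the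
cross term. -/
theorem sum_quadratic_eq {c : Fin n → ℝ} {u : Fin n → Vec3} (hc : ∑ i, c i = 1)
    (hu : ∑ i, c i • u i = 0) :
    ∑ i, ∑ j, c i * c j * inner ℝ (u i - u j) (u i) = ∑ i, c i * ‖u i‖ ^ 2 := by
  have h (i : Fin n) : ∑ j, c i * c j * (inner ℝ (u i - u j) (u i) : ℝ) = c i * ‖u i‖ ^ 2 := by
    have e (j : Fin n) : c i * c j * (inner ℝ (u i - u j) (u i) : ℝ) =
        c i * ‖u i‖ ^ 2 * c j - c i * inner ℝ (c j • u j) (u i) := by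
      rw [inner_sub_left, real_inner_self_eq_norm_sq, real_inner_smul_left]; ring
    simp_rw [e]
    rw [Finset.sum_sub_distrib, ← Finset.mul_sum, ← Finset.mul_sum, hc, ← sum_inner, hu,
      inner_zero_left]
    ring
  exact Finset.sum_congr rfl fun i _ => h i

/-- The force `∇c_i` determined by the fluxes. -/
noncomputable def force (D : Fin n → Fin n → ℝ) (c : Fin n → ℝ) (u : Fin n → Vec3) (i : Fin n) :
    Vec3 :=
  - ∑ j ∈ Finset.univ.erase i, (D i j)⁻¹ • (c j • (c i • u i) - c i • (c j • u j))

/-- A lower bound for the reciprocals of the diffusion coefficients. -/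
noncomputable def coercivity (D : Fin n → Fin n → ℝ) : ℝ := (1 + ∑ i, ∑ j, |D i j|)⁻¹

theorem coercivity_pos (D : Fin n → Fin n → ℝ) : 0 < coercivity D := by
  unfold coercivity
  have : 0 ≤ ∑ i, ∑ j, |D i j| :=
    Finset.sum_nonneg fun _ _ => Finset.sum_nonneg fun _ _ => abs_nonneg _
  positivity

theorem coercivity_le {D : Fin n → Fin n → ℝ} {i j : Fin n} (h : 0 < D i j) :
    coercivity D ≤ (D i j)⁻¹ := by
  unfold coercivity
  refine inv_anti₀ h ?_
  have h1 : |D i j| ≤ ∑ j, |D i j| :=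
    Finset.single_le_sum (f := fun j => |D i j|) (fun _ _ => abs_nonneg _) (Finset.mem_univ j)
  have h2 : ∑ j, |D i j| ≤ ∑ i, ∑ j, |D i j| :=
    Finset.single_le_sum (f := fun i => ∑ j, |D i j|)
      (fun _ _ => Finset.sum_nonneg fun _ _ => abs_nonneg _) (Finset.mem_univ i)
  linarith [le_abs_self (D i j)]

/-- After symmetrization the form is a weighted sum of `‖u i - u j‖ ^ 2` with weights `1 / D i j`.
Lowering all weights to one constant keeps the inequality, and the form with constant weights is
computed from the two constraints. -/
theorem sum_inner_force_le {D : Fin n → Fin n → ℝ} (hDsymm : ∀ i j, i ≠ j → D i j = D j i)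
    (hDpos : ∀ i j, i ≠ j → 0 < D i j) {c : Fin n → ℝ} {u : Fin n → Vec3}
    (hc0 : ∀ i, 0 ≤ c i) (hc : ∑ i, c i = 1) (hu : ∑ i, c i • u i = 0) :
    ∑ i, inner ℝ (force D c u i) (u i) ≤ - (coercivity D * ∑ i, c i * ‖u i‖ ^ 2) := by
  -- The diagonal value does not affect the sum because `u i - u i = 0`; this choice makes the lower
  -- bound valid for all pairs.
  let m : Fin n → Fin n → ℝ := fun i j => if i = j then coercivity D else (D i j)⁻¹
  have hm (i j : Fin n) : m i j = m j i := by
    by_cases h : i = j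
    · rw [h]
    · simp only [m, h, Ne.symm h, if_false, hDsymm i j h]
  have hmk (i j : Fin n) : coercivity D ≤ m i j := by
    by_cases h : i = j
    · simp [m, h]
    · simp only [m, h, if_false]; exact coercivity_le (hDpos i j h)
  have hS (i : Fin n) : inner ℝ (force D c u i) (u i) =
      - ∑ j, m i j * (c i * c j) * (inner ℝ (u i - u j) (u i) : ℝ) := by
    rw [force, inner_neg_left, sum_inner, ← Finset.sum_erase (a := i) Finset.univ (f := fun j =>
      m i j * (c i * c j) * (inner ℝ (u i - u j) (u i) : ℝ)) (by simp)]
    congr 1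
    refine Finset.sum_congr rfl fun j hj => ?_
    have hij : i ≠ j := (Finset.ne_of_mem_erase hj).symm
    simp only [m, hij, if_false, inner_sub_left, real_inner_smul_left]
    ring
  simp_rw [hS]
  rw [Finset.sum_neg_distrib, neg_le_neg_iff]
  have h1 := sum_symm_quadratic m hm c u
  have h2 := sum_symm_quadratic (fun _ _ => coercivity D) (fun _ _ => rfl) c u
  have h3 : ∑ i, ∑ j, coercivity D * (c i * c j) * (inner ℝ (u i - u j) (u i) : ℝ) =
      coercivity D * ∑ i, c i * ‖u i‖ ^ 2 := by
    rw [← sum_quadratic_eq hc hu, Finset.mul_sum]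
    refine Finset.sum_congr rfl fun i _ => ?_
    rw [Finset.mul_sum]
    exact Finset.sum_congr rfl fun j _ => by ring
  have h4 : ∑ i, ∑ j, coercivity D * (c i * c j) * ‖u i - u j‖ ^ 2 ≤
      ∑ i, ∑ j, m i j * (c i * c j) * ‖u i - u j‖ ^ 2 :=
    Finset.sum_le_sum fun i _ => Finset.sum_le_sum fun j _ => by
      have := mul_nonneg (hc0 i) (hc0 j)
      gcongr
      exact hmk i j
  rw [← h3]
  linarith

end Coercivity

/-! ### The logarithmic entropy -/

/-- The regularized logarithmic entropy density. -/
noncomputable def logEntropy (ε x : ℝ) : ℝ := (x + ε) * Real.log (x + ε)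

theorem contDiffOn_logEntropy {ε : ℝ} (hε : 0 < ε) : ContDiffOn ℝ 2 (logEntropy ε) (Ici 0) := by
  intro x hx
  have : x + ε ≠ 0 := by linarith [mem_Ici.1 hx]
  refine ContDiffAt.contDiffWithinAt ?_
  exact (contDiffAt_id.add contDiffAt_const).mul ((contDiffAt_id.add contDiffAt_const).log this)

theorem derivWithin_logEntropy {ε : ℝ} (hε : 0 < ε) {x : ℝ} (hx : x ∈ Ici (0 : ℝ)) :
    derivWithin (logEntropy ε) (Ici 0) x = Real.log (x + ε) + 1 := by
  have h0 : x + ε ≠ 0 := by linarith [mem_Ici.1 hx]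
  have h := (Real.hasDerivAt_mul_log h0).comp_add_const x ε
  exact h.hasDerivWithinAt.derivWithin (uniqueDiffOn_Ici 0 x hx)

theorem iteratedDerivWithin_two_logEntropy {ε : ℝ} (hε : 0 < ε) {x : ℝ} (hx : x ∈ Ici (0 : ℝ)) :
    iteratedDerivWithin 2 (logEntropy ε) (Ici 0) x = (x + ε)⁻¹ := by
  have h0 : x + ε ≠ 0 := by linarith [mem_Ici.1 hx]
  rw [iteratedDerivWithin_succ, iteratedDerivWithin_one]
  rw [derivWithin_congr (f := fun x => Real.log (x + ε) + 1)
    (fun y hy => derivWithin_logEntropy hε hy) (derivWithin_logEntropy hε hx)]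
  have h := ((Real.hasDerivAt_log h0).comp_add_const x ε).add_const 1
  exact h.hasDerivWithinAt.derivWithin (uniqueDiffOn_Ici 0 x hx)

/-- The argument `x + ε` stays in `[0,2]`, where `s log s` is continuous; uniformity in `ε` is what
survives the limit `ε → 0`. -/
theorem exists_bound_logEntropy :
    ∃ B, ∀ ε ∈ Ioc (0 : ℝ) 1, ∀ x ∈ Icc (0 : ℝ) 1, |logEntropy ε x| ≤ B := by
  obtain ⟨B, hB⟩ := (isCompact_Icc (a := (0 : ℝ)) (b := 2)).exists_bound_of_continuousOn
    Real.continuous_mul_log.continuousOn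
  exact ⟨B, fun ε hε x hx => hB (x + ε) ⟨by linarith [hx.1, hε.1], by linarith [hx.2, hε.2]⟩⟩

theorem continuous_logEntropy (ε : ℝ) : Continuous (logEntropy ε) :=
  Real.continuous_mul_log.comp (continuous_id.add continuous_const)

theorem iteratedDerivWithin_two_id {x : ℝ} (hx : x ∈ Ici (0 : ℝ)) :
    iteratedDerivWithin 2 (fun y : ℝ => y) (Ici 0) x = 0 := by
  rw [iteratedDerivWithin_succ, derivWithin_congr (f := fun _ => (1 : ℝ))
    (fun y hy => by
      rw [iteratedDerivWithin_one]; exact derivWithin_id' _ _ (uniqueDiffOn_Ici 0 y hy))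
    (by rw [iteratedDerivWithin_one]; exact derivWithin_id' _ _ (uniqueDiffOn_Ici 0 x hx))]
  simp

/-! ### Square integrability of the fluxes up to the initial time -/

/-- In this form the force has bounded coefficients multiplying the fields `√c u`, so it inherits
their square integrability. -/
theorem force_eq_sqrt {n : ℕ} (D : Fin n → Fin n → ℝ) {c : Fin n → ℝ} (hc : ∀ i, 0 ≤ c i)
    (u : Fin n → Vec3) (i : Fin n) :
    force D c u i = - ∑ j ∈ Finset.univ.erase i, (D i j)⁻¹ •
      ((c j * √(c i)) • (√(c i) • u i) - (c i * √(c j)) • (√(c j) • u j)) := by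
  unfold force
  congr 1
  refine Finset.sum_congr rfl fun j _ => ?_
  simp only [smul_smul, mul_assoc, Real.mul_self_sqrt (hc _)]

theorem exists_contDiff_bump_eq_one (T : ℝ) : ∃ ψ : ℝ → ℝ, ContDiff ℝ ∞ ψ ∧ HasCompactSupport ψ ∧
    ∀ t ∈ Icc 0 T, ψ t = 1 := by
  let ψ : ContDiffBump (0 : ℝ) := ⟨|T| + 1, |T| + 2, by positivity, by linarith⟩
  refine ⟨ψ, ψ.contDiff, ψ.hasCompactSupport, fun t ht => ψ.one_of_mem_closedBall ?_⟩
  rw [Metric.mem_closedBall, dist_zero_right, Real.norm_eq_abs, abs_of_nonneg ht.1]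
  exact (ht.2.trans (le_abs_self T)).trans (by simp [ψ])

namespace IsRenormalizedSolutionWith

variable {n : ℕ} {D : Fin n → Fin n → ℝ} {c0 : Fin n → Torus3 → ℝ}
  {c : Fin n → ℝ × Torus3 → ℝ} {u g : Fin n → ℝ × Torus3 → Vec3}

theorem mem_Icc (S : IsRenormalizedSolutionWith D c0 c u g) (i : Fin n) :
    ∀ᵐ p ∂(cyl (Ioi 0)), c i p ∈ Icc (0 : ℝ) 1 := S.bounds i

theorem aestronglyMeasurable_Ioo (S : IsRenormalizedSolutionWith D c0 c u g) (i : Fin n) {s T : ℝ}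
    (hs : 0 ≤ s) : AEStronglyMeasurable (c i) (cyl (Ioo s T)) :=
  (S.measurable i).mono_measure (cyl_mono (Ioo_subset_Ioi_zero hs))

theorem memLp_mul_vel (S : IsRenormalizedSolutionWith D c0 c u g) {s T : ℝ} (hs : 0 ≤ s)
    (hw : ∀ i, MemLp (fun p => √(c i p) • u i p) 2 (cyl (Ioo s T))) (i : Fin n) :
    MemLp (fun p => c i p • u i p) 2 (cyl (Ioo s T)) := by
  refine (memLp_bdd_smul (m := fun p => √(c i p)) (M := 1)
    (Real.continuous_sqrt.comp_aestronglyMeasurable (S.aestronglyMeasurable_Ioo i hs)) ?_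
    (hw i)).ae_eq ?_
  · filter_upwards [ae_Ioo_of_Ioi hs (S.mem_Icc i)] with p hp
    rw [abs_of_nonneg (Real.sqrt_nonneg _)]
    exact Real.sqrt_le_one.2 hp.2
  · filter_upwards [ae_Ioo_of_Ioi hs (S.mem_Icc i)] with p hp
    rw [smul_smul, Real.mul_self_sqrt hp.1]

theorem memLp_force (S : IsRenormalizedSolutionWith D c0 c u g) {s T : ℝ} (hs : 0 ≤ s)
    (hw : ∀ i, MemLp (fun p => √(c i p) • u i p) 2 (cyl (Ioo s T))) (i : Fin n) :
    MemLp (fun p => force D (fun j => c j p) (fun j => u j p) i) 2 (cyl (Ioo s T)) := by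
  have hI : ∀ᵐ p ∂(cyl (Ioo s T)), ∀ i, c i p ∈ Icc (0 : ℝ) 1 :=
    ae_all_iff.2 fun i => ae_Ioo_of_Ioi hs (S.mem_Icc i)
  have hm (j k : Fin n) : MemLp (fun p => (c j p * √(c k p)) • (√(c k p) • u k p)) 2
      (cyl (Ioo s T)) := by
    refine memLp_bdd_smul (M := 1) ((S.aestronglyMeasurable_Ioo j hs).mul
      (Real.continuous_sqrt.comp_aestronglyMeasurable (S.aestronglyMeasurable_Ioo k hs))) ?_ (hw k)
    filter_upwards [hI] with p hp
    rw [abs_of_nonneg (mul_nonneg (hp j).1 (Real.sqrt_nonneg _))]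
    exact mul_le_one₀ (hp j).2 (Real.sqrt_nonneg _) (Real.sqrt_le_one.2 (hp k).2)
  have hm' (j : Fin n) : MemLp (fun p => (c i p * √(c j p)) • (√(c j p) • u j p)) 2
      (cyl (Ioo s T)) := hm i j
  have hsum : MemLp (fun p => - ∑ j ∈ Finset.univ.erase i, (D i j)⁻¹ •
      ((c j p * √(c i p)) • (√(c i p) • u i p) - (c i p * √(c j p)) • (√(c j p) • u j p))) 2
      (cyl (Ioo s T)) :=
    (memLp_finsetSum _ fun j _ => ((hm j i).sub (hm' j)).const_smul (D i j)⁻¹).neg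
  refine hsum.ae_eq ?_
  filter_upwards [hI] with p hp
  exact (force_eq_sqrt D (fun j => (hp j).1) (fun j => u j p) i).symm

theorem locL2_force (S : IsRenormalizedSolutionWith D c0 c u g) (i : Fin n) :
    LocL2 (fun p => force D (fun j => c j p) (fun j => u j p) i) := fun s T hs hT =>
  S.memLp_force hs.le (fun j => S.sqrt_mul_vel_locL2 j s T hs hT) i

theorem hasWeakGradient_force (S : IsRenormalizedSolutionWith D c0 c u g) (i : Fin n) :
    HasWeakGradient (c i) (fun p => force D (fun j => c j p) (fun j => u j p) i) :=
  S.linear_system i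

/-- The chain rule `∇c = 2 √c ∇√c`. -/
theorem two_sqrt_smul_grad (S : IsRenormalizedSolutionWith D c0 c u g) (i : Fin n) :
    ∀ᵐ p ∂(cyl (Ioi 0)), (2 * √(c i p)) • g i p =
      force D (fun j => c j p) (fun j => u j p) i := by
  have hsq : ∀ᵐ p ∂(cyl (Ioi 0)), √(c i p) ∈ Icc (0 : ℝ) 1 :=
    (S.mem_Icc i).mono fun p hp => ⟨Real.sqrt_nonneg _, Real.sqrt_le_one.2 hp.2⟩
  -- The chain rule for the square of `√c` yields a second weak gradient of `c`; uniqueness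
  -- identifies it with the force.
  have h := (S.grad_sqrt i).comp (S.grad_sqrt_locL2 i) hsq (Φ := fun x => x ^ 2)
    (contDiff_id.pow 2)
  have h' := h.congr_fun (f' := c i) ((S.mem_Icc i).mono fun p hp => Real.sq_sqrt hp.1)
  have h2 : LocL2 (fun p => deriv (fun x : ℝ => x ^ 2) √(c i p) • g i p) := fun s T hs hT => by
    refine memLp_bdd_smul (M := 2) ?_ ?_ (S.grad_sqrt_locL2 i s T hs hT)
    · have : Continuous (deriv fun x : ℝ => x ^ 2) :=
        ((contDiff_id.pow 2 : ContDiff ℝ 1 fun x : ℝ => x ^ 2)).continuous_deriv le_rfl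
      exact this.comp_aestronglyMeasurable
        (Real.continuous_sqrt.comp_aestronglyMeasurable (S.aestronglyMeasurable_Ioo i hs.le))
    · filter_upwards [ae_Ioo_of_Ioi hs.le hsq] with p hp
      simp only [deriv_pow_field]
      rw [abs_of_nonneg (by have := hp.1; positivity)]
      simpa using hp.2
  filter_upwards [h'.unique (S.hasWeakGradient_force i) h2 (S.locL2_force i)] with p hp
  rw [← hp]
  simp

/-- Since `∇c = 2 √c ∇√c`, the pairing of `2 ∇√c` with `√c u` equals that of the force with `u`.
Coercivity thus becomes a bound between fields that are locally square integrable, without dividing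
by `c`. -/
theorem ae_flux_sum_sqrt (S : IsRenormalizedSolutionWith D c0 c u g)
    (hDsymm : ∀ i j, i ≠ j → D i j = D j i) (hDpos : ∀ i j, i ≠ j → 0 < D i j) :
    ∀ᵐ p ∂(cyl (Ioi 0)), coercivity D * ∑ i, ‖√(c i p) • u i p‖ ^ 2 ≤
      - ∑ i, 2 * (inner ℝ (g i p) (√(c i p) • u i p) : ℝ) := by
  filter_upwards [ae_all_iff.2 fun i => S.mem_Icc i, ae_all_iff.2 fun i => S.two_sqrt_smul_grad i,
    S.sum_eq_one, S.flux_sum] with p h1 h2 h3 h4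
  have h := sum_inner_force_le hDsymm hDpos (c := fun i => c i p) (u := fun i => u i p)
    (fun i => (h1 i).1) h3 h4
  have e1 (i : Fin n) : ‖√(c i p) • u i p‖ ^ 2 = c i p * ‖u i p‖ ^ 2 := by
    rw [norm_smul, mul_pow, Real.norm_eq_abs, sq_abs, Real.sq_sqrt (h1 i).1]
  have e2 (i : Fin n) : 2 * (inner ℝ (g i p) (√(c i p) • u i p) : ℝ) =
      inner ℝ (force D (fun j => c j p) (fun j => u j p) i) (u i p) := by
    rw [← h2 i, real_inner_smul_left, real_inner_smul_right]; ring
  simp_rw [e1, e2]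
  linarith

/-- Integrability down to the initial time is part of the renormalized formulation: use a test
function that is one on `[0,T]` and constant in space. -/
theorem integrable_dissipation (S : IsRenormalizedSolutionWith D c0 c u g) (i : Fin n) {ε : ℝ}
    (hε : 0 < ε) (T : ℝ) :
    Integrable (fun p => c i p * (c i p + ε)⁻¹ * inner ℝ (g i p) (√(c i p) • u i p))
      (cyl (Ioo 0 T)) := by
  obtain ⟨ψ, hψ, hψc, hψ1⟩ := exists_contDiff_bump_eq_one T
  have h := (S.renormalized i _ (contDiffOn_logEntropy hε) _
    ((TorusSmooth.const 1).isTestFunction hψ hψc 0)).2.1.mono_measure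
      (cyl_mono (Ioo_subset_Ioi_zero (T := T) le_rfl))
  refine h.congr ?_
  filter_upwards [ae_Ioo_of_Ioi le_rfl (S.mem_Icc i),
    ae_cyl_of_ae_fst (ae_restrict_mem measurableSet_Ioo)] with p hp ht
  rw [iteratedDerivWithin_two_logEntropy hε hp.1, hψ1 _ (Ioo_subset_Icc_self ht)]
  ring

theorem integrable_logEntropy (S : IsRenormalizedSolutionWith D c0 c u g) (i : Fin n) (ε T : ℝ) :
    Integrable (fun p => logEntropy ε (c i p)) (cyl (Ioo 0 T)) := by
  obtain ⟨B, hB⟩ := (continuous_logEntropy ε).exists_bound_Icc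
  exact Integrable.of_bound ((continuous_logEntropy ε).comp_aestronglyMeasurable
    (S.aestronglyMeasurable_Ioo i le_rfl)) B
    ((ae_Ioo_of_Ioi le_rfl (S.mem_Icc i)).mono fun p hp => hB _ hp)

/-- The entropy balance. -/
theorem ae_integral_logEntropy (S : IsRenormalizedSolutionWith D c0 c u g) (i : Fin n) {ε : ℝ}
    (hε : 0 < ε) : ∀ᵐ t ∂((volume : Measure ℝ).restrict (Ioi 0)),
      ∫ x, logEntropy ε (c i (t, x)) = (∫ x, logEntropy ε (c0 i x)) + ∫ s in 0..t,
        2 * ∫ x, c i (s, x) * (c i (s, x) + ε)⁻¹ *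
          inner ℝ (g i (s, x)) (√(c i (s, x)) • u i (s, x)) := by
  refine ae_eq_primitive (fun T hT => ?_) (fun T hT => ?_) fun ψ hψ hψc => ?_
  · rw [integrableOn_Ioc_iff_integrableOn_Ioo]
    exact (S.integrable_logEntropy i ε T).integral_prod_left
  · rw [integrableOn_Ioc_iff_integrableOn_Ioo]
    exact (S.integrable_dissipation i hε T).integral_prod_left.const_mul 2
  obtain ⟨T, hT, hψT⟩ := hψc.exists_pos_vanishing
  obtain ⟨B', hB'⟩ := hψc.deriv.exists_bound_norm (hψ.continuous_deriv (by simp))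
  obtain ⟨-, h2, h3⟩ := S.renormalized i _ (contDiffOn_logEntropy hε) _
    ((TorusSmooth.const 1).isTestFunction hψ hψc 0)
  -- The test function does not depend on `x`, so the transport term drops out of the balance.
  have eg (p : ℝ × Torus3) : spaceGrad (fun p => ψ p.1 * 1) p = - ψ p.1 • torusGrad (fun _ => 1) _ :=
    spaceGrad_mul_kernel (TorusSmooth.const 1) ψ 0 p
  have et (p : ℝ × Torus3) : timeDeriv (fun p => ψ p.1 * 1) p = deriv ψ p.1 * 1 :=
    timeDeriv_mul_kernel (K := fun _ => 1) hψ 0 p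
  simp_rw [eg, et, torusGrad_const, Pi.zero_apply, smul_zero, inner_zero_right, mul_zero, integral_zero,
    mul_one] at h3
  simp_rw [mul_one] at h2
  have j1 : Integrable (fun p : ℝ × Torus3 => logEntropy ε (c i p) * deriv ψ p.1)
      (cyl (Ioi 0)) :=
    integrable_cyl_Ioi_of_vanishing ((S.integrable_logEntropy i ε T).mul_bdd (c := B')
      (((hψ.continuous_deriv (by simp)).comp continuous_fst).aestronglyMeasurable)
      (Eventually.of_forall fun p => hB' _)) fun p hp => by rw [(hψT _ hp).2, mul_zero]
  have ae2 : (fun p : ℝ × Torus3 => c i p * iteratedDerivWithin 2 (logEntropy ε) (Ici 0) (c i p) *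
      inner ℝ (g i p) (√(c i p) • u i p) * ψ p.1) =ᵐ[cyl (Ioi 0)] fun p =>
      c i p * (c i p + ε)⁻¹ * inner ℝ (g i p) (√(c i p) • u i p) * ψ p.1 := by
    filter_upwards [S.mem_Icc i] with p hp
    rw [iteratedDerivWithin_two_logEntropy hε hp.1]
  have j2 := h2.congr ae2
  rw [integral_congr_ae ae2, integral_cyl j1, integral_cyl j2, integral_mul_const] at h3
  simp_rw [integral_mul_const] at h3
  rw [← integral_const_mul, add_zero] at h3
  simp_rw [← mul_assoc] at h3 ⊢
  exact h3

/-- The dissipation between two times is a difference of entropies, bounded uniformly in `ε`. On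
intervals away from `0` one may let `ε → 0`, and coercivity then gives a bound on `∑ c |u|²` that
does not depend on the interval. -/
theorem exists_bound_dissipation (S : IsRenormalizedSolutionWith D c0 c u g)
    (hDsymm : ∀ i j, i ≠ j → D i j = D j i) (hDpos : ∀ i j, i ≠ j → 0 < D i j) :
    ∃ B, ∀ s T, 0 < s → s < T →
      ∫ p, ∑ i, ‖√(c i p) • u i p‖ ^ 2 ∂(cyl (Ioo s T)) ≤ B := by
  obtain ⟨B, hB⟩ := exists_bound_logEntropy
  let ε : ℕ → ℝ := fun k => 1 / ((k : ℝ) + 1)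
  have hε (k : ℕ) : ε k ∈ Ioc (0 : ℝ) 1 :=
    ⟨Nat.one_div_pos_of_nat, by
      simp only [ε]; rw [div_le_one (by positivity)]; linarith [Nat.cast_nonneg (α := ℝ) k]⟩
  have ht : Tendsto ε atTop (𝓝 0) := tendsto_one_div_add_atTop_nhds_zero_nat
  have hgood : ∀ᵐ t ∂((volume : Measure ℝ).restrict (Ioi 0)), (∀ i (k : ℕ),
      ∫ x, logEntropy (ε k) (c i (t, x)) = (∫ x, logEntropy (ε k) (c0 i x)) + ∫ s in 0..t,
        2 * ∫ x, c i (s, x) * (c i (s, x) + ε k)⁻¹ *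
          inner ℝ (g i (s, x)) (√(c i (s, x)) • u i (s, x))) ∧
      ∀ i, ∀ᵐ x, c i (t, x) ∈ Icc (0 : ℝ) 1 :=
    (ae_all_iff.2 fun i => ae_all_iff.2 fun k => S.ae_integral_logEntropy i (hε k).1).and
      (ae_all_iff.2 fun i => ae_slice_of_ae_cyl (S.mem_Icc i))
  have hiw (i : Fin n) {s T : ℝ} (hs : 0 < s) (hT : s < T) := integrable_inner_of_memLp
    (S.grad_sqrt_locL2 i s T hs hT) (S.sqrt_mul_vel_locL2 i s T hs hT)
  have hsq (i : Fin n) {s T : ℝ} (hs : 0 < s) (hT : s < T) :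
      Integrable (fun p => ‖√(c i p) • u i p‖ ^ 2) (cyl (Ioo s T)) :=
    (S.sqrt_mul_vel_locL2 i s T hs hT).integrable_norm_pow two_ne_zero
  have hdiss (k : ℕ) (i : Fin n) {s T : ℝ} (hs : 0 < s) :
      Integrable (fun p => c i p * (c i p + ε k)⁻¹ * inner ℝ (g i p) (√(c i p) • u i p))
        (cyl (Ioo s T)) :=
    (S.integrable_dissipation i (hε k).1 T).mono_measure (cyl_mono (Ioo_subset_Ioo_left hs.le))
  let P (t : ℝ) : Prop := (∀ i (k : ℕ),
      ∫ x, logEntropy (ε k) (c i (t, x)) = (∫ x, logEntropy (ε k) (c0 i x)) + ∫ s in 0..t,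
        2 * ∫ x, c i (s, x) * (c i (s, x) + ε k)⁻¹ *
          inner ℝ (g i (s, x)) (√(c i (s, x)) • u i (s, x))) ∧
      ∀ i, ∀ᵐ x, c i (t, x) ∈ Icc (0 : ℝ) 1
  have hbd {t : ℝ} (ht : P t) (i : Fin n) (k : ℕ) : |∫ x, logEntropy (ε k) (c i (t, x))| ≤ B := by
    have := norm_integral_le_of_norm_le_const (μ := (volume : Measure Torus3))
      (f := fun x => logEntropy (ε k) (c i (t, x))) (C := B)
      ((ht.2 i).mono fun x hx => hB (ε k) (hε k) _ hx)
    simpa using this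
  -- Subtract the entropy balances at the two times; each entropy is at most `B` in absolute value.
  have hlow {s T : ℝ} (hs : 0 < s) (hT : s < T) (Ps : P s) (PT : P T) (i : Fin n) (k : ℕ) :
      - (2 * B) ≤ 2 * ∫ p, c i p * (c i p + ε k)⁻¹ * inner ℝ (g i p) (√(c i p) • u i p)
        ∂(cyl (Ioo s T)) := by
    have hint (t : ℝ) (ht : 0 < t) : IntervalIntegrable (fun s => 2 * ∫ x, c i (s, x) *
        (c i (s, x) + ε k)⁻¹ * inner ℝ (g i (s, x)) (√(c i (s, x)) • u i (s, x))) volume 0 t := by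
      rw [intervalIntegrable_iff_integrableOn_Ioc_of_le ht.le, integrableOn_Ioc_iff_integrableOn_Ioo]
      exact (S.integrable_dissipation i (hε k).1 t).integral_prod_left.const_mul 2
    rw [integral_cyl (hdiss k i hs), ← integral_const_mul, ← integral_Ioc_eq_integral_Ioo,
      ← intervalIntegral.integral_of_le hT.le,
      ← intervalIntegral.integral_interval_sub_left (hint T (hs.trans hT)) (hint s hs)]
    have h1 := Ps.1 i k
    have h2 := PT.1 i k
    have h3 := abs_le.1 (hbd Ps i k)
    have h4 := abs_le.1 (hbd PT i k)
    linarith [h3.1, h3.2, h4.1, h4.2]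
  -- The majorant is integrable because the interval stays away from `0`. Where `c` vanishes so does
  -- `√c u`, hence the pointwise limit also holds there.
  have hlim {s T : ℝ} (hs : 0 < s) (hT : s < T) (i : Fin n) :
      Tendsto (fun k => ∫ p, c i p * (c i p + ε k)⁻¹ * inner ℝ (g i p) (√(c i p) • u i p)
        ∂(cyl (Ioo s T))) atTop (𝓝 (∫ p, inner ℝ (g i p) (√(c i p) • u i p)
        ∂(cyl (Ioo s T)))) := by
    refine tendsto_integral_of_dominated_convergence
      (fun p => |(inner ℝ (g i p) (√(c i p) • u i p) : ℝ)|) (fun k => (hdiss k i hs).1)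
      (hiw i hs hT).abs (fun k => ?_) ?_
    · filter_upwards [ae_Ioo_of_Ioi hs.le (S.mem_Icc i)] with p hp
      have hpos : 0 < c i p + ε k := add_pos_of_nonneg_of_pos hp.1 (hε k).1
      rw [Real.norm_eq_abs, abs_mul, ← div_eq_mul_inv, abs_of_nonneg (div_nonneg hp.1 hpos.le)]
      refine mul_le_of_le_one_left (abs_nonneg _) ?_
      rw [div_le_one hpos]
      linarith [(hε k).1]
    · filter_upwards [ae_Ioo_of_Ioi hs.le (S.mem_Icc i)] with p hp
      rcases hp.1.eq_or_lt with h0 | h0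
      · simp [← h0]
      have : Tendsto (fun k => c i p * (c i p + ε k)⁻¹ *
          (inner ℝ (g i p) (√(c i p) • u i p) : ℝ)) atTop
          (𝓝 (c i p * (c i p + 0)⁻¹ * inner ℝ (g i p) (√(c i p) • u i p))) :=
        (((ht.const_add (c i p)).inv₀ (by simpa using h0.ne')).const_mul _).mul_const _
      rwa [add_zero, mul_inv_cancel₀ h0.ne', one_mul] at this
  have hκ := coercivity_pos D
  have hkey {s T : ℝ} (hs : 0 < s) (hT : s < T) (Ps : P s) (PT : P T) :
      ∫ p, ∑ i, ‖√(c i p) • u i p‖ ^ 2 ∂(cyl (Ioo s T)) ≤ (coercivity D)⁻¹ * (n * (2 * B)) := by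
    rw [← div_eq_inv_mul, le_div_iff₀' hκ, ← integral_const_mul]
    calc ∫ p, coercivity D * ∑ i, ‖√(c i p) • u i p‖ ^ 2 ∂(cyl (Ioo s T))
        ≤ ∫ p, - ∑ i, 2 * (inner ℝ (g i p) (√(c i p) • u i p) : ℝ) ∂(cyl (Ioo s T)) :=
          integral_mono_ae ((integrable_finsetSum _ fun i _ => hsq i hs hT).const_mul _)
            (integrable_finsetSum _ fun i _ => (hiw i hs hT).const_mul 2).neg
            (ae_Ioo_of_Ioi hs.le (S.ae_flux_sum_sqrt hDsymm hDpos))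
      _ = - ∑ i, 2 * ∫ p, (inner ℝ (g i p) (√(c i p) • u i p) : ℝ) ∂(cyl (Ioo s T)) := by
          rw [integral_neg, integral_finsetSum _ fun i _ => (hiw i hs hT).const_mul 2]
          simp_rw [integral_const_mul]
      _ ≤ ∑ _i : Fin n, 2 * B := by
          rw [← Finset.sum_neg_distrib]
          refine Finset.sum_le_sum fun i _ => ?_
          have := ge_of_tendsto' ((hlim hs hT i).const_mul 2) (hlow hs hT Ps PT i)
          linarith
      _ = n * (2 * B) := by simp
  -- The balance holds at almost every time, so an arbitrary interval can be enlarged to one with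
  -- good endpoints.
  have hex {a b : ℝ} (ha : 0 ≤ a) (hab : a < b) : ∃ t ∈ Ioo a b, P t := by
    have h : ∀ᵐ t ∂((volume : Measure ℝ).restrict (Ioo a b)), P t := ae_time_Ioo_of_Ioi ha hgood
    have : NeZero ((volume : Measure ℝ).restrict (Ioo a b)) :=
      ⟨by simp [Measure.restrict_eq_zero, hab]⟩
    exact ((ae_restrict_mem measurableSet_Ioo).and h).exists
  refine ⟨(coercivity D)⁻¹ * (n * (2 * B)), fun s T hs hT => ?_⟩
  obtain ⟨s', hs', Ps⟩ := hex le_rfl hs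
  obtain ⟨T', hT', PT⟩ := hex (hs.trans hT).le (lt_add_one T)
  have hsT : s' < T' := hs'.2.trans (hT.trans hT'.1)
  refine le_trans ?_ (hkey hs'.1 hsT Ps PT)
  exact integral_mono_measure (cyl_mono (Ioo_subset_Ioo hs'.2.le hT'.1.le))
    (Eventually.of_forall fun p => Finset.sum_nonneg fun i _ => sq_nonneg _)
    (integrable_finsetSum _ fun i _ => hsq i hs'.1 hsT)

/-- The bound on `(s,T)` is independent of `s`, so exhausting `(0,T)` by such intervals gives
integrability of the square up to the initial time. -/
theorem memLp_sqrt_mul_vel (S : IsRenormalizedSolutionWith D c0 c u g)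
    (hDsymm : ∀ i j, i ≠ j → D i j = D j i) (hDpos : ∀ i j, i ≠ j → 0 < D i j) (i : Fin n) (T : ℝ) :
    MemLp (fun p => √(c i p) • u i p) 2 (cyl (Ioo 0 T)) := by
  obtain ⟨B, hB⟩ := S.exists_bound_dissipation hDsymm hDpos
  have hm : AEStronglyMeasurable (fun p => √(c i p) • u i p) (cyl (Ioo 0 T)) :=
    (aestronglyMeasurable_cyl_Ioi fun s T hs hT =>
      (S.sqrt_mul_vel_locL2 i s T hs hT).1).mono_measure (cyl_mono (Ioo_subset_Ioi_zero le_rfl))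
  rw [memLp_two_iff_integrable_sq_norm hm]
  have hsq (i : Fin n) {s T : ℝ} (hs : 0 < s) (hT : s < T) :
      Integrable (fun p => ‖√(c i p) • u i p‖ ^ 2) (cyl (Ioo s T)) :=
    (S.sqrt_mul_vel_locL2 i s T hs hT).integrable_norm_pow two_ne_zero
  rcases le_or_gt T 0 with hT | hT
  · rw [Ioo_eq_empty (not_lt.2 hT)]
    simp [cyl]
  let s : ℕ → ℝ := fun m => T / ((m : ℝ) + 2)
  have hs0 (m : ℕ) : 0 < s m := by positivity
  have hsT (m : ℕ) : s m < T := div_lt_self hT (by linarith [Nat.cast_nonneg (α := ℝ) m])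
  have hst : Tendsto s atTop (𝓝 0) := tendsto_const_nhds.div_atTop
    (tendsto_atTop_add_const_right _ _ tendsto_natCast_atTop_atTop)
  have hr (m : ℕ) : (cyl (Ioo 0 T)).restrict (Ioo (s m) T ×ˢ univ) = cyl (Ioo (s m) T) :=
    cyl_restrict measurableSet_Ioo (Ioo_subset_Ioo_left (hs0 m).le)
  have hcov : AECover (cyl (Ioo 0 T)) atTop fun m => Ioo (s m) T ×ˢ (univ : Set Torus3) := by
    refine ⟨?_, fun m => measurableSet_Ioo.prod MeasurableSet.univ⟩
    filter_upwards [ae_cyl_of_ae_fst (ae_restrict_mem measurableSet_Ioo)] with p hp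
    filter_upwards [hst.eventually_lt_const hp.1] with m hm
    exact ⟨⟨hm, hp.2⟩, mem_univ _⟩
  refine hcov.integrable_of_integral_norm_bounded B (fun m => ?_) (Eventually.of_forall fun m => ?_)
  · rw [IntegrableOn, hr]
    exact hsq i (hs0 m) (hsT m)
  · rw [hr]
    refine le_trans (integral_mono (hsq i (hs0 m) (hsT m)).norm
      (integrable_finsetSum _ fun j _ => hsq j (hs0 m) (hsT m)) fun p => ?_)
      (hB _ _ (hs0 m) (hsT m))
    simp only [norm_pow, norm_norm]
    exact Finset.single_le_sum (f := fun j => ‖√(c j p) • u j p‖ ^ 2)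
      (fun _ _ => sq_nonneg _) (Finset.mem_univ i)

/-- Each component of a renormalized solution solves a linear equation with square integrable flux
and gradient. -/
theorem isFluxSolution (S : IsRenormalizedSolutionWith D c0 c u g)
    (hDsymm : ∀ i j, i ≠ j → D i j = D j i) (hDpos : ∀ i j, i ≠ j → 0 < D i j)
    (hc0 : IsInitialDatum c0) (i : Fin n) :
    IsFluxSolution (c0 i) (c i) (fun p => force D (fun j => c j p) (fun j => u j p) i)
      (fun p => c i p • u i p) where
  meas_init := hc0.measurable i
  init_mem := by
    filter_upwards [ae_all_iff.2 hc0.nonneg, hc0.sum_eq_one] with x h0 h1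
    exact ⟨h0 i, h1 ▸ Finset.single_le_sum (f := fun j => c0 j x) (fun j _ => h0 j)
      (Finset.mem_univ i)⟩
  mem := S.mem_Icc i
  grad := S.hasWeakGradient_force i
  memLp_grad T _ := S.memLp_force le_rfl (fun j => S.memLp_sqrt_mul_vel hDsymm hDpos j T) i
  memLp_flux T _ := S.memLp_mul_vel le_rfl (fun j => S.memLp_sqrt_mul_vel hDsymm hDpos j T) i
  weak φ hφ := by
    -- With `β = id` the second-order term vanishes and the transport term becomes the flux `c u`.
    obtain ⟨-, -, h⟩ := S.renormalized i (fun y => y) contDiffOn_id φ hφ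
    have e1 : ∫ p, √(c i p) * derivWithin (fun y : ℝ => y) (Ici 0) (c i p) *
        inner ℝ (√(c i p) • u i p) (spaceGrad φ p) ∂(cyl (Ioi 0)) =
        ∫ p, inner ℝ (c i p • u i p) (spaceGrad φ p) ∂(cyl (Ioi 0)) := by
      refine integral_congr_ae ?_
      filter_upwards [S.mem_Icc i] with p hp
      rw [derivWithin_id' _ _ (uniqueDiffOn_Ici 0 _ hp.1), mul_one, ← real_inner_smul_left,
        smul_smul, Real.mul_self_sqrt hp.1]
    have e2 : ∫ p, c i p * iteratedDerivWithin 2 (fun y : ℝ => y) (Ici 0) (c i p) *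
        inner ℝ (g i p) (√(c i p) • u i p) * φ p ∂(cyl (Ioi 0)) = 0 := by
      refine integral_eq_zero_of_ae ?_
      filter_upwards [S.mem_Icc i] with p hp
      rw [iteratedDerivWithin_two_id hp.1]
      simp
    rw [e1, e2] at h
    simpa using h

end IsRenormalizedSolutionWith

/-! ### The regularized logarithm -/

/-- A smooth function on the line which agrees with `log (x + δ)` for nonnegative `x`. -/
noncomputable def smoothLog (δ x : ℝ) : ℝ :=
  Real.smoothTransition ((x + δ / 2) * (4 / δ)) * Real.log (x + δ)

/-- The transition rises from zero at `-δ/2` to one at `-δ/4`, well to the right of the singularity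
at `-δ`. Agreement on an open set containing `[0,∞)` lets the derivatives be computed as well. -/
theorem smoothLog_eq {δ x : ℝ} (hδ : 0 < δ) (hx : - (δ / 4) < x) :
    smoothLog δ x = Real.log (x + δ) := by
  rw [smoothLog, Real.smoothTransition.one_of_one_le, one_mul]
  rw [← mul_div_assoc, le_div_iff₀ hδ]
  linarith

theorem contDiff_smoothLog {δ : ℝ} (hδ : 0 < δ) : ContDiff ℝ 2 (smoothLog δ) := by
  rw [contDiff_iff_contDiffAt]
  intro x
  have hs : ContDiff ℝ 2 fun x => Real.smoothTransition ((x + δ / 2) * (4 / δ)) :=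
    Real.smoothTransition.contDiff.comp ((contDiff_id.add contDiff_const).mul contDiff_const)
  rcases lt_or_ge (-δ) x with h | h
  · exact hs.contDiffAt.mul ((contDiffAt_id.add contDiffAt_const).log
      (by simp only [id]; linarith))
  · refine (contDiffAt_const (c := (0 : ℝ))).congr_of_eventuallyEq ?_
    filter_upwards [Iio_mem_nhds (show x < - (δ / 2) by linarith)] with y hy
    rw [smoothLog, Real.smoothTransition.zero_of_nonpos, zero_mul]
    have hy' : y + δ / 2 ≤ 0 := by linarith [mem_Iio.1 hy]
    exact mul_nonpos_of_nonpos_of_nonneg hy' (by positivity)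

theorem deriv_smoothLog {δ x : ℝ} (hδ : 0 < δ) (hx : - (δ / 4) < x) :
    deriv (smoothLog δ) x = (x + δ)⁻¹ := by
  have h : smoothLog δ =ᶠ[𝓝 x] fun y => Real.log (y + δ) := by
    filter_upwards [Ioi_mem_nhds hx] with y hy using smoothLog_eq hδ hy
  rw [h.deriv_eq]
  exact ((Real.hasDerivAt_log (show x + δ ≠ 0 by linarith)).comp_add_const x δ).deriv

theorem deriv_deriv_smoothLog {δ x : ℝ} (hδ : 0 < δ) (hx : - (δ / 4) < x) :
    deriv (deriv (smoothLog δ)) x = - ((x + δ) ^ 2)⁻¹ := by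
  have h : deriv (smoothLog δ) =ᶠ[𝓝 x] fun y => (y + δ)⁻¹ := by
    filter_upwards [Ioi_mem_nhds hx] with y hy using deriv_smoothLog hδ hy
  rw [h.deriv_eq]
  exact ((hasDerivAt_inv (show x + δ ≠ 0 by linarith)).comp_add_const x δ).deriv

/-- Here `L' = 1/(a + δ)` and `L'' = -1/(a + δ)²`, so `L''(a)(a - b) + 2 L'(a) = (a + b + 2δ)/(a +
δ)²` and `L'(a) + L'(b) = (a + b + 2δ)/((a + δ)(b + δ))`. The factor `a + b + 2δ` therefore comes
out of both entropy fields, leaving multiples of the same difference of logarithmic gradients. -/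
theorem entropyFlux_smoothLog {δ a b : ℝ} (hδ : 0 < δ) (ha : 0 ≤ a) (hb : 0 ≤ b)
    (v w V W : Vec3) : entropyFlux (smoothLog δ) a b v w (a • V) (b • W) =
      (a + b + 2 * δ) * inner ℝ ((a + δ)⁻¹ • v - (b + δ)⁻¹ • w)
        ((a / (a + δ)) • V - (b / (b + δ)) • W) := by
  have ha' : - (δ / 4) < a := by linarith
  have hb' : - (δ / 4) < b := by linarith
  have h1 : a + δ ≠ 0 := by linarith
  have h2 : b + δ ≠ 0 := by linarith
  simp only [entropyFlux, entropyField, deriv_smoothLog hδ ha', deriv_smoothLog hδ hb',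
    deriv_deriv_smoothLog hδ ha', deriv_deriv_smoothLog hδ hb', inner_sub_left, inner_sub_right,
    real_inner_smul_left, real_inner_smul_right]
  field_simp
  ring

namespace IsRenormalizedSolutionWith

variable {n : ℕ} {D : Fin n → Fin n → ℝ} {c0 : Fin n → Torus3 → ℝ}
  {c : Fin n → ℝ × Torus3 → ℝ} {u g : Fin n → ℝ × Torus3 → Vec3}

theorem hasWeakGradient_log (S : IsRenormalizedSolutionWith D c0 c u g) {δ : ℝ} (hδ : 0 < δ)
    (i : Fin n) : HasWeakGradient (fun p => Real.log (c i p + δ))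
      (fun p => (c i p + δ)⁻¹ • force D (fun j => c j p) (fun j => u j p) i) := by
  have h := (S.hasWeakGradient_force i).comp (S.locL2_force i) (S.mem_Icc i)
    ((contDiff_smoothLog hδ).of_le one_le_two)
  refine (h.congr_fun ?_).congr_grad ?_
  · filter_upwards [S.mem_Icc i] with p hp
    exact smoothLog_eq hδ (by linarith [hp.1])
  · filter_upwards [S.mem_Icc i] with p hp
    rw [deriv_smoothLog hδ (by linarith [hp.1])]

theorem memLp_inv_smul (S : IsRenormalizedSolutionWith D c0 c u g) {δ : ℝ} (hδ : 0 < δ) (i : Fin n)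
    {T : ℝ} {h : ℝ × Torus3 → Vec3} (hh : MemLp h 2 (cyl (Ioo 0 T))) :
    MemLp (fun p => (c i p + δ)⁻¹ • h p) 2 (cyl (Ioo 0 T)) := by
  refine memLp_bdd_smul (M := δ⁻¹) ?_ ?_ hh
  · exact ((S.aestronglyMeasurable_Ioo i le_rfl).aemeasurable.add_const δ).inv.aestronglyMeasurable
  · filter_upwards [ae_Ioo_of_Ioi le_rfl (S.mem_Icc i)] with p hp
    have : 0 < c i p + δ := by linarith [hp.1]
    rw [abs_of_nonneg (inv_nonneg.2 this.le)]
    exact inv_anti₀ hδ (by linarith [hp.1])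

theorem memLp_log_vel (S : IsRenormalizedSolutionWith D c0 c u g) {δ : ℝ} (hδ : 0 < δ) (i : Fin n)
    {T : ℝ} (hJ : MemLp (fun p => c i p • u i p) 2 (cyl (Ioo 0 T))) :
    MemLp (fun p => (c i p / (c i p + δ)) • u i p) 2 (cyl (Ioo 0 T)) := by
  convert S.memLp_inv_smul hδ i hJ using 2 with p
  rw [smul_smul, div_eq_inv_mul]

end IsRenormalizedSolutionWith

end MaxwellStefan

/-! ### The relative entropy identity for renormalized solutions. -/

theorem corollary2p4 {n : ℕ} (D : Fin n → Fin n → ℝ)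
    (hDsymm : ∀ i j, i ≠ j → D i j = D j i) (hDpos : ∀ i j, i ≠ j → 0 < D i j)
    (c0 : Fin n → Torus3 → ℝ) (hc0 : IsInitialDatum c0)
    (c cbar : Fin n → ℝ × Torus3 → ℝ) (u ubar : Fin n → ℝ × Torus3 → Vec3)
    (hc : IsRenormalizedSolution D c0 c u)
    (hcbar : IsRenormalizedSolution D c0 cbar ubar) :
    ∃ C Cbar : Fin n → ℝ → Lp ℝ 2 (volume : Measure Torus3),
      (∀ i, IsTimeContinuousRep (c i) (C i)) ∧
      (∀ i, IsTimeContinuousRep (cbar i) (Cbar i)) ∧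
      ∀ δ : ℝ, 0 < δ →
        ∃ G : Fin n → ℝ × Torus3 → Vec3,
          (∀ i, HasWeakGradient
            (fun p => Real.log (c i p + δ) - Real.log (cbar i p + δ)) (G i)) ∧
          ∀ T : ℝ, 0 < T →
            (∀ i, MemLp (G i) 2 (cyl (Ioo 0 T))) ∧
            (∀ i, MemLp (fun p => (c i p / (c i p + δ)) • u i p) 2 (cyl (Ioo 0 T))) ∧
            (∀ i, MemLp (fun p => (cbar i p / (cbar i p + δ)) • ubar i p) 2
              (cyl (Ioo 0 T))) ∧
            (∀ i, Integrable (fun p => (c i p + cbar i p + 2 * δ) *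
              inner ℝ (G i p) ((c i p / (c i p + δ)) • u i p
                - (cbar i p / (cbar i p + δ)) • ubar i p)) (cyl (Ioo 0 T))) ∧
            (∀ i, Integrable (fun x => (Real.log (C i T x + δ) - Real.log (Cbar i T x + δ))
              * (C i T x - Cbar i T x)) volume) ∧
            symRelEntropy δ (fun i => C i T) (fun i => Cbar i T) =
              ∑ i, ∫ p, (c i p + cbar i p + 2 * δ) *
                inner ℝ (G i p) ((c i p / (c i p + δ)) • u i p
                  - (cbar i p / (cbar i p + δ)) • ubar i p) ∂(cyl (Ioo 0 T)) := by
  obtain ⟨g, S⟩ := hc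
  obtain ⟨gbar, Sbar⟩ := hcbar
  have H := S.isFluxSolution hDsymm hDpos hc0
  have Hbar := Sbar.isFluxSolution hDsymm hDpos hc0
  choose C hC hCt using fun i => (H i).exists_timeContinuousRep
  choose Cbar hCbar hCbart using fun i => (Hbar i).exists_timeContinuousRep
  -- The gradient is given by the chain rule, with `∇c` expressed through the fluxes by the force
  -- relation.
  refine ⟨C, Cbar, hC, hCbar, fun δ hδ => ⟨fun i p =>
    (c i p + δ)⁻¹ • force D (fun j => c j p) (fun j => u j p) i
      - (cbar i p + δ)⁻¹ • force D (fun j => cbar j p) (fun j => ubar j p) i,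
    fun i => (S.hasWeakGradient_log hδ i).sub (Sbar.hasWeakGradient_log hδ i), fun T hT => ?_⟩⟩
  have hcI (i : Fin n) := (H i).mem_Ioo T
  have hcbarI (i : Fin n) := (Hbar i).mem_Ioo T
  have hL := contDiff_smoothLog hδ
  have hflux (i : Fin n) := integrable_entropyFlux hL ((H i).memLp T).1 ((Hbar i).memLp T).1
    (hcI i) (hcbarI i) ((H i).memLp_grad T hT) ((Hbar i).memLp_grad T hT)
    ((H i).memLp_flux T hT) ((Hbar i).memLp_flux T hT)
  have hfe (i : Fin n) : (fun p => entropyFlux (smoothLog δ) (c i p) (cbar i p)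
      (force D (fun j => c j p) (fun j => u j p) i)
      (force D (fun j => cbar j p) (fun j => ubar j p) i) (c i p • u i p) (cbar i p • ubar i p))
      =ᵐ[cyl (Ioo 0 T)] fun p => (c i p + cbar i p + 2 * δ) *
        inner ℝ ((c i p + δ)⁻¹ • force D (fun j => c j p) (fun j => u j p) i
          - (cbar i p + δ)⁻¹ • force D (fun j => cbar j p) (fun j => ubar j p) i)
          ((c i p / (c i p + δ)) • u i p - (cbar i p / (cbar i p + δ)) • ubar i p) := by
    filter_upwards [hcI i, hcbarI i] with p h1 h2
    exact entropyFlux_smoothLog hδ h1.1 h2.1 _ _ _ _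
  -- The time-continuous representatives must be nonnegative at the fixed time `T`, so that the
  -- smooth logarithm can be replaced by the true one.
  have hCI (i : Fin n) := (H i).rep_mem_Icc hT (hCt i T hT)
  have hCbarI (i : Fin n) := (Hbar i).rep_mem_Icc hT (hCbart i T hT)
  have hse (i : Fin n) : (fun x => symEntropy (smoothLog δ) (C i T x) (Cbar i T x)) =ᵐ[volume]
      fun x => (Real.log (C i T x + δ) - Real.log (Cbar i T x + δ)) * (C i T x - Cbar i T x) := by
    filter_upwards [hCI i, hCbarI i] with x h1 h2
    rw [symEntropy, smoothLog_eq hδ (by linarith [h1.1]), smoothLog_eq hδ (by linarith [h2.1])]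
  have hint (i : Fin n) : Integrable (fun x => (Real.log (C i T x + δ)
      - Real.log (Cbar i T x + δ)) * (C i T x - Cbar i T x)) volume := by
    have cS := continuous_symEntropy hL.continuous
    obtain ⟨M, hM⟩ := exists_bound_square cS
    refine Integrable.congr (Integrable.of_bound (cS.comp_aestronglyMeasurable
      ((Lp.memLp (C i T)).1.prodMk (Lp.memLp (Cbar i T)).1)) M ?_) (hse i)
    filter_upwards [hCI i, hCbarI i] with x h1 h2 using hM _ h1 _ h2
  refine ⟨fun i => (S.memLp_inv_smul hδ i ((H i).memLp_grad T hT)).sub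
      (Sbar.memLp_inv_smul hδ i ((Hbar i).memLp_grad T hT)),
    fun i => S.memLp_log_vel hδ i ((H i).memLp_flux T hT),
    fun i => Sbar.memLp_log_vel hδ i ((Hbar i).memLp_flux T hT),
    fun i => (hflux i).congr (hfe i), hint, ?_⟩
  rw [symRelEntropy, integral_finsetSum _ fun i _ => hint i]
  refine Finset.sum_congr rfl fun i _ => ?_
  rw [← integral_congr_ae (hfe i), ← integral_congr_ae (hse i)]
  exact (H i).integral_symEntropy (Hbar i) hL hT (hCt i T hT) (hCbart i T hT)
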